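/- Let $V$ be a unitary vertex operator algebra of CFT type, $V=\mathbb C|0\rangle\oplus\bigoplus_{n\ge1}V_{(n)}$, with anti-linear involution $\theta$ and positive definite invariant Hermitian form $\langle\cdot,\cdot\rangle$, and let $\Phi\ni|0\rangle$ be a homogeneous orthonormal basis of $V$ with $\theta(a)=a$ for all $a\in\Phi$. Let $0<x_0<x_1<\dots$ be integers, let $X_N$ be the initial segment of $x_N$ natural numbers (so $X_N\subset X_{N+1}\subset\mathbb N$), and let $G_N$ be a permutation group of $X_N$. $G_N$ acts on functions $g:X_N\to\Phi$ by $(\sigma g)(x)=g(\sigma^{-1}x)$; the weight of $g$ is $|g|=\sum_x\mathrm{wt}(g(x))$, its support is $\{x: g(x)\ne|0\rangle\}$, and $b_n(G_N)$ is the number of $G_N$-orbits of functions of weight $n$. For $\mathcal K\subset X_N$ let $\hat G_N^{\mathcal K}$ be the pointwise stabilizer of $\mathcal K$ in $G_N$ and $G^N(\mathcal K)$ the group of permutations of $\mathcal K$ induced by the setwise stabilizer. Let $V^{G_N}=(V^{\otimes X_N})^{G_N}$ be the fixed point VOA, with $G_N$ permuting the tensor factors. Assume that $\{G_N\}$ is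 nested oligomorphic, i.e. 1. for every $n$ the sequence $b_n(G_N)$ is eventually constant in $N$; 2. for every finite $\mathcal K\subset\mathbb N$ there is a group $G(\mathcal K)$ with $G^N(\mathcal K)=G(\mathcal K)$ for all large $N$; 3. the restriction of $G_{N+1}$ to $X_N$ is contained in $G_N$, in the following sense: for every $\sigma\in G_{N+1}$ there is $\tau\in G_N$ with $\tau(i)=\sigma(i)$ for all $i\in X_N$ with $\sigma(i)\in X_N$. For finite sets $\mathcal K_1,\mathcal K_2,\mathcal K_3\subset X_N$ and $\kappa\in G_N^3$ put $$M(\kappa,N)=\left(\frac{|\hat G_N^{\mathcal K_1}||\hat G_N^{\mathcal K_2}||\hat G_N^{\mathcal K_3}|}{|G_N|\,|\hat G_N^{\kappa_1\mathcal K_1\cup\kappa_2\mathcal K_2\cup\kappa_3\mathcal K_3}|^2}\right)^{1/2}.$$ Assume that $M(\kappa,N)$ converges to a finite limit as $N\to\infty$ for every configuration $\kappa$ in which no point lies in exactly one of the three sets $\kappa_i\mathcal K_i$. Here a configuration is followed along $N$ by keeping the finite sets $\mathcal K_i$ and $\kappa_i\mathcal K_i\subset\mathbb N$ fixed for all large $N$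 (with $\kappa=\kappa^{(N)}\in G_N^3$). Then the fixed point VOAs $V^{G_N}$ have a large $N$ vertex algebra limit, in the following sense. Call a set $B=\bigcup_n B_n$ of finitely supported functions $g:\mathbb N\to\Phi$, with $B_n$ its part of weight $n$, a system of $N$-independent representatives if for every $n$ there is $N_n$ such that all $g\in B_n$ are supported in $X_{N_n}$ and, for all $N\ge N_n$, the restrictions to $X_N$ of the elements of $B_n$ represent each $G_N$-orbit of functions $X_N\to\Phi$ of weight $n$ exactly once. For $g\in B$ let $\phi_g^N\in V^{G_N}$ be the unit vector $A^{-1/2}\sum_{\sigma\in G_N}\bigotimes_{x\in X_N}(\sigma g)(x)$, where $A>0$ is the normalizing constant. Then such a system exists, and for every such system $B$: * for every $n$ and all large $N$, $(\phi^N_g)_{g\in B_n}$ is an orthonormal basis of $(V^{G_N})_{(n)}$; * for all $g_1,g_2,g_3\in B$ the structure constants $f^N_{g_1g_2g_3}=\langle\phi^N_{g_1},(\phi^N_{g_2})_{|g_3|+|g_2|-|g_1|-1}\,\phi^N_{g_3}\rangle$ of $V^{G_N}$ converge to a limit $f_{g_1g_2g_3}$ as $N\to\infty$; * the space $\bar V=\bigoplus_n\bigoplus_{g\in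 B_n}\mathbb C\phi_g$ with $Y(\phi_{g_2},z)\phi_{g_3}=\sum_{g_1}f_{g_1g_2g_3}\,\phi_{g_1}z^{|g_1|-|g_2|-|g_3|}$ and vacuum $\phi_{|0\rangle}$ (the constant function $|0\rangle$) is a vertex algebra. -/

import Mathlib

open Filter Topology

noncomputable section

/-! ## Vertex algebras and unitary vertex operator algebras -/

/-- A vertex algebra over `ℂ`: vacuum, state-field map `Y`, translation operator `T`; the axioms are
the vacuum property, the creation property, translation covariance and locality
`(z - w) ^ K * [Y(a, z), Y(b, w)] = 0`, all written in modes `Y(a, z) = ∑ a₍ₙ₎ z ^ (- n - 1)`. -/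
structure VertexAlgebra (V : Type*) [AddCommGroup V] [Module ℂ V] where
  vac : V
  Y : V →ₗ[ℂ] VertexOperator ℂ V
  T : V →ₗ[ℂ] V
  vac_mode_neg_one : ∀ b : V, VertexOperator.ncoeff (Y vac) (-1) b = b
  vac_mode_of_ne : ∀ (n : ℤ) (b : V), n ≠ -1 → VertexOperator.ncoeff (Y vac) n b = 0
  creation_neg_one : ∀ a : V, VertexOperator.ncoeff (Y a) (-1) vac = a
  creation_of_nonneg : ∀ (a : V) (n : ℤ), 0 ≤ n → VertexOperator.ncoeff (Y a) n vac = 0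
  translation_vac : T vac = 0
  translation : ∀ (a b : V) (n : ℤ),
    T (VertexOperator.ncoeff (Y a) n b) - VertexOperator.ncoeff (Y a) n (T b)
      = -(n : ℂ) • VertexOperator.ncoeff (Y a) (n - 1) b
  locality : ∀ a b : V, ∃ K : ℕ, ∀ (m n : ℤ) (c : V),
    ∑ j ∈ Finset.range (K + 1), ((-1 : ℂ) ^ j * (K.choose j : ℂ)) •
      (VertexOperator.ncoeff (Y a) (m + K - j) (VertexOperator.ncoeff (Y b) (n + j) c)
        - VertexOperator.ncoeff (Y b) (n + j) (VertexOperator.ncoeff (Y a) (m + K - j) c)) = 0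

/-- The mode `a₍ₙ₎ b`, as a bilinear map in `a` and `b`. -/
def VertexAlgebra.mode {V : Type*} [AddCommGroup V] [Module ℂ V] (A : VertexAlgebra V) (n : ℤ) :
    V →ₗ[ℂ] V →ₗ[ℂ] V :=
  (LinearMap.proj n).comp (VertexOperator.ncoeff.comp A.Y)

/-- A vertex operator algebra: a vertex algebra with a conformal vector whose modes
`L n = conf₍ₙ₊₁₎` satisfy the Virasoro relations, with `L (-1) = T`, graded by the eigenvalues of
`L 0`, which are integers bounded below with finite multiplicity. -/
structure VertexOperatorAlgebra (V : Type*) [AddCommGroup V] [Module ℂ V]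
    extends VertexAlgebra V where
  conf : V
  centralCharge : ℂ
  virasoro : ∀ (m n : ℤ) (v : V),
    toVertexAlgebra.mode (m + 1) conf (toVertexAlgebra.mode (n + 1) conf v)
      - toVertexAlgebra.mode (n + 1) conf (toVertexAlgebra.mode (m + 1) conf v)
      = ((m : ℂ) - n) • toVertexAlgebra.mode (m + n + 1) conf v
        + (if m + n = 0 then centralCharge / 12 * ((m : ℂ) ^ 3 - m) else 0) • v
  mode_zero_conf : ∀ v : V, toVertexAlgebra.mode 0 conf v = T v
  iSup_weight : ⨆ n : ℤ, Module.End.eigenspace (toVertexAlgebra.mode 1 conf) (n : ℂ) = ⊤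
  finite_weight : ∀ n : ℤ,
    Module.Finite ℂ (Module.End.eigenspace (toVertexAlgebra.mode 1 conf) (n : ℂ))
  bounded_weight : ∃ n₀ : ℤ, ∀ n < n₀,
    Module.End.eigenspace (toVertexAlgebra.mode 1 conf) (n : ℂ) = ⊥

namespace VertexOperatorAlgebra

variable {V : Type*} [AddCommGroup V] [Module ℂ V]

/-- The Virasoro operator `L n`, where `Y(conf, z) = ∑ L n z ^ (- n - 2)`. -/
def L (U : VertexOperatorAlgebra V) (n : ℤ) : Module.End ℂ V := U.mode (n + 1) U.conf

/-- The space of vectors of conformal weight `n`. -/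
def weightSpace (U : VertexOperatorAlgebra V) (n : ℤ) : Submodule ℂ V :=
  Module.End.eigenspace (U.L 0) (n : ℂ)

/-- CFT type: `V = ℂ vac ⊕ ⨁_{n ≥ 1} V₍ₙ₎`. -/
def IsCFTType (U : VertexOperatorAlgebra V) : Prop :=
  U.vac ≠ 0 ∧ (∀ n < 0, U.weightSpace n = ⊥) ∧ U.weightSpace 0 = Submodule.span ℂ {U.vac}

end VertexOperatorAlgebra

/-- A unitary vertex operator algebra: an anti-linear involution `θ` and a positive definite
Hermitian form (linear in the second variable). The field `invariant` is the coefficient of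
`z ^ (- n - 1)` in the invariance property
`⟨Y(e ^ (z L(1)) (- z ^ (-2)) ^ L(0) a, z ^ (-1)) u, v⟩ = ⟨u, Y(θ a, z) v⟩`
for `a` of weight `h`. -/
structure UnitaryVOA (V : Type*) [AddCommGroup V] [Module ℂ V]
    extends VertexOperatorAlgebra V where
  θ : V →ₗ⋆[ℂ] V
  θ_θ : ∀ v, θ (θ v) = v
  θ_vac : θ vac = vac
  θ_conf : θ conf = conf
  θ_mode : ∀ (n : ℤ) (u v : V),
    θ (toVertexAlgebra.mode n u v) = toVertexAlgebra.mode n (θ u) (θ v)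
  form : V →ₗ⋆[ℂ] V →ₗ[ℂ] ℂ
  form_symm : ∀ u v, form u v = star (form v u)
  form_pos : ∀ v, v ≠ 0 → 0 < (form v v).re
  invariant : ∀ (h : ℤ), ∀ a ∈ toVertexOperatorAlgebra.weightSpace h, ∀ (n : ℤ) (u v : V),
    ∑ᶠ j : ℕ, ((-1 : ℂ) ^ h / (j.factorial : ℂ)) *
        form (toVertexAlgebra.mode (2 * h - j - n - 2) ((toVertexOperatorAlgebra.L 1 ^ j) a) u) v
      = form u (toVertexAlgebra.mode n (θ a) v)

/-- A homogeneous real orthonormal basis `Φ` of a unitary vertex operator algebra of CFT type, whose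
element of weight zero is the vacuum. -/
structure RealBasis {V : Type*} [AddCommGroup V] [Module ℂ V] (U : UnitaryVOA V)
    (ι : Type*) where
  basis : Module.Basis ι ℂ V
  wt : ι → ℕ
  homogeneous : ∀ i, basis i ∈ U.weightSpace (wt i)
  orthonormal_self : ∀ i, U.form (basis i) (basis i) = 1
  orthonormal_ne : ∀ i j, i ≠ j → U.form (basis i) (basis j) = 0
  real : ∀ i, U.θ (basis i) = basis i
  vacIdx : ι
  basis_vacIdx : basis vacIdx = U.vac

/-! ## The tensor product `V^{⊗ m}` -/

section Tensor

variable {V : Type*} [AddCommGroup V] [Module ℂ V]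

/-- The tensor power `V^{⊗ m}`, with factors indexed by `Fin m`. -/
abbrev TensorPow (V : Type*) [AddCommGroup V] [Module ℂ V] (m : ℕ) :=
  PiTensorProduct ℂ (fun _ : Fin m => V)

/-- The `n`-th mode of the tensor product state-field map
`Y(⊗ bₓ, z) = ⨂ₓ Y(bₓ, z)`: on pure tensors, the sum of `⨂ₓ (bₓ)₍ᵥₓ₎ cₓ` over all families of
integers `ν` with `∑ₓ (νₓ + 1) = n + 1`. Only finitely many terms are nonzero
(`finite_support_tensorMode` below). -/
def tensorMode (A : VertexAlgebra V) {m : ℕ} (n : ℤ) (b c : TensorPow V m) : TensorPow V m :=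
  ∑ᶠ ν : {ν : Fin m → ℤ // ∑ x, (ν x + 1) = n + 1},
    PiTensorProduct.map₂ (fun x => A.mode (ν.1 x)) b c

/-- The dual of `W` with conjugated scalar multiplication; the target of the anti-linear map
`u ↦ ⟨u, ·⟩`. -/
def ConjDual (W : Type*) [AddCommGroup W] [Module ℂ W] : Type _ := W →ₗ[ℂ] ℂ

instance (W : Type*) [AddCommGroup W] [Module ℂ W] : AddCommGroup (ConjDual W) :=
  inferInstanceAs (AddCommGroup (W →ₗ[ℂ] ℂ))

instance (W : Type*) [AddCommGroup W] [Module ℂ W] : Module ℂ (ConjDual W) :=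
  Module.compHom (W →ₗ[ℂ] ℂ) (starRingEnd ℂ)

/-- The functional `⊗ bₓ ↦ ∏ₓ ⟨aₓ, bₓ⟩`. -/
def pureFunctional (U : UnitaryVOA V) {m : ℕ} (a : Fin m → V) : TensorPow V m →ₗ[ℂ] ℂ :=
  PiTensorProduct.lift
    ((MultilinearMap.mkPiAlgebra ℂ (Fin m) ℂ).compLinearMap fun x => U.form (a x))

theorem pureFunctional_tprod (U : UnitaryVOA V) {m : ℕ} (a b : Fin m → V) :
    pureFunctional U a (PiTensorProduct.tprod ℂ b) = ∏ x, U.form (a x) (b x) := by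
  simp [pureFunctional]

theorem prod_form_update (U : UnitaryVOA V) {m : ℕ} [DecidableEq (Fin m)] (a b : Fin m → V)
    (i : Fin m) (v : V) :
    ∏ x, U.form (Function.update a i v x) (b x)
      = U.form v (b i) * ∏ x ∈ Finset.univ.erase i, U.form (a x) (b x) := by
  rw [← Finset.mul_prod_erase Finset.univ _ (Finset.mem_univ i)]
  congr 1
  · simp
  · refine Finset.prod_congr rfl fun x hx => ?_
    rw [Function.update_of_ne (Finset.ne_of_mem_erase hx)]

/-- `a ↦ ⟨⊗ aₓ, ·⟩` as a (conjugate-)multilinear map. -/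
def conjMultilinear (U : UnitaryVOA V) (m : ℕ) :
    MultilinearMap ℂ (fun _ : Fin m => V) (ConjDual (TensorPow V m)) where
  toFun a := pureFunctional U a
  map_update_add' a i u v := by
    have key : pureFunctional U (Function.update a i (u + v))
        = pureFunctional U (Function.update a i u) + pureFunctional U (Function.update a i v) := by
      refine PiTensorProduct.ext (MultilinearMap.ext fun b => ?_)
      simp only [LinearMap.compMultilinearMap_apply, LinearMap.add_apply, pureFunctional_tprod,
        prod_form_update, map_add, add_mul]
    exact key
  map_update_smul' a i r v := by
    have key : pureFunctional U (Function.update a i (r • v))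
        = (starRingEnd ℂ r) • pureFunctional U (Function.update a i v) := by
      refine PiTensorProduct.ext (MultilinearMap.ext fun b => ?_)
      simp only [LinearMap.compMultilinearMap_apply, LinearMap.smul_apply, pureFunctional_tprod,
        prod_form_update, LinearMap.map_smulₛₗ, smul_eq_mul, mul_assoc]
    exact key

/-- The Hermitian form of `V^{⊗ m}`, determined by `⟨⊗ aₓ, ⊗ bₓ⟩ = ∏ₓ ⟨aₓ, bₓ⟩`,
anti-linear in the first and linear in the second variable. -/
def tensorForm (U : UnitaryVOA V) {m : ℕ} (u v : TensorPow V m) : ℂ :=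
  (show TensorPow V m →ₗ[ℂ] ℂ from PiTensorProduct.lift (conjMultilinear U m) u) v

theorem tensorForm_tprod (U : UnitaryVOA V) {m : ℕ} (a b : Fin m → V) :
    tensorForm U (PiTensorProduct.tprod ℂ a) (PiTensorProduct.tprod ℂ b) = ∏ x, U.form (a x) (b x) := by
  rw [tensorForm, PiTensorProduct.lift.tprod]
  exact pureFunctional_tprod U a b

/-- The vectors of conformal weight `n` in `V^{⊗ m}`. -/
def tensorWeightSpace (U : VertexOperatorAlgebra V) (m : ℕ) (n : ℤ) :
    Submodule ℂ (TensorPow V m) :=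
  Submodule.span ℂ {t | ∃ (k : Fin m → ℤ) (v : Fin m → V),
    ∑ x, k x = n ∧ (∀ x, v x ∈ U.weightSpace (k x)) ∧ t = PiTensorProduct.tprod ℂ v}

/-- The fixed point subspace `V^G = (V^{⊗ m})^G` of a permutation group `G` of the factors. -/
def fixedPointSpace (V : Type*) [AddCommGroup V] [Module ℂ V] {m : ℕ}
    (G : Subgroup (Equiv.Perm (Fin m))) : Submodule ℂ (TensorPow V m) where
  carrier := {v | ∀ σ ∈ G, PiTensorProduct.reindex ℂ (fun _ : Fin m => V) σ v = v}
  add_mem' := by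
    intro a b ha hb σ hσ
    exact (map_add _ a b).trans (congrArg₂ (· + ·) (ha σ hσ) (hb σ hσ))
  zero_mem' := fun σ _ => map_zero _
  smul_mem' := by
    intro c a ha σ hσ
    exact (map_smul _ c a).trans (congrArg (c • ·) (ha σ hσ))

theorem finite_support_tensorMode (A : VertexAlgebra V) {m : ℕ} (n : ℤ) (b c : TensorPow V m) :
    (Function.support fun ν : {ν : Fin m → ℤ // ∑ x, (ν x + 1) = n + 1} =>
      PiTensorProduct.map₂ (fun x => A.mode (ν.1 x)) b c).Finite := by
  induction b using PiTensorProduct.induction_on with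
  | add b₁ b₂ h₁ h₂ =>
    refine (h₁.union h₂).subset fun ν hν => ?_
    by_contra hcon
    simp only [Set.mem_union, Function.mem_support, not_or, not_not] at hcon
    exact hν (by simp [hcon.1, hcon.2])
  | smul_tprod r b =>
    induction c using PiTensorProduct.induction_on with
    | add c₁ c₂ h₁ h₂ =>
      refine (h₁.union h₂).subset fun ν hν => ?_
      by_contra hcon
      simp only [Set.mem_union, Function.mem_support, not_or, not_not] at hcon
      exact hν ((map_add _ c₁ c₂).trans (by rw [hcon.1, hcon.2, add_zero]))
    | smul_tprod s c =>
      have trunc : ∀ x, ∃ d : ℤ, ∀ k : ℤ, A.mode k (b x) (c x) ≠ 0 → k + 1 ≤ d := by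
        intro x
        refine ⟨-((HahnModule.of ℂ).symm (A.Y (b x) (c x))).order, fun k hk => ?_⟩
        by_contra hlt
        exact hk (VertexOperator.ncoeff_eq_zero_of_lt_order (A.Y (b x)) k (c x) (by omega))
      choose d hd using trunc
      have hfin : (Set.univ.pi fun x => Set.Icc
          (n - ∑ y ∈ Finset.univ.erase x, d y) (d x) : Set (Fin m → ℤ)).Finite :=
        Set.Finite.pi fun x => Set.finite_Icc _ _
      refine Set.Finite.subset (hfin.preimage
        (f := fun ν : {ν : Fin m → ℤ // ∑ x, (ν x + 1) = n + 1} => ν.1)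
        (Subtype.val_injective.injOn)) fun ν hν => ?_
      have hne : ∀ x, A.mode (ν.1 x) (b x) (c x) ≠ 0 := by
        intro x hx
        refine hν ?_
        have : PiTensorProduct.map₂ (fun x => A.mode (ν.1 x)) (PiTensorProduct.tprod ℂ b) (PiTensorProduct.tprod ℂ c) = 0 := by
          rw [PiTensorProduct.map₂_tprod_tprod]
          exact MultilinearMap.map_coord_zero _ x hx
        simp [this]
      simp only [Set.mem_preimage, Set.mem_pi, Set.mem_univ, Set.mem_Icc, forall_const]
      intro x
      have h1 := hd x _ (hne x)
      have h2 : ∑ y ∈ Finset.univ.erase x, (ν.1 y + 1) ≤ ∑ y ∈ Finset.univ.erase x, d y :=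
        Finset.sum_le_sum fun y _ => hd y _ (hne y)
      have h3 := ν.2
      rw [← Finset.add_sum_erase _ _ (Finset.mem_univ x)] at h3
      constructor <;> omega

end Tensor

/-! ## Families of permutation groups

The set `X_N` of size `x N` is `Fin (x N)`, i.e. `{0, …, x N - 1}`, and `X_N ⊆ X_{N+1} ⊆ ℕ`. -/

/-- The part of a finite set `K ⊆ ℕ` that lies in `Fin m`. -/
def finPart (m : ℕ) (K : Finset ℕ) : Finset (Fin m) :=
  Finset.univ.filter fun i => (i : ℕ) ∈ K

/-- The group `G(K)` of permutations of `K` induced by the setwise stabilizer of `K` in `G`. -/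
def inducedGroup {m : ℕ} (G : Subgroup (Equiv.Perm (Fin m))) (K : Finset ℕ) :
    Set (Equiv.Perm K) :=
  {π | ∃ σ ∈ G, ∀ (i : Fin m) (hi : (i : ℕ) ∈ K), ((σ i : Fin m) : ℕ) = (π ⟨i, hi⟩ : ℕ)}

/-- The pointwise stabilizer of `K` in `G`. -/
def pointwiseStabilizer {m : ℕ} (G : Subgroup (Equiv.Perm (Fin m))) (K : Finset (Fin m)) :
    Subgroup G :=
  fixingSubgroup G (K : Set (Fin m))

/-- The number `M(κ, N)` for `κ = (κ₁, κ₂, κ₃) ∈ G_N³` and finite sets `K₁, K₂, K₃ ⊆ X_N`. -/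
def configMultiplicity {m : ℕ} (G : Subgroup (Equiv.Perm (Fin m))) (K : Fin 3 → Finset (Fin m))
    (κ : Fin 3 → G) : ℝ :=
  Real.sqrt ((∏ i, (Nat.card (pointwiseStabilizer G (K i)) : ℝ)) /
    ((Nat.card G : ℝ) * (Nat.card (pointwiseStabilizer G
      (Finset.univ.biUnion fun i => (K i).image (κ i : Equiv.Perm (Fin m)))) : ℝ) ^ 2))

/-- Convergence of `M(κ, N)` as `N → ∞` for every configuration `κ` that can contribute to a
structure constant. A double coset `[κ]` is made independent of `N` by fixing the finite
subsets `Lᵢ = κᵢ Kᵢ` of `ℕ`; a point lying in exactly one of the `Lᵢ` gives a factor with exactly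
two vacua, which vanishes. -/
def MultiplicitiesConverge (x : ℕ → ℕ) (G : ∀ N, Subgroup (Equiv.Perm (Fin (x N)))) : Prop :=
  ∀ (K L : Fin 3 → Finset ℕ) (κ : ∀ N, Fin 3 → G N),
    (∀ᶠ N in atTop, ∀ i,
      (finPart (x N) (K i)).image (κ N i : Equiv.Perm (Fin (x N))) = finPart (x N) (L i)) →
    (∀ p : ℕ, (Finset.univ.filter fun i => p ∈ L i).card ≠ 1) →
    ∃ l : ℝ, Tendsto (fun N => configMultiplicity (G N) (fun i => finPart (x N) (K i)) (κ N))
      atTop (𝓝 l)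

section Orbifold

variable {V : Type*} [AddCommGroup V] [Module ℂ V] {U : UnitaryVOA V} {ι : Type*}

/-- `b_n(G)`: the number of `G`-orbits on functions `X → Φ` of weight `n`, where `σ` acts by
`(σ g)(i) = g (σ⁻¹ i)`. -/
def orbitCount (Φ : RealBasis U ι) {m : ℕ} (G : Subgroup (Equiv.Perm (Fin m))) (n : ℕ) : ℕ :=
  Set.ncard {O : Set (Fin m → ι) | ∃ g : Fin m → ι, ∑ i, Φ.wt (g i) = n ∧
    O = {h | ∃ σ ∈ G, h = fun i => g (σ⁻¹ i)}}

/-- Nested oligomorphic families. In `nested`, the permutation group `G (N + 1)` restricted to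
`X_N` is contained in `G N`: whatever `σ ∈ G (N + 1)` does to those points of `X_N` which it keeps
in `X_N` is done by some element of `G N`. -/
structure NestedOligomorphic (Φ : RealBasis U ι) (x : ℕ → ℕ)
    (G : ∀ N, Subgroup (Equiv.Perm (Fin (x N)))) : Prop where
  size_pos : ∀ N, 0 < x N
  size_lt : ∀ N, x N < x (N + 1)
  orbitCount_converges : ∀ n, ∃ b : ℕ, ∀ᶠ N in atTop, orbitCount Φ (G N) n = b
  induced_converges : ∀ K : Finset ℕ, ∃ H : Subgroup (Equiv.Perm K),
    ∀ᶠ N in atTop, inducedGroup (G N) K = (H : Set (Equiv.Perm K))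
  nested : ∀ N, ∀ σ ∈ G (N + 1), ∃ τ ∈ G N, ∀ i : Fin (x N),
    ((σ (Fin.castLE (size_lt N).le i) : Fin (x (N + 1))) : ℕ) < x N →
      ((σ (Fin.castLE (size_lt N).le i) : Fin (x (N + 1))) : ℕ) = (τ i : ℕ)

/-! ## The limit -/

/-- The support of `g : ℕ → Φ`. -/
def supp (Φ : RealBasis U ι) (g : ℕ → ι) : Set ℕ := {j | g j ≠ Φ.vacIdx}

/-- The weight of a finitely supported function `g : ℕ → Φ`. -/
def weight (Φ : RealBasis U ι) (g : ℕ → ι) : ℕ := ∑ᶠ j, Φ.wt (g j)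

/-- `∑_{σ ∈ G} ⨂ₓ (σ g)(x)`. -/
def symmetrization (Φ : RealBasis U ι) {m : ℕ} (G : Subgroup (Equiv.Perm (Fin m)))
    (g : ℕ → ι) : TensorPow V m :=
  ∑ᶠ σ : G, PiTensorProduct.tprod ℂ fun i : Fin m => Φ.basis (g ((σ : Equiv.Perm (Fin m))⁻¹ i : Fin m))

/-- The unit vector `φ_g ∈ V^G`. -/
def fixedState (Φ : RealBasis U ι) {m : ℕ} (G : Subgroup (Equiv.Perm (Fin m)))
    (g : ℕ → ι) : TensorPow V m :=
  (((Real.sqrt (tensorForm U (symmetrization Φ G g) (symmetrization Φ G g)).re)⁻¹ : ℝ) : ℂ) •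
    symmetrization Φ G g

/-- The structure constant `⟨φ_{g₁}, (φ_{g₂})₍ₙ₎ φ_{g₃}⟩` of `V^G`, where
`n = wt g₃ + wt g₂ - wt g₁ - 1`. -/
def structureConstant (Φ : RealBasis U ι) {m : ℕ} (G : Subgroup (Equiv.Perm (Fin m)))
    (g₁ g₂ g₃ : ℕ → ι) : ℂ :=
  tensorForm U (fixedState Φ G g₁)
    (tensorMode U.toVertexAlgebra
      ((weight Φ g₃ : ℤ) + weight Φ g₂ - weight Φ g₁ - 1) (fixedState Φ G g₂) (fixedState Φ G g₃))

/-- `B = ⋃ₙ Bₙ` is a system of `N`-independent representatives of orbits: the functions in `B` of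
weight `n` are supported in some fixed `X_{N₀}`, and for all `N ≥ N₀` their restrictions to `X_N`
represent every `G_N`-orbit of functions `X_N → Φ` of weight `n` exactly once. -/
structure IsRepresentativeSystem (Φ : RealBasis U ι) (x : ℕ → ℕ)
    (G : ∀ N, Subgroup (Equiv.Perm (Fin (x N)))) (B : Set (ℕ → ι)) : Prop where
  finite_supp : ∀ g ∈ B, (supp Φ g).Finite
  stable : ∀ n : ℕ, ∃ N₀ : ℕ,
    (∀ g ∈ B, weight Φ g = n → ∀ j ∈ supp Φ g, j < x N₀) ∧
    ∀ N ≥ N₀, ∀ h : Fin (x N) → ι, ∑ i, Φ.wt (h i) = n →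
      ∃! g : ℕ → ι, g ∈ B ∧ weight Φ g = n ∧
        ∃ σ ∈ G N, ∀ i, h i = g (σ⁻¹ i : Fin (x N))

/-- The vertex algebra `A` on `⨁_{g ∈ B} ℂ φ_g` is the large `N` limit of the fixed point vertex
operator algebras `V^{G_N}`, with structure constants `f = lim f^N`. -/
structure IsLargeNLimit (Φ : RealBasis U ι) (x : ℕ → ℕ)
    (G : ∀ N, Subgroup (Equiv.Perm (Fin (x N)))) (B : Set (ℕ → ι))
    (f : B → B → B → ℂ) (A : VertexAlgebra (B →₀ ℂ)) : Prop where
  orthonormal : ∀ n : ℕ, ∀ᶠ N in atTop, ∀ g ∈ B, ∀ g' ∈ B, weight Φ g = n → weight Φ g' = n →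
    (g = g' → tensorForm U (fixedState Φ (G N) g) (fixedState Φ (G N) g') = 1) ∧
    (g ≠ g' → tensorForm U (fixedState Φ (G N) g) (fixedState Φ (G N) g') = 0)
  span_eq : ∀ n : ℕ, ∀ᶠ N in atTop,
    Submodule.span ℂ {v | ∃ g ∈ B, weight Φ g = n ∧ v = fixedState Φ (G N) g}
      = fixedPointSpace V (G N) ⊓ tensorWeightSpace U.toVertexOperatorAlgebra (x N) n
  tendsto : ∀ g₁ g₂ g₃ : B,
    Tendsto (fun N => structureConstant Φ (G N) g₁.1 g₂.1 g₃.1) atTop (𝓝 (f g₁ g₂ g₃))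
  vac_eq : ∃ h : (fun _ => Φ.vacIdx) ∈ B, A.vac = Finsupp.single ⟨fun _ => Φ.vacIdx, h⟩ 1
  mode_eq : ∀ (g₁ g₂ g₃ : B) (n : ℤ),
    ((weight Φ g₁.1 : ℤ) = weight Φ g₂.1 + weight Φ g₃.1 - n - 1 →
      A.mode n (Finsupp.single g₂ 1) (Finsupp.single g₃ 1) g₁ = f g₁ g₂ g₃) ∧
    ((weight Φ g₁.1 : ℤ) ≠ weight Φ g₂.1 + weight Φ g₃.1 - n - 1 →
      A.mode n (Finsupp.single g₂ 1) (Finsupp.single g₃ 1) g₁ = 0)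

/-- The family `V^{G_N}` has a large `N` vertex algebra limit: systems of `N`-independent
representatives exist, and for each of them all structure constants of `V^{G_N}` converge and
define a vertex algebra. -/
def HasLargeNLimit (Φ : RealBasis U ι) (x : ℕ → ℕ)
    (G : ∀ N, Subgroup (Equiv.Perm (Fin (x N)))) : Prop :=
  (∃ B, IsRepresentativeSystem Φ x G B) ∧
    ∀ B, IsRepresentativeSystem Φ x G B →
      ∃ (f : B → B → B → ℂ) (A : VertexAlgebra (B →₀ ℂ)), IsLargeNLimit Φ x G B f A

end Orbifold

end

open Filter Topology

noncomputable section

/-! ## Formal distributions and Dong's lemma -/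

section Shift

variable {A M : Type*} [AddCommGroup A] [AddCommGroup M] [Module ℂ M]

/-! A graded vertex algebra is encoded by its structure constants in a homogeneous basis:
`IsVertexStructure` lists the vertex algebra axioms as identities between finite sums of products of
such constants, and `IsVertexStructure.vertexAlgebra` rebuilds the algebra from them. Identities of
this kind survive entrywise limits as long as their index sets and orders of locality do not grow.
Hence three things are needed: the axioms for `V^{G_N}`, uniformity in `N`, and convergence.

Axioms. For `V` itself they come from expanding in `Φ` (`RealBasis.isVertexStructure`), once modes
are known to respect weights; this is the commutator formula for `L 0`, obtained from Dong's lemma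
and the uniqueness of local fields. For the tensor power, locality is rewritten as a multiplicative
condition: up to a sign, the two orderings of a product of fields are one polynomial divided by a
power of `1 - X`, read from its two ends (`localAt_iff_polynomial`). Polynomials multiply over the
sites, while translation is a Leibniz rule. For the fixed points, normalized orbit sums form an
orthonormal basis, so a composition of fixed point constants is an orbit average of compositions in
the tensor power (`IsTransversal.sum_right`, `IsTransversal.sum_left`), and each axiom is averaged.

Uniformity. Eventually the elements of `B` of a given weight represent all orbits of that weight, so
the sums run over fixed finite sets. Pairs of vacua with anything have order of locality zero, so
the order for two orbit sums is bounded in terms of the two finitely supported functions only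
(`sum_order_le`).

Convergence. The constant for `g₁, g₂, g₃` is a normalized sum over triples from three orbits.
Triples are grouped by the orbit of the union of their supports. Nestedness and convergence of orbit
counts make these orbits representable independently of `N`, and reduce the sum to finitely many
triples of functions on `ℕ`. A triple contributes a number independent of `N`, times an orbit size
divided by square roots of three orbit sizes. By orbit-stabilizer that quotient is `M(κ, N)` times a
factor given by induced groups, which stabilizes (`exists_tendsto_ratio`). A point covered by
exactly one support gives the factor zero, so the assumption on `M(κ, N)` covers all surviving
triples. Whether a triple occurs at all is eventually constant, since by nestedness orbits can only
split further as `N` grows. -/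

/-- Translation by `a` on functions on an additive group. -/
def shift (a : A) : Module.End ℂ (A → M) := LinearMap.funLeft ℂ M (· + a)

theorem shift_apply (a : A) (φ : A → M) (s : A) : shift a φ s = φ (s + a) := rfl

theorem shift_mul (a b : A) : (shift a * shift b : Module.End ℂ (A → M)) = shift (a + b) := by
  ext φ s
  simp only [Module.End.mul_apply, shift_apply, add_assoc]

theorem shift_commute (a b : A) : Commute (shift a : Module.End ℂ (A → M)) (shift b) := by
  rw [Commute, SemiconjBy, shift_mul, shift_mul, add_comm]

theorem shift_pow (a : A) (n : ℕ) : (shift a : Module.End ℂ (A → M)) ^ n = shift (n • a) := by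
  induction n with
  | zero => ext φ s; simp [shift_apply]
  | succ n ih => rw [pow_succ, ih, shift_mul, succ_nsmul]

theorem shift_sub_commute (a b a' b' : A) :
    Commute (shift a - shift b : Module.End ℂ (A → M)) (shift a' - shift b') :=
  ((shift_commute _ _).sub_right (shift_commute _ _)).sub_left
    ((shift_commute _ _).sub_right (shift_commute _ _))

/-- Binomial theorem for commuting translations. The alternating sums of the locality axiom become
powers of one operator, so polynomial algebra applies to them. -/
theorem shift_sub_pow_apply (a b : A) (K : ℕ) (φ : A → M) (s : A) :
    ((shift a - shift b : Module.End ℂ (A → M)) ^ K) φ s = ∑ j ∈ Finset.range (K + 1),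
      ((-1 : ℂ) ^ j * (K.choose j : ℂ)) • φ (s + (K - j) • a + j • b) := by
  have hc : Commute (-shift b : Module.End ℂ (A → M)) (shift a) := (shift_commute (M := M) b a).neg_left
  rw [sub_eq_neg_add, hc.add_pow, LinearMap.sum_apply, Finset.sum_apply]
  refine Finset.sum_congr rfl fun j _ => ?_
  rw [show (-shift b : Module.End ℂ (A → M)) = (-1 : ℂ) • shift b from
    (neg_one_smul ℂ _).symm, smul_pow, shift_pow, shift_pow,
    smul_mul_assoc, shift_mul]
  have h2 : ((K.choose j : ℕ) : Module.End ℂ (A → M)) = (K.choose j : ℂ) • 1 := by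
    rw [Nat.cast_smul_eq_nsmul, nsmul_one]
  rw [h2, smul_mul_assoc, mul_smul_comm, mul_one]
  simp only [LinearMap.smul_apply, Pi.smul_apply, shift_apply, smul_smul]
  rw [mul_comm, add_assoc, add_comm (j • b)]

/-- Every term of the binomial expansion of `(Q - P) ^ (i + j)` contains `P ^ i` or `Q ^ j`. This is
the algebraic core of Dong's lemma. -/
theorem pow_sub_apply_eq_zero {E : Type*} [AddCommGroup E] [Module ℂ E] {P Q : Module.End ℂ E}
    (h : Commute P Q) {i j : ℕ} {φ : E} (hP : (P ^ i) φ = 0) (hQ : (Q ^ j) φ = 0) :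
    ((Q - P) ^ (i + j)) φ = 0 := by
  have hc : Commute Q (-P) := h.symm.neg_right
  rw [sub_eq_add_neg, hc.add_pow, LinearMap.sum_apply]
  refine Finset.sum_eq_zero fun m hm => ?_
  have hm' : m < i + j + 1 := Finset.mem_range.1 hm
  have hcast : Commute (Q ^ m * (-P) ^ (i + j - m)) (((i + j).choose m : ℕ) : Module.End ℂ E) :=
    Nat.commute_cast _ _
  rw [hcast.eq, Module.End.mul_apply]
  suffices hs : (Q ^ m * (-P) ^ (i + j - m)) φ = 0 by rw [hs, map_zero]
  by_cases hmj : j ≤ m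
  · rw [(hc.pow_pow m (i + j - m)).eq, Module.End.mul_apply, ← Nat.sub_add_cancel hmj, pow_add,
      Module.End.mul_apply, hQ, map_zero, map_zero]
  · have : i + j - m = (j - m) + i := by omega
    rw [Module.End.mul_apply, this, pow_add, Module.End.mul_apply, neg_pow P i, Module.End.mul_apply,
      hP, map_zero, map_zero, map_zero]

end Shift

section Local

attribute [local instance] LieRing.ofAssociativeRing LieAlgebra.ofAssociativeAlgebra

variable {V : Type*} [AddCommGroup V] [Module ℂ V]

/-- Mutual locality of order `K` of two fields, given by their modes. -/
def LocalFields (K : ℕ) (a b : ℤ → Module.End ℂ V) : Prop :=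
  ((shift (1, 0) - shift (0, 1) : Module.End ℂ (ℤ × ℤ → Module.End ℂ V)) ^ K)
    (fun p => ⁅a p.1, b p.2⁆) = 0

theorem localFields_iff (K : ℕ) (a b : ℤ → Module.End ℂ V) :
    LocalFields K a b ↔ ∀ m n : ℤ, ∑ j ∈ Finset.range (K + 1), ((-1 : ℂ) ^ j * (K.choose j : ℂ)) •
      ⁅a (m + K - j), b (n + j)⁆ = 0 := by
  rw [LocalFields, funext_iff, Prod.forall]
  refine forall₂_congr fun m n => ?_
  rw [shift_sub_pow_apply]
  refine Eq.congr (Finset.sum_congr rfl fun j hj => ?_) rfl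
  have hj' : j ≤ K := Nat.lt_succ_iff.1 (Finset.mem_range.1 hj)
  congr 3
  · simp [Nat.cast_sub hj']; ring_nf
  · simp

theorem LocalFields.mono {K K' : ℕ} {a b : ℤ → Module.End ℂ V} (h : LocalFields K a b)
    (hK : K ≤ K') : LocalFields K' a b := by
  rw [LocalFields] at h ⊢
  rw [← Nat.sub_add_cancel hK, pow_add, Module.End.mul_apply, h, map_zero]

theorem LocalFields.sub {K : ℕ} {a a' b : ℤ → Module.End ℂ V} (h : LocalFields K a b)
    (h' : LocalFields K a' b) : LocalFields K (a - a') b := by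
  rw [LocalFields] at h h' ⊢
  have : (fun p : ℤ × ℤ => ⁅(a - a') p.1, b p.2⁆)
      = (fun p => ⁅a p.1, b p.2⁆) - (fun p => ⁅a' p.1, b p.2⁆) := by
    ext1 p; simp [sub_lie]
  rw [this, map_sub, h, h', sub_zero]

/-- Relabelling the modes multiplies the field by a power of its variable, which commutes with
multiplication by `(z - w) ^ K`. -/
theorem LocalFields.comp_add {K : ℕ} {a b : ℤ → Module.End ℂ V} (h : LocalFields K a b)
    (i : ℤ) : LocalFields K (fun n => a (n + i)) b := by
  rw [localFields_iff] at h ⊢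
  intro m n
  rw [← h (m + i) n]
  refine Finset.sum_congr rfl fun j _ => ?_
  ring_nf

/-- Dong's lemma. -/
theorem LocalFields.lie {K₁ K₂ K₃ : ℕ} {w a b : ℤ → Module.End ℂ V} (h₁ : LocalFields K₁ w a)
    (h₂ : LocalFields K₂ a b) (h₃ : LocalFields K₃ w b) (i : ℤ) :
    LocalFields (K₁ + K₃ + K₂) (fun n => ⁅w i, a n⁆) b := by
  set Z : Module.End ℂ (ℤ × ℤ × ℤ → Module.End ℂ V) := shift (1, 0, 0) with hZ
  set W : Module.End ℂ (ℤ × ℤ × ℤ → Module.End ℂ V) := shift (0, 1, 0) with hW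
  set U : Module.End ℂ (ℤ × ℤ × ℤ → Module.End ℂ V) := shift (0, 0, 1) with hU
  set φ : ℤ × ℤ × ℤ → Module.End ℂ V := fun p => ⁅⁅w p.1, a p.2.1⁆, b p.2.2⁆ with hφ
  have e₁ : ((Z - W) ^ K₁) φ = 0 := by
    ext1 ⟨p, q, r⟩
    rw [shift_sub_pow_apply]
    have := congrArg (fun X => ⁅X, b r⁆) (congrFun h₁ (p, q))
    simp only [shift_sub_pow_apply, hφ, Pi.zero_apply, zero_lie, sum_lie, smul_lie] at this ⊢
    rw [← this]
    refine Finset.sum_congr rfl fun j _ => ?_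
    simp
  have e₂ : ((W - U) ^ K₂) (fun p => ⁅w p.1, ⁅a p.2.1, b p.2.2⁆⁆) = 0 := by
    ext1 ⟨p, q, r⟩
    rw [shift_sub_pow_apply]
    have := congrArg (fun X => ⁅w p, X⁆) (congrFun h₂ (q, r))
    simp only [shift_sub_pow_apply, Pi.zero_apply, lie_zero, lie_sum, lie_smul] at this ⊢
    rw [← this]
    refine Finset.sum_congr rfl fun j _ => ?_
    simp
  have e₃ : ((Z - U) ^ K₃) (fun p => ⁅a p.2.1, ⁅w p.1, b p.2.2⁆⁆) = 0 := by
    ext1 ⟨p, q, r⟩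
    rw [shift_sub_pow_apply]
    have := congrArg (fun X => ⁅a q, X⁆) (congrFun h₃ (p, r))
    simp only [shift_sub_pow_apply, Pi.zero_apply, lie_zero, lie_sum, lie_smul] at this ⊢
    rw [← this]
    refine Finset.sum_congr rfl fun j _ => ?_
    simp
  -- Jacobi identity: of its two terms one is killed by `(W - U) ^ K₂` and the other by `(Z - U) ^
  -- K₃`.
  have split : φ = (fun p => ⁅w p.1, ⁅a p.2.1, b p.2.2⁆⁆) - (fun p => ⁅a p.2.1, ⁅w p.1, b p.2.2⁆⁆) := by
    ext1 p
    simp only [hφ, Pi.sub_apply]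
    rw [lie_lie]
  have f₁ : ((Z - W) ^ K₁) (((W - U) ^ K₂) φ) = 0 := by
    rw [← Module.End.mul_apply, ((shift_sub_commute _ _ _ _).pow_pow K₁ K₂).eq,
      Module.End.mul_apply, e₁, map_zero]
  have f₃ : ((Z - U) ^ K₃) (((W - U) ^ K₂) φ) = 0 := by
    rw [split, map_sub, map_sub, e₂, map_zero, ← Module.End.mul_apply,
      ((shift_sub_commute _ _ _ _).pow_pow K₃ K₂).eq, Module.End.mul_apply, e₃, map_zero, sub_zero]
  -- Since `W - U = (Z - U) - (Z - W)`, a further power `K₁ + K₃` of `W - U` kills what both `(Z -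
  -- W) ^ K₁` and `(Z - U) ^ K₃` kill. The variable of `w` has disappeared from the operator, so its
  -- mode can be frozen at `i`.
  have key : ((W - U) ^ (K₁ + K₃ + K₂)) φ = 0 := by
    have := pow_sub_apply_eq_zero (shift_sub_commute _ _ _ _) f₁ f₃
    rwa [sub_sub_sub_cancel_left, ← Module.End.mul_apply, ← pow_add] at this
  rw [LocalFields]
  ext1 ⟨p, q⟩
  have := congrFun key (i, p, q)
  rw [shift_sub_pow_apply] at this ⊢
  rw [Pi.zero_apply] at this ⊢
  rw [← this]
  refine Finset.sum_congr rfl fun j _ => ?_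
  simp [hφ]

end Local

/-! ### Uniqueness of local fields, and translation as a mode. -/

namespace VertexAlgebra

variable {V : Type*} [AddCommGroup V] [Module ℂ V] (A : VertexAlgebra V)

/-- The modes of the field `Y(a, z)` as endomorphisms. -/
def field (a : V) (n : ℤ) : Module.End ℂ V := A.mode n a

theorem mode_apply (n : ℤ) (a b : V) : A.mode n a b = VertexOperator.ncoeff (A.Y a) n b := rfl

theorem field_apply (n : ℤ) (a b : V) : A.field a n b = A.mode n a b := rfl

theorem exists_localFields (a b : V) : ∃ K, LocalFields K (A.field a) (A.field b) := by
  obtain ⟨K, hK⟩ := A.locality a b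
  refine ⟨K, (localFields_iff _ _ _).2 fun m n => ?_⟩
  ext c
  simpa [Ring.lie_def, field_apply, mode_apply] using hK m n c

/-- A field which is local with respect to all `Y(b, z)` and annihilates the vacuum vanishes. -/
theorem eq_zero_of_local {D : ℤ → Module.End ℂ V}
    (hloc : ∀ b, ∃ K, LocalFields K D (A.field b)) (hvac : ∀ n, D n A.vac = 0) : D = 0 := by
  ext n b
  obtain ⟨K, hK⟩ := hloc b
  -- With these mode numbers the `j = 0` term applied to the vacuum is `D n b`, because `b₍₋₁₎ vac =
  -- b`. For `j ≥ 1` the mode of `b` has nonnegative index and kills the vacuum.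
  have h := LinearMap.congr_fun ((localFields_iff _ _ _).1 hK (n - K) (-1)) A.vac
  rw [LinearMap.sum_apply, Finset.sum_eq_single 0] at h
  · simpa [Ring.lie_def, hvac, field_apply, mode_apply, A.creation_neg_one] using h
  · intro j _ hj
    have hj' : (0 : ℤ) ≤ -1 + j := by omega
    simp [Ring.lie_def, hvac, field_apply, mode_apply, A.creation_of_nonneg b _ hj']
  · simp

/-- Translation covariance at `n = -1`, applied to the vacuum. It eliminates `T` in favour of modes,
so structure constants determine it. -/
theorem T_eq (a : V) : A.T a = A.mode (-2) a A.vac := by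
  have := A.translation a A.vac (-1)
  rw [A.creation_neg_one, A.translation_vac, map_zero] at this
  simpa [mode_apply] using this

end VertexAlgebra

/-! ### The action of `L 0` on modes. -/

namespace VertexOperatorAlgebra

variable {V : Type*} [AddCommGroup V] [Module ℂ V] (U : VertexOperatorAlgebra V)

theorem T_mode (a b : V) (n : ℤ) :
    U.T (U.mode n a b) = U.mode n a (U.T b) - (n : ℂ) • U.mode (n - 1) a b := by
  have := U.translation a b n
  rw [sub_eq_iff_eq_add] at this
  simp only [VertexAlgebra.mode_apply, this, neg_smul]
  abel

theorem L_zero_vac : U.L 0 U.vac = 0 := U.creation_of_nonneg _ _ (by norm_num)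

theorem T_L_zero (v : V) : U.T (U.L 0 v) = U.L 0 (U.T v) - U.T v := by
  have := U.virasoro (-1) 0 v
  simp only [Int.reduceNeg, neg_add_cancel, zero_add, U.mode_zero_conf, add_zero] at this
  simp only [L, zero_add]
  rw [sub_eq_iff_eq_add] at this
  rw [this]
  simp
  abel

/-- The commutator of `L 0` with the modes of `Y(a, z)`. -/
theorem L_zero_mode (a b : V) (n : ℤ) :
    U.L 0 (U.mode n a b)
      = U.mode n a (U.L 0 b) + U.mode n (U.L 0 a) b - ((n : ℂ) + 1) • U.mode n a b := by
  set w := U.field U.conf with hw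
  have w0 : ∀ v, w 0 v = U.T v := U.mode_zero_conf
  have w1 : ∀ v, w 1 v = U.L 0 v := fun v => by simp [hw, VertexAlgebra.field_apply, L]
  -- The claim amounts to `D = 0`. Its term `(n + 1) a₍ₙ₎` is written as minus the commutator of `T
  -- = w 0` with `a₍ₙ₊₁₎`, so `D` is built from commutators with single modes of the conformal
  -- field, to which Dong's lemma applies.
  set D : ℤ → Module.End ℂ V := (fun n => ⁅w 1, U.field a n⁆)
    - (fun n => ⁅w 0, U.field a (n + 1)⁆) - U.field (U.L 0 a) with hD
  have D_apply : ∀ n v, D n v = U.L 0 (U.mode n a v) - U.mode n a (U.L 0 v)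
      + ((n : ℂ) + 1) • U.mode n a v - U.mode n (U.L 0 a) v := by
    intro n v
    simp only [hD, Pi.sub_apply, LinearMap.sub_apply, Ring.lie_def, Module.End.mul_apply, w0, w1,
      VertexAlgebra.field_apply, T_mode]
    simp
  have hloc : ∀ b, ∃ K, LocalFields K D (U.field b) := by
    intro b
    obtain ⟨K₁, h₁⟩ := U.exists_localFields U.conf a
    obtain ⟨K₂, h₂⟩ := U.exists_localFields a b
    obtain ⟨K₃, h₃⟩ := U.exists_localFields U.conf b
    obtain ⟨K₄, h₄⟩ := U.exists_localFields (U.L 0 a) b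
    exact ⟨K₁ + K₃ + K₂ + K₄, (((h₁.lie h₂ h₃ 1).mono (by omega)).sub
      (((h₁.lie h₂ h₃ 0).comp_add 1).mono (by omega))).sub (h₄.mono (by omega))⟩
  -- Nonnegative modes kill the vacuum and `n = -1` is computed directly. The relation `hcov` then
  -- carries the vanishing from `n` to `n - 1`, its coefficient `-n` being nonzero for negative `n`.
  have hvac : ∀ n, D n U.vac = 0 := by
    have hpos : ∀ n : ℤ, 0 ≤ n → D n U.vac = 0 := by
      intro n hn
      simp [D_apply, L_zero_vac, VertexAlgebra.mode_apply, U.creation_of_nonneg _ _ hn]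
    have hcov : ∀ (n : ℤ), U.T (D n U.vac) = -(n : ℂ) • D (n - 1) U.vac := by
      intro n
      simp only [D_apply, L_zero_vac, map_zero, sub_zero, map_sub, map_add, map_smul, T_L_zero,
        T_mode, U.translation_vac, zero_sub]
      simp only [map_neg, map_smul]
      push_cast
      module
    have hneg : ∀ k : ℕ, D (-1 - k) U.vac = 0 := by
      intro k
      induction k with
      | zero =>
        simp [D_apply, L_zero_vac, VertexAlgebra.mode_apply, U.creation_neg_one]
      | succ k ih =>
        have h := hcov (-1 - k)
        rw [ih, map_zero] at h
        have hne : -((-1 - (k : ℤ) : ℤ) : ℂ) ≠ 0 := by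
          rw [neg_ne_zero, Int.cast_ne_zero]; omega
        have := (smul_eq_zero.1 h.symm).resolve_left hne
        rw [← this]
        congr 2
        push_cast; ring
    intro n
    rcases le_or_gt 0 n with hn | hn
    · exact hpos n hn
    · have := hneg (-1 - n).toNat
      rwa [show (-1 - ((-1 - n).toNat : ℤ)) = n by omega] at this
  have hzero := U.eq_zero_of_local hloc hvac
  have := D_apply n b
  rw [hzero] at this
  simp only [Pi.zero_apply, LinearMap.zero_apply] at this
  rw [eq_comm, sub_eq_zero, ← eq_sub_iff_add_eq, sub_eq_iff_eq_add] at this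
  rw [this]
  abel

theorem mem_weightSpace {n : ℤ} {v : V} : v ∈ U.weightSpace n ↔ U.L 0 v = (n : ℂ) • v :=
  Module.End.mem_eigenspace_iff

theorem mode_mem_weightSpace {h k : ℤ} {a b : V} (ha : a ∈ U.weightSpace h)
    (hb : b ∈ U.weightSpace k) (n : ℤ) : U.mode n a b ∈ U.weightSpace (h + k - n - 1) := by
  rw [mem_weightSpace] at ha hb ⊢
  rw [L_zero_mode, ha, hb]
  simp only [map_smul, LinearMap.smul_apply]
  push_cast
  module

end VertexOperatorAlgebra

/-! ## Vertex algebras from structure constants -/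

section Local

variable {V : Type*} [AddCommGroup V] [Module ℂ V]

attribute [local instance] LieRing.ofAssociativeRing LieAlgebra.ofAssociativeAlgebra

theorem LocalFields.add_left {K : ℕ} {a a' b : ℤ → Module.End ℂ V} (h : LocalFields K a b)
    (h' : LocalFields K a' b) : LocalFields K (a + a') b := by
  rw [LocalFields] at h h' ⊢
  have : (fun p : ℤ × ℤ => ⁅(a + a') p.1, b p.2⁆)
      = (fun p => ⁅a p.1, b p.2⁆) + (fun p => ⁅a' p.1, b p.2⁆) := by
    ext1 p; simp [add_lie]
  rw [this, map_add, h, h', add_zero]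

theorem LocalFields.add_right {K : ℕ} {a b b' : ℤ → Module.End ℂ V} (h : LocalFields K a b)
    (h' : LocalFields K a b') : LocalFields K a (b + b') := by
  rw [LocalFields] at h h' ⊢
  have : (fun p : ℤ × ℤ => ⁅a p.1, (b + b') p.2⁆)
      = (fun p => ⁅a p.1, b p.2⁆) + (fun p => ⁅a p.1, b' p.2⁆) := by
    ext1 p; simp [lie_add]
  rw [this, map_add, h, h', add_zero]

theorem LocalFields.smul_smul {K : ℕ} {a b : ℤ → Module.End ℂ V} (h : LocalFields K a b)
    (r s : ℂ) : LocalFields K (r • a) (s • b) := by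
  rw [LocalFields] at h ⊢
  have : (fun p : ℤ × ℤ => ⁅(r • a) p.1, (s • b) p.2⁆)
      = (r * s) • (fun p => ⁅a p.1, b p.2⁆) := by
    ext1 p; simp [smul_lie, lie_smul, mul_smul, smul_comm s r]
  rw [this, map_smul, h, smul_zero]

theorem LocalFields.zero_left (b : ℤ → Module.End ℂ V) : LocalFields 0 0 b := by
  rw [LocalFields, pow_zero, Module.End.one_apply]
  ext1 p; simp

theorem LocalFields.zero_right (b : ℤ → Module.End ℂ V) : LocalFields 0 b 0 := by
  rw [LocalFields, pow_zero, Module.End.one_apply]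
  ext1 p; simp

theorem localFields_iff_apply (K : ℕ) (a b : ℤ → Module.End ℂ V) :
    LocalFields K a b ↔ ∀ (m n : ℤ) (x : V),
      ∑ j ∈ Finset.range (K + 1), ((-1 : ℂ) ^ j * (K.choose j : ℂ)) •
        (a (m + K - j) (b (n + j) x) - b (n + j) (a (m + K - j) x)) = 0 := by
  rw [localFields_iff]
  refine forall₂_congr fun m n => ?_
  rw [LinearMap.ext_iff]
  refine forall_congr' fun x => ?_
  simp [Ring.lie_def]

end Local

section Structure

variable {I : Type*}

/-- The finite set of indices of weight `k`. -/
def fib (wt : I → ℕ) (k : ℤ) : Finset I :=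
  open Classical in if h : {i | (wt i : ℤ) = k}.Finite then h.toFinset else ∅

theorem mem_fib {wt : I → ℕ} (hf : ∀ n, {i | wt i = n}.Finite) {k : ℤ} {i : I} :
    i ∈ fib wt k ↔ (wt i : ℤ) = k := by
  have h : {i | (wt i : ℤ) = k}.Finite :=
    (hf k.toNat).subset fun i (hi : (wt i : ℤ) = k) => by
      change wt i = k.toNat
      omega
  rw [fib, dif_pos h, Set.Finite.mem_toFinset, Set.mem_ofPred_eq]

theorem fib_of_neg (wt : I → ℕ) {k : ℤ} (hk : k < 0) : fib wt k = ∅ := by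
  rw [fib]
  split_ifs with h
  · ext i
    simp only [Set.Finite.mem_toFinset, Set.mem_ofPred_eq, Finset.notMem_empty, iff_false]
    omega
  · rfl

/-- Coefficients `F` and `G` of the two orderings of a product of two homogeneous fields between
homogeneous vectors, indexed by the intermediate weight, satisfy locality of order `K`. -/
def LocalAt (K : ℕ) (e : ℤ) (F G : ℤ → ℂ) : Prop :=
  ∀ r : ℤ, ∑ j ∈ Finset.range (K + 1),
    ((-1 : ℂ) ^ j * (K.choose j : ℂ)) * (F (r - j) - G (e - r + j)) = 0

/-- As `shift 0` is the identity, the operator is the backward difference, and locality says that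
its `K`-th power kills the commutator. -/
theorem localAt_iff (K : ℕ) (e : ℤ) (F G : ℤ → ℂ) :
    LocalAt K e F G ↔
      ((shift 0 - shift (-1) : Module.End ℂ (ℤ → ℂ)) ^ K) (fun r => F r - G (e - r)) = 0 := by
  rw [LocalAt, funext_iff]
  refine forall_congr' fun r => ?_
  rw [shift_sub_pow_apply]
  refine Eq.congr (Finset.sum_congr rfl fun j _ => ?_) rfl
  simp only [smul_zero, add_zero, smul_eq_mul, nsmul_eq_mul, mul_neg, mul_one]
  ring_nf

theorem LocalAt.mono {K K' : ℕ} {e : ℤ} {F G : ℤ → ℂ} (h : LocalAt K e F G) (hK : K ≤ K') :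
    LocalAt K' e F G := by
  rw [localAt_iff] at h ⊢
  rw [← Nat.sub_add_cancel hK, pow_add, Module.End.mul_apply, h, map_zero]

/-- The axioms of a vertex algebra with a weight grading, in terms of its structure constants:
the vector with index `b` is sent by the mode of `a` to the sum of the `c d a b` times the vector
with index `d`, over all `d` of the appropriate weight. -/
structure IsVertexStructure (wt : I → ℕ) (v : I) (c : I → I → I → ℂ) : Prop where
  finite : ∀ n, {i | wt i = n}.Finite
  wt_vac : wt v = 0
  vac_self : ∀ i, c i v i = 1
  vac_ne : ∀ i k, i ≠ k → c i v k = 0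
  creation_self : ∀ i, c i i v = 1
  -- For `wt i ≤ wt j` the constant belongs to a mode with index at least `-1` acting on the vacuum.
  -- Larger `wt i` encodes derivatives and stays unconstrained.
  creation_ne : ∀ i j, wt i ≤ wt j → i ≠ j → c i j v = 0
  -- The matrix of `T = (·)₍₋₂₎ vac` has the entries `c d i v` with `wt d = wt i + 1`.
  translation : ∀ d a b, ∑ i ∈ fib wt (wt d - 1), c d i v * c i a b
    - ∑ k ∈ fib wt (wt b + 1), c d a k * c k b v = -((wt a : ℂ) + wt b - wt d) * c d a b
  locality : ∀ a b, ∃ K, ∀ b' d, LocalAt K (wt b' + wt d)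
    (fun k => ∑ i ∈ fib wt k, c d a i * c i b b') (fun k => ∑ i ∈ fib wt k, c d b i * c i a b')

/-! ### Modes defined by structure constants. -/

section Mode

variable (wt : I → ℕ) (c : I → I → I → ℂ)

/-- The `n`-th mode defined by structure constants. -/
def modeMap (n : ℤ) : (I →₀ ℂ) →ₗ[ℂ] (I →₀ ℂ) →ₗ[ℂ] (I →₀ ℂ) :=
  Finsupp.linearCombination ℂ fun a => Finsupp.linearCombination ℂ fun b =>
    ∑ d ∈ fib wt (wt a + wt b - n - 1), Finsupp.single d (c d a b)

theorem modeMap_single (n : ℤ) (a b : I) :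
    modeMap wt c n (Finsupp.single a 1) (Finsupp.single b 1)
      = ∑ d ∈ fib wt (wt a + wt b - n - 1), Finsupp.single d (c d a b) := by
  simp [modeMap]

variable {wt}

open Classical in
theorem modeMap_single_apply (hf : ∀ n, {i | wt i = n}.Finite) (n : ℤ) (a b d : I) :
    modeMap wt c n (Finsupp.single a 1) (Finsupp.single b 1) d
      = if (wt d : ℤ) = wt a + wt b - n - 1 then c d a b else 0 := by
  rw [modeMap_single, Finsupp.finsetSum_apply]
  simp only [Finsupp.single_apply, Finset.sum_ite_eq', mem_fib hf]

theorem modeMap_single_single (n : ℤ) (a b : I) (r s : ℂ) :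
    modeMap wt c n (Finsupp.single a r) (Finsupp.single b s)
      = (r * s) • modeMap wt c n (Finsupp.single a 1) (Finsupp.single b 1) := by
  rw [← mul_one r, ← mul_one s, ← smul_eq_mul, ← smul_eq_mul, ← Finsupp.smul_single,
    ← Finsupp.smul_single, map_smul, map_smul, LinearMap.smul_apply, smul_smul]
  simp [mul_comm]

/-- Weights are nonnegative, and for basis vectors the result would have negative weight once `n ≥
wt a + wt b`. -/
theorem modeMap_truncation (x y : I →₀ ℂ) : ∃ N : ℤ, ∀ n ≥ N, modeMap wt c n x y = 0 := by
  induction x using Finsupp.induction_linear with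
  | zero => exact ⟨0, by simp⟩
  | add x₁ x₂ h₁ h₂ =>
    obtain ⟨N₁, h₁⟩ := h₁
    obtain ⟨N₂, h₂⟩ := h₂
    refine ⟨max N₁ N₂, fun n hn => ?_⟩
    rw [map_add, LinearMap.add_apply, h₁ n (le_trans (le_max_left _ _) hn),
      h₂ n (le_trans (le_max_right _ _) hn), add_zero]
  | single a r =>
    induction y using Finsupp.induction_linear with
    | zero => exact ⟨0, by simp⟩
    | add x₁ x₂ h₁ h₂ =>
      obtain ⟨N₁, h₁⟩ := h₁
      obtain ⟨N₂, h₂⟩ := h₂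
      refine ⟨max N₁ N₂, fun n hn => ?_⟩
      rw [map_add, h₁ n (le_trans (le_max_left _ _) hn),
        h₂ n (le_trans (le_max_right _ _) hn), add_zero]
    | single b s =>
      refine ⟨wt a + wt b, fun n hn => ?_⟩
      rw [modeMap_single_single, modeMap_single, fib_of_neg _ (by omega), Finset.sum_empty,
        smul_zero]

theorem fieldMap_bddBelow (wt : I → ℕ) (c : I → I → I → ℂ) (x y : I →₀ ℂ) :
    BddBelow (Function.support fun k : ℤ => modeMap wt c (-k - 1) x y) := by
  obtain ⟨N, hN⟩ := modeMap_truncation (wt := wt) c x y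
  refine ⟨-N, fun k hk => ?_⟩
  by_contra hlt
  exact hk (hN _ (by omega))

/-- The state-field map defined by structure constants. -/
def fieldMap (wt : I → ℕ) (c : I → I → I → ℂ) : (I →₀ ℂ) →ₗ[ℂ] VertexOperator ℂ (I →₀ ℂ) where
  toFun x := VertexOperator.of_coeff (fun k => modeMap wt c (-k - 1) x) (fieldMap_bddBelow wt c x)
  map_add' x y := by
    refine HVertexOperator.coeff_inj ?_
    rw [map_add]
    simp only [VertexOperator.of_coeff, HVertexOperator.coeff_of_coeff, map_add]
    rfl
  map_smul' r x := by
    refine HVertexOperator.coeff_inj ?_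
    rw [map_smul]
    simp only [VertexOperator.of_coeff, HVertexOperator.coeff_of_coeff, map_smul]
    rfl

theorem ncoeff_fieldMap (x : I →₀ ℂ) (n : ℤ) :
    VertexOperator.ncoeff (fieldMap wt c x) n = modeMap wt c n x := by
  have h := VertexOperator.ncoeff_of_coeff _ (fieldMap_bddBelow wt c x) n
  refine h.trans ?_
  rw [show -(-n - 1) - 1 = n by ring]

theorem modeMap_modeMap_right (hf : ∀ n, {i | wt i = n}.Finite) (p q : ℤ) (a b b' d : I) :
    modeMap wt c p (Finsupp.single a 1)
        (modeMap wt c q (Finsupp.single b 1) (Finsupp.single b' 1)) d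
      = if (wt d : ℤ) = wt a + wt b + wt b' - p - q - 2 then
          ∑ i ∈ fib wt (wt b + wt b' - q - 1), c d a i * c i b b' else 0 := by
  classical
  rw [modeMap_single wt c q, map_sum, Finsupp.finsetSum_apply]
  have h1 : ∀ i s, modeMap wt c p (Finsupp.single a 1) (Finsupp.single i s) d
      = s * if (wt d : ℤ) = wt a + wt i - p - 1 then c d a i else 0 := fun i s => by
    rw [modeMap_single_single, Finsupp.smul_apply, modeMap_single_apply c hf, one_mul, smul_eq_mul]
  simp only [h1]
  split_ifs with h
  · refine Finset.sum_congr rfl fun i hi => ?_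
    rw [mem_fib hf] at hi
    rw [if_pos (by omega), mul_comm]
  · refine Finset.sum_eq_zero fun i hi => ?_
    rw [mem_fib hf] at hi
    rw [if_neg (by omega), mul_zero]

theorem modeMap_modeMap_left (hf : ∀ n, {i | wt i = n}.Finite) (p q : ℤ) (a b b' d : I) :
    modeMap wt c p (modeMap wt c q (Finsupp.single a 1) (Finsupp.single b 1))
        (Finsupp.single b' 1) d
      = if (wt d : ℤ) = wt a + wt b + wt b' - p - q - 2 then
          ∑ i ∈ fib wt (wt a + wt b - q - 1), c d i b' * c i a b else 0 := by
  classical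
  rw [modeMap_single wt c q, map_sum, LinearMap.sum_apply, Finsupp.finsetSum_apply]
  have h1 : ∀ i s, modeMap wt c p (Finsupp.single i s) (Finsupp.single b' 1) d
      = s * if (wt d : ℤ) = wt i + wt b' - p - 1 then c d i b' else 0 := fun i s => by
    rw [modeMap_single_single, Finsupp.smul_apply, modeMap_single_apply c hf, mul_one, smul_eq_mul]
  simp only [h1]
  split_ifs with h
  · refine Finset.sum_congr rfl fun i hi => ?_
    rw [mem_fib hf] at hi
    rw [if_pos (by omega), mul_comm]
  · refine Finset.sum_eq_zero fun i hi => ?_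
    rw [mem_fib hf] at hi
    rw [if_neg (by omega), mul_zero]

end Mode

namespace IsVertexStructure

variable {wt : I → ℕ} {v : I} {c : I → I → I → ℂ} (S : IsVertexStructure wt v c)
include S

theorem exists_localFields (x y : I →₀ ℂ) :
    ∃ K, LocalFields K (fun n => modeMap wt c n x) (fun n => modeMap wt c n y) := by
  have add' : ∀ x y : I →₀ ℂ, (fun n => modeMap wt c n (x + y))
      = (fun n => modeMap wt c n x) + (fun n => modeMap wt c n y) := fun x y => by
    ext1 n; exact map_add _ x y
  have zero' : (fun n => modeMap wt c n 0) = 0 := by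
    ext1 n; exact map_zero _
  have single' : ∀ a r, (fun n => modeMap wt c n (Finsupp.single a r))
      = r • (fun n => modeMap wt c n (Finsupp.single a 1)) := fun a r => by
    ext1 n
    rw [Pi.smul_apply, ← map_smul, Finsupp.smul_single, smul_eq_mul, mul_one]
  induction x using Finsupp.induction_linear with
  | zero => exact ⟨0, by rw [zero']; exact LocalFields.zero_left _⟩
  | add x₁ x₂ h₁ h₂ =>
    obtain ⟨K₁, h₁⟩ := h₁
    obtain ⟨K₂, h₂⟩ := h₂
    exact ⟨max K₁ K₂, by
      rw [add']; exact (h₁.mono (le_max_left _ _)).add_left (h₂.mono (le_max_right _ _))⟩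
  | single a r =>
    induction y using Finsupp.induction_linear with
    | zero => exact ⟨0, by rw [zero']; exact LocalFields.zero_right _⟩
    | add x₁ x₂ h₁ h₂ =>
      obtain ⟨K₁, h₁⟩ := h₁
      obtain ⟨K₂, h₂⟩ := h₂
      exact ⟨max K₁ K₂, by
        rw [add' x₁]; exact (h₁.mono (le_max_left _ _)).add_right (h₂.mono (le_max_right _ _))⟩
    | single b s =>
      obtain ⟨K, hK⟩ := S.locality a b
      refine ⟨K, ?_⟩
      rw [single' a, single' b]
      refine LocalFields.smul_smul ?_ r s
      rw [localFields_iff_apply]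
      intro m n y
      induction y using Finsupp.induction_linear with
      | zero => simp
      | add y₁ y₂ h₁ h₂ =>
        refine Eq.trans ?_ ((congrArg₂ (· + ·) h₁ h₂).trans (add_zero 0))
        rw [← Finset.sum_add_distrib]
        refine Finset.sum_congr rfl fun j _ => ?_
        simp only [map_add]
        rw [← smul_add]
        congr 1
        abel
      | single b' t =>
      rw [← mul_one t, ← smul_eq_mul, ← Finsupp.smul_single]
      simp only [map_smul, ← smul_sub, smul_comm _ t]
      rw [← Finset.smul_sum]
      refine (congrArg (t • ·) ?_).trans (smul_zero t)
      ext d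
      rw [Finsupp.finsetSum_apply, Finsupp.zero_apply]
      simp only [Finsupp.smul_apply, Finsupp.sub_apply, modeMap_modeMap_right c S.finite,
        smul_eq_mul]
      -- The two mode indices add up to `m + K + n` for every `j`, so the weight condition on `d` is
      -- the same in all terms. If it holds, the sum is `LocalAt` at the intermediate weight `wt b +
      -- wt b' - n - 1`.
      by_cases h : (wt d : ℤ) = wt a + wt b + wt b' - (m + K) - n - 2
      · rw [← hK b' d (wt b + wt b' - n - 1)]
        refine Finset.sum_congr rfl fun j _ => ?_
        rw [if_pos (by omega), if_pos (by omega)]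
        rw [show (wt b + wt b' - (n + j) - 1 : ℤ) = wt b + wt b' - n - 1 - j by ring,
          show (wt a + wt b' - (m + K - j) - 1 : ℤ) = wt b' + wt d - (wt b + wt b' - n - 1) + j by
            omega]
      · refine Finset.sum_eq_zero fun j _ => ?_
        rw [if_neg (by omega), if_neg (by omega), sub_self, mul_zero]

theorem modeMap_vac (n : ℤ) :
    modeMap wt c n (Finsupp.single v 1) = if n = -1 then LinearMap.id else 0 := by
  classical
  refine Finsupp.lhom_ext fun b t => ?_
  rw [← mul_one t, ← smul_eq_mul, ← Finsupp.smul_single, map_smul, map_smul]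
  congr 1
  ext d
  rw [modeMap_single_apply c S.finite, S.wt_vac]
  by_cases hd : d = b
  · subst hd
    rw [S.vac_self]
    split_ifs with h1 h2 h2
    · simp
    · omega
    · omega
    · simp
  · rw [S.vac_ne d b hd, ite_self]
    split_ifs
    · simp [Ne.symm hd]
    · simp

theorem modeMap_creation (x : I →₀ ℂ) :
    modeMap wt c (-1) x (Finsupp.single v 1) = x := by
  classical
  suffices h : (modeMap wt c (-1)).flip (Finsupp.single v 1) = LinearMap.id from
    LinearMap.congr_fun h x
  refine Finsupp.lhom_ext fun b t => ?_
  rw [← mul_one t, ← smul_eq_mul, ← Finsupp.smul_single, map_smul, map_smul]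
  congr 1
  ext d
  rw [LinearMap.flip_apply, modeMap_single_apply c S.finite, S.wt_vac]
  by_cases hd : d = b
  · subst hd
    rw [S.creation_self, if_pos (by simp)]
    simp
  · split_ifs with h
    · rw [S.creation_ne d b (by omega) hd]
      simp [Ne.symm hd]
    · simp [Ne.symm hd]

theorem modeMap_creation_nonneg (x : I →₀ ℂ) {n : ℤ} (hn : 0 ≤ n) :
    modeMap wt c n x (Finsupp.single v 1) = 0 := by
  classical
  suffices h : (modeMap wt c n).flip (Finsupp.single v 1) = 0 from
    LinearMap.congr_fun h x
  refine Finsupp.lhom_ext fun b t => ?_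
  rw [← mul_one t, ← smul_eq_mul, ← Finsupp.smul_single, map_smul, map_smul]
  congr 1
  ext d
  rw [LinearMap.flip_apply, modeMap_single_apply c S.finite, S.wt_vac]
  split_ifs with h
  · rw [S.creation_ne d b (by omega) (by rintro rfl; omega)]
    simp
  · simp

theorem modeMap_translation (x y : I →₀ ℂ) (n : ℤ) :
    modeMap wt c (-2) (modeMap wt c n x y) (Finsupp.single v 1)
      - modeMap wt c n x (modeMap wt c (-2) y (Finsupp.single v 1))
      = -(n : ℂ) • modeMap wt c (n - 1) x y := by
  classical
  rw [sub_eq_iff_eq_add']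
  suffices h : (modeMap wt c n).compr₂ ((modeMap wt c (-2)).flip (Finsupp.single v 1))
      = (modeMap wt c n).compl₂ ((modeMap wt c (-2)).flip (Finsupp.single v 1))
        + -(n : ℂ) • modeMap wt c (n - 1) from
    LinearMap.congr_fun (LinearMap.congr_fun h x) y
  refine Finsupp.lhom_ext fun a s => ?_
  rw [← mul_one s, ← smul_eq_mul, ← Finsupp.smul_single, map_smul, map_smul]
  congr 1
  refine Finsupp.lhom_ext fun b t => ?_
  rw [← mul_one t, ← smul_eq_mul, ← Finsupp.smul_single, map_smul, map_smul]
  congr 1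
  ext d
  simp only [LinearMap.add_apply, LinearMap.compr₂_apply, LinearMap.compl₂_apply,
    LinearMap.flip_apply, LinearMap.smul_apply, Finsupp.add_apply, Finsupp.smul_apply,
    modeMap_modeMap_left c S.finite, modeMap_modeMap_right c S.finite,
    modeMap_single_apply c S.finite, S.wt_vac]
  by_cases h : (wt d : ℤ) = wt a + wt b - n
  · rw [if_pos (by push_cast; omega), if_pos (by push_cast; omega), if_pos (by omega)]
    have := S.translation d a b
    rw [smul_eq_mul, show (n : ℂ) = (wt a : ℂ) + wt b - wt d by
      rw [show n = wt a + wt b - wt d by omega]; push_cast; ring, ← this]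
    rw [← sub_eq_iff_eq_add']
    congr 2
    · congr 1
      omega
    · congr 1
      push_cast
      ring
  · rw [if_neg (by push_cast; omega), if_neg (by push_cast; omega), if_neg (by omega)]
    simp

end IsVertexStructure

/-- The vertex algebra with given structure constants. -/
def IsVertexStructure.vertexAlgebra {wt : I → ℕ} {v : I} {c : I → I → I → ℂ}
    (S : IsVertexStructure wt v c) : VertexAlgebra (I →₀ ℂ) where
  vac := Finsupp.single v 1
  Y := fieldMap wt c
  T := (modeMap wt c (-2)).flip (Finsupp.single v 1)
  vac_mode_neg_one b := by rw [ncoeff_fieldMap, S.modeMap_vac, if_pos rfl, LinearMap.id_apply]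
  vac_mode_of_ne n b hn := by rw [ncoeff_fieldMap, S.modeMap_vac, if_neg hn, LinearMap.zero_apply]
  creation_neg_one a := by rw [ncoeff_fieldMap, S.modeMap_creation]
  creation_of_nonneg a n hn := by rw [ncoeff_fieldMap, S.modeMap_creation_nonneg a hn]
  translation_vac := by
    rw [LinearMap.flip_apply, S.modeMap_vac, if_neg (by norm_num), LinearMap.zero_apply]
  translation a b n := by
    simp only [ncoeff_fieldMap, LinearMap.flip_apply]
    exact S.modeMap_translation a b n
  locality a b := by
    obtain ⟨K, hK⟩ := S.exists_localFields a b
    refine ⟨K, fun m n x => ?_⟩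
    simpa only [ncoeff_fieldMap] using (localFields_iff_apply _ _ _).1 hK m n x

theorem IsVertexStructure.vertexAlgebra_mode {wt : I → ℕ} {v : I} {c : I → I → I → ℂ}
    (S : IsVertexStructure wt v c) (n : ℤ) : S.vertexAlgebra.mode n = modeMap wt c n := by
  exact LinearMap.ext fun x => ncoeff_fieldMap c x n

end Structure

/-! ## Structure constants of a unitary vertex operator algebra in a real basis -/

namespace RealBasis

variable {V : Type*} [AddCommGroup V] [Module ℂ V] {U : UnitaryVOA V} {ι : Type*}
  (Φ : RealBasis U ι)

/-- Orthonormality lets the Hermitian form be traded for coordinates, which compose as matrices. -/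
theorem form_basis (i : ι) (u : V) : U.form (Φ.basis i) u = Φ.basis.repr u i := by
  suffices h : U.form (Φ.basis i) = Finsupp.lapply i ∘ₗ Φ.basis.repr.toLinearMap from
    LinearMap.congr_fun h u
  refine Φ.basis.ext fun j => ?_
  by_cases hij : i = j
  · subst hij
    simp [Φ.orthonormal_self]
  · simp [Φ.orthonormal_ne i j hij, Ne.symm hij]

theorem repr_eq_zero_of_mem_weightSpace {n : ℤ} {u : V} (hu : u ∈ U.weightSpace n) {i : ι}
    (hi : (Φ.wt i : ℤ) ≠ n) : Φ.basis.repr u i = 0 := by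
  -- The coordinate functional is an eigenvector of the transpose of `L 0` with eigenvalue `wt i`,
  -- so it vanishes on vectors with another eigenvalue.
  have h : Finsupp.lapply i ∘ₗ Φ.basis.repr.toLinearMap ∘ₗ U.L 0
      = (Φ.wt i : ℂ) • (Finsupp.lapply i ∘ₗ Φ.basis.repr.toLinearMap) := by
    refine Φ.basis.ext fun j => ?_
    have hj := (U.mem_weightSpace).1 (Φ.homogeneous j)
    by_cases hij : i = j
    · subst hij
      simp [hj]
    · simp [hj, Ne.symm hij]
  have h' := LinearMap.congr_fun h u
  simp only [LinearMap.comp_apply, (U.mem_weightSpace).1 hu, LinearMap.smul_apply, map_smul,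
    smul_eq_mul] at h'
  have hne : ((n : ℂ) - Φ.wt i) ≠ 0 := by
    rw [sub_ne_zero]
    exact_mod_cast Ne.symm hi
  have := mul_eq_zero.1 ((sub_mul _ _ _).trans (sub_eq_zero.2 h'))
  exact this.resolve_left hne

theorem wt_eq_of_mem_weightSpace {n : ℤ} {i : ι} (hi : Φ.basis i ∈ U.weightSpace n) :
    (Φ.wt i : ℤ) = n := by
  by_contra h
  have := Φ.repr_eq_zero_of_mem_weightSpace hi h
  simp at this

/-- These basis vectors are linearly independent in a finite-dimensional weight space. -/
theorem finite_wt (n : ℕ) : {i | Φ.wt i = n}.Finite := by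
  have : Module.Finite ℂ (U.weightSpace n) := U.finite_weight n
  have hli : LinearIndependent ℂ (fun i : {i | Φ.wt i = n} => Φ.basis i) :=
    Φ.basis.linearIndependent.comp _ Subtype.val_injective
  let w : {i | Φ.wt i = n} → U.weightSpace n := fun i =>
    ⟨Φ.basis i, by have := Φ.homogeneous i; rwa [show Φ.wt i = n from i.2] at this⟩
  have hw : LinearIndependent ℂ w := by
    refine LinearIndependent.of_comp (U.weightSpace n).subtype ?_
    exact hli
  exact Set.finite_coe_iff.1 hw.finite

section CFT

variable (hU : U.IsCFTType)
include hU

theorem wt_vacIdx : Φ.wt Φ.vacIdx = 0 := by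
  have : Φ.basis Φ.vacIdx ∈ U.weightSpace 0 := by
    rw [hU.2.2, Φ.basis_vacIdx]
    exact Submodule.mem_span_singleton_self _
  exact_mod_cast Φ.wt_eq_of_mem_weightSpace this

theorem wt_eq_zero_iff {i : ι} : Φ.wt i = 0 ↔ i = Φ.vacIdx := by
  refine ⟨fun h => ?_, fun h => h ▸ Φ.wt_vacIdx hU⟩
  have hi := Φ.homogeneous i
  rw [h, Nat.cast_zero, hU.2.2, ← Φ.basis_vacIdx, Submodule.mem_span_singleton] at hi
  obtain ⟨r, hr⟩ := hi
  by_contra hne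
  have := congrArg (fun u => Φ.basis.repr u i) hr
  simp [Ne.symm hne] at this

end CFT

/-- The structure constants of `U` in the basis `Φ`. -/
def structConst (i j k : ι) : ℂ :=
  U.form (Φ.basis i) (U.mode ((Φ.wt j : ℤ) + Φ.wt k - Φ.wt i - 1) (Φ.basis j) (Φ.basis k))

open Classical in
theorem form_mode (d a b : ι) (n : ℤ) :
    U.form (Φ.basis d) (U.mode n (Φ.basis a) (Φ.basis b))
      = if (Φ.wt d : ℤ) = Φ.wt a + Φ.wt b - n - 1 then Φ.structConst d a b else 0 := by
  split_ifs with h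
  · rw [structConst, show (Φ.wt a : ℤ) + Φ.wt b - Φ.wt d - 1 = n by omega]
  · rw [form_basis]
    exact Φ.repr_eq_zero_of_mem_weightSpace
      (U.mode_mem_weightSpace (Φ.homogeneous a) (Φ.homogeneous b) n) h

theorem repr_mode (n : ℤ) (u w : V) : Φ.basis.repr (U.mode n u w)
    = modeMap Φ.wt Φ.structConst n (Φ.basis.repr u) (Φ.basis.repr w) := by
  classical
  suffices h : (U.mode n).compr₂ Φ.basis.repr.toLinearMap
      = (modeMap Φ.wt Φ.structConst n).compl₁₂ Φ.basis.repr.toLinearMap Φ.basis.repr.toLinearMap from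
    LinearMap.congr_fun (LinearMap.congr_fun h u) w
  refine Φ.basis.ext fun a => Φ.basis.ext fun b => ?_
  ext d
  simp only [LinearMap.compr₂_apply, LinearMap.compl₁₂_apply, LinearEquiv.coe_coe,
    Module.Basis.repr_self]
  rw [← form_basis, form_mode, modeMap_single_apply _ Φ.finite_wt]

theorem isVertexStructure (hU : U.IsCFTType) :
    IsVertexStructure Φ.wt Φ.vacIdx Φ.structConst where
  finite := Φ.finite_wt
  wt_vac := Φ.wt_vacIdx hU
  vac_self i := by
    rw [structConst, Φ.basis_vacIdx, Φ.wt_vacIdx hU]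
    rw [show (((0 : ℕ) : ℤ) + Φ.wt i - Φ.wt i - 1) = -1 by simp, VertexAlgebra.mode_apply,
      U.vac_mode_neg_one, Φ.orthonormal_self]
  vac_ne i k hik := by
    rw [structConst, Φ.basis_vacIdx, VertexAlgebra.mode_apply]
    by_cases h : ((Φ.wt Φ.vacIdx : ℤ) + Φ.wt k - Φ.wt i - 1) = -1
    · rw [h, U.vac_mode_neg_one, Φ.orthonormal_ne _ _ hik]
    · rw [U.vac_mode_of_ne _ _ h, map_zero]
  creation_self i := by
    rw [structConst, Φ.basis_vacIdx, Φ.wt_vacIdx hU]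
    rw [show ((Φ.wt i : ℤ) + ((0 : ℕ) : ℤ) - Φ.wt i - 1) = -1 by simp, VertexAlgebra.mode_apply,
      U.creation_neg_one, Φ.orthonormal_self]
  creation_ne i j hle hij := by
    rw [structConst, Φ.basis_vacIdx, Φ.wt_vacIdx hU, VertexAlgebra.mode_apply]
    by_cases h : Φ.wt i = Φ.wt j
    · rw [show ((Φ.wt j : ℤ) + ((0 : ℕ) : ℤ) - Φ.wt i - 1) = -1 by omega, U.creation_neg_one,
        Φ.orthonormal_ne _ _ hij]
    · rw [U.creation_of_nonneg _ _ (by omega), map_zero]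
  translation d a b := by
    -- The mode is chosen so that `a₍ₙ₎ b` has weight `wt d - 1`, which `T` raises to `wt d`.
    have h := congrArg (fun u => Φ.basis.repr u d)
      (U.translation (Φ.basis a) (Φ.basis b) ((Φ.wt a : ℤ) + Φ.wt b - Φ.wt d))
    simp only [← VertexAlgebra.mode_apply, VertexAlgebra.T_eq, map_sub, map_smul, repr_mode,
      ← Φ.basis_vacIdx, Module.Basis.repr_self, Finsupp.sub_apply, Finsupp.smul_apply,
      modeMap_modeMap_left _ Φ.finite_wt, modeMap_modeMap_right _ Φ.finite_wt,
      modeMap_single_apply _ Φ.finite_wt, Φ.wt_vacIdx hU] at h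
    rw [if_pos (by push_cast; omega), if_pos (by push_cast; omega), if_pos (by omega)] at h
    push_cast at h
    rw [smul_eq_mul] at h
    rw [← h]
    congr 2
    · congr 1; omega
    · congr 1; omega
  locality a b := by
    obtain ⟨K, hK⟩ := U.locality (Φ.basis a) (Φ.basis b)
    refine ⟨K, fun b' d r => ?_⟩
    -- The index of the inner mode makes the intermediate weight `r - j`; the other is then forced
    -- by the weight of `d`.
    have h := congrArg (fun u => Φ.basis.repr u d) (hK
      ((Φ.wt a : ℤ) - Φ.wt d - K + r - 1) (Φ.wt b + Φ.wt b' - r - 1) (Φ.basis b'))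
    simp only [← VertexAlgebra.mode_apply, map_sub, map_smul, map_sum, repr_mode,
      Module.Basis.repr_self, Finsupp.finsetSum_apply, Finsupp.sub_apply, Finsupp.smul_apply,
      modeMap_modeMap_right _ Φ.finite_wt, map_zero, Finsupp.zero_apply] at h
    rw [← h]
    refine Finset.sum_congr rfl fun j _ => ?_
    rw [if_pos (by omega), if_pos (by omega), smul_eq_mul,
      show (Φ.wt b + Φ.wt b' - (Φ.wt b + Φ.wt b' - r - 1 + j) - 1 : ℤ) = r - j by ring,
      show (Φ.wt a + Φ.wt b' - (Φ.wt a - Φ.wt d - K + r - 1 + K - j) - 1 : ℤ)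
        = Φ.wt b' + Φ.wt d - r + j by ring]

end RealBasis

/-! ## Locality in terms of power series -/

section PowerSeries

/-- The backward difference operator. -/
def nabla : Module.End ℂ (ℤ → ℂ) := shift 0 - shift (-1)

theorem nabla_apply (F : ℤ → ℂ) (r : ℤ) : nabla F r = F r - F (r - 1) := by
  simp [nabla, shift_apply, sub_eq_add_neg]

theorem nabla_pow_of_neg {F : ℤ → ℂ} (hF : ∀ k < 0, F k = 0) (K : ℕ) :
    ∀ k < 0, (nabla ^ K) F k = 0 := by
  induction K with
  | zero => simpa using hF
  | succ K ih =>
    intro k hk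
    rw [pow_succ', Module.End.mul_apply, nabla_apply, ih k hk, ih (k - 1) (by omega), sub_zero]

/-- Reflection turns backward into forward differences: each costs a sign and a shift by one. -/
theorem nabla_pow_comp_sub (G : ℤ → ℂ) (e : ℤ) (K : ℕ) (r : ℤ) :
    (nabla ^ K) (fun r => G (e - r)) r = (-1) ^ K * (nabla ^ K) G (e + K - r) := by
  induction K generalizing r with
  | zero => simp
  | succ K ih =>
    rw [pow_succ', Module.End.mul_apply, Module.End.mul_apply, nabla_apply, nabla_apply, ih, ih,
      show e + ((K + 1 : ℕ) : ℤ) - r = e + K - (r - 1) by push_cast; ring,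
      show e + (K : ℤ) - (r - 1) - 1 = e + K - r by ring]
    ring

theorem localAt_iff_nabla (K : ℕ) (e : ℤ) (F G : ℤ → ℂ) :
    LocalAt K e F G ↔ ∀ r, (nabla ^ K) F r = (-1) ^ K * (nabla ^ K) G (e + K - r) := by
  rw [localAt_iff, ← nabla]
  have : (fun r => F r - G (e - r)) = F - fun r => G (e - r) := rfl
  rw [this, map_sub, sub_eq_zero, funext_iff]
  simp only [nabla_pow_comp_sub]

/-- The power series with the coefficients `F k` for `k ≥ 0`. -/
def toPowerSeries (F : ℤ → ℂ) : PowerSeries ℂ := PowerSeries.mk fun k => F k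

theorem coeff_toPowerSeries (F : ℤ → ℂ) (n : ℕ) :
    PowerSeries.coeff n (toPowerSeries F) = F n := PowerSeries.coeff_mk _ _

theorem toPowerSeries_nabla_pow {F : ℤ → ℂ} (hF : ∀ k < 0, F k = 0) (K : ℕ) :
    toPowerSeries ((nabla ^ K) F) = (1 - PowerSeries.X) ^ K * toPowerSeries F := by
  induction K with
  | zero => simp
  | succ K ih =>
    rw [pow_succ' (1 - PowerSeries.X), mul_assoc, ← ih, pow_succ', Module.End.mul_apply]
    ext n
    rw [sub_mul, one_mul, map_sub, coeff_toPowerSeries, coeff_toPowerSeries, nabla_apply]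
    cases n with
    | zero => rw [nabla_pow_of_neg hF K (((0 : ℕ) : ℤ) - 1) (by simp), PowerSeries.coeff_zero_X_mul]
    | succ n =>
      rw [PowerSeries.coeff_succ_X_mul, coeff_toPowerSeries,
        show ((n + 1 : ℕ) : ℤ) - 1 = n by push_cast; ring]

/-- `∇ ^ K F` lives on `r ≥ 0`, while the reflection of `∇ ^ K G` lives on `r ≤ e + K`. Equality up
to sign confines both to `[0, e + K]`, so they are the coefficients of one polynomial read from
opposite ends. This is the rational function behind a correlator, expanded in two regions; unlike
`LocalAt`, the condition is visibly multiplicative. -/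
theorem localAt_iff_polynomial {F G : ℤ → ℂ} (hF : ∀ k < 0, F k = 0) (hG : ∀ k < 0, G k = 0)
    (K e : ℕ) : LocalAt K e F G ↔ ∃ P : Polynomial ℂ, P.natDegree ≤ e + K ∧
      (1 - PowerSeries.X) ^ K * toPowerSeries F = (P : PowerSeries ℂ) ∧
      (-1) ^ K * ((1 - PowerSeries.X) ^ K * toPowerSeries G)
        = (Polynomial.reflect (e + K) P : PowerSeries ℂ) := by
  rw [localAt_iff_nabla, ← toPowerSeries_nabla_pow hF, ← toPowerSeries_nabla_pow hG]
  have hF' := nabla_pow_of_neg hF K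
  have hG' := nabla_pow_of_neg hG K
  set F' := (nabla ^ K) F
  set G' := (nabla ^ K) G
  have hsign : ∀ n, PowerSeries.coeff n ((-1) ^ K * toPowerSeries G') = (-1) ^ K * G' n := by
    intro n
    rcases Nat.even_or_odd K with h | h <;> simp [h.neg_one_pow, coeff_toPowerSeries]
  constructor
  · intro h
    refine ⟨PowerSeries.trunc (e + K + 1) (toPowerSeries F'), ?_, ?_, ?_⟩
    · exact Nat.lt_succ_iff.1 (PowerSeries.natDegree_trunc_lt _ _)
    · ext n
      rw [Polynomial.coeff_coe, PowerSeries.coeff_trunc, coeff_toPowerSeries]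
      split_ifs with hn
      · rfl
      · rw [h, hG' _ (by omega), mul_zero]
    · ext n
      rw [hsign, Polynomial.coeff_coe, Polynomial.coeff_reflect]
      by_cases hn : n ≤ e + K
      · rw [Polynomial.revAt_le hn, PowerSeries.coeff_trunc, if_pos (by omega),
          coeff_toPowerSeries, h]
        congr 2
        push_cast [hn]; ring
      -- `Polynomial.revAt` fixes indices above `e + K`, where the truncated polynomial has
      -- coefficient zero, so the required vanishing of `G'` comes from `F'` at negative arguments.
      · rw [Polynomial.revAt_eq_self_of_lt (by omega), PowerSeries.coeff_trunc, if_neg (by omega)]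
        have := h (e + K - n)
        rw [hF' _ (by omega)] at this
        rw [this]
        congr 2
        ring
  · rintro ⟨P, hP, h₁, h₂⟩ r
    have c₁ : ∀ n : ℕ, F' n = P.coeff n := fun n => by
      rw [← Polynomial.coeff_coe, ← h₁, coeff_toPowerSeries]
    have c₂ : ∀ n : ℕ, (-1) ^ K * G' n = P.coeff (Polynomial.revAt (e + K) n) := fun n => by
      rw [← Polynomial.coeff_reflect, ← Polynomial.coeff_coe, ← h₂, hsign]
    rcases lt_or_ge r 0 with hr | hr
    · have := c₂ (e + K - r).toNat
      rw [Polynomial.revAt_eq_self_of_lt (by omega), Polynomial.coeff_eq_zero_of_natDegree_lt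
        (by omega), show (((e + K - r : ℤ).toNat : ℕ) : ℤ) = e + K - r by omega] at this
      rw [this, hF' r hr]
    · lift r to ℕ using hr
      rw [c₁]
      by_cases hn : r ≤ e + K
      · have := c₂ (e + K - r)
        rw [Polynomial.revAt_le (by omega), show e + K - (e + K - r) = r by omega] at this
        rw [← this]
        push_cast [hn]; rfl
      · rw [hG' _ (by omega), mul_zero, Polynomial.coeff_eq_zero_of_natDegree_lt (by omega)]

theorem reflect_prod {X : Type*} (s : Finset X) (N : X → ℕ) (P : X → Polynomial ℂ)
    (h : ∀ x ∈ s, (P x).natDegree ≤ N x) :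
    Polynomial.reflect (∑ x ∈ s, N x) (∏ x ∈ s, P x) = ∏ x ∈ s, Polynomial.reflect (N x) (P x) := by
  classical
  induction s using Finset.induction_on with
  | empty => ext n; cases n <;> simp [Polynomial.coeff_one]
  | insert a s ha ih =>
    rw [Finset.sum_insert ha, Finset.prod_insert ha, Finset.prod_insert ha,
      Polynomial.reflect_mul _ _ (h a (Finset.mem_insert_self a s)),
      ih fun x hx => h x (Finset.mem_insert_of_mem hx)]
    refine (Polynomial.natDegree_prod_le _ _).trans (Finset.sum_le_sum fun x hx => ?_)
    exact h x (Finset.mem_insert_of_mem hx)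

/-- The product of the site polynomials serves as the polynomial of the product: degree bounds and
orders add, and reflections and signs multiply. -/
theorem LocalAt.prod {X : Type*} [Fintype X] {K e : X → ℕ} {F G : X → ℤ → ℂ} {F' G' : ℤ → ℂ}
    (h : ∀ x, LocalAt (K x) (e x) (F x) (G x)) (hF : ∀ x, ∀ k < 0, F x k = 0)
    (hG : ∀ x, ∀ k < 0, G x k = 0) (hF' : ∀ k < 0, F' k = 0) (hG' : ∀ k < 0, G' k = 0)
    (eF : toPowerSeries F' = ∏ x, toPowerSeries (F x))
    (eG : toPowerSeries G' = ∏ x, toPowerSeries (G x)) :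
    LocalAt (∑ x, K x) (∑ x, e x : ℕ) F' G' := by
  choose P hdeg h₁ h₂ using fun x => (localAt_iff_polynomial (hF x) (hG x) _ _).1 (h x)
  refine (localAt_iff_polynomial hF' hG' _ _).2 ⟨∏ x, P x, ?_, ?_, ?_⟩
  · rw [← Finset.sum_add_distrib]
    exact (Polynomial.natDegree_prod_le _ _).trans (Finset.sum_le_sum fun x _ => hdeg x)
  · rw [eF, ← Finset.prod_pow_eq_pow_sum, ← Finset.prod_mul_distrib,
      ← Polynomial.coeToPowerSeries.ringHom_apply, map_prod]
    exact Finset.prod_congr rfl fun x _ => h₁ x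
  · rw [eG, ← Finset.prod_pow_eq_pow_sum, ← Finset.prod_pow_eq_pow_sum, ← Finset.prod_mul_distrib,
      ← Finset.prod_mul_distrib, ← Finset.sum_add_distrib, reflect_prod _ _ _ fun x _ => hdeg x,
      ← Polynomial.coeToPowerSeries.ringHom_apply, map_prod]
    exact Finset.prod_congr rfl fun x _ => h₂ x

end PowerSeries

/-! ## Products of vertex structures -/

section Product

variable {I X : Type*} [Fintype X] {wt : I → ℕ} {v : I} {c : I → I → I → ℂ}

/-- The weight of a function. -/
def piWt (wt : I → ℕ) (h : X → I) : ℕ := ∑ x, wt (h x)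

/-- The structure constants of a tensor power. -/
def piConst (c : I → I → I → ℂ) (d a b : X → I) : ℂ := ∏ x, c (d x) (a x) (b x)

theorem finite_piWt (hf : ∀ n, {i | wt i = n}.Finite) (n : ℕ) :
    {h : X → I | piWt wt h = n}.Finite := by
  have h1 : (⋃ k ∈ Set.Iic n, {i | wt i = k}).Finite := (Set.finite_Iic n).biUnion fun k _ => hf k
  refine (Set.Finite.pi' (fun _ : X => h1)).subset fun h hh x => ?_
  refine Set.mem_biUnion (x := wt (h x)) (Set.mem_Iic.2 ?_) rfl
  rw [← show piWt wt h = n from hh]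
  exact Finset.single_le_sum (f := fun x => wt (h x)) (fun _ _ => Nat.zero_le _) (Finset.mem_univ x)

/-- Expanding the product distributes the degree over the sites, and injectivity of `s x` recovers
the distribution from the weights. The set `T` may contain further functions, provided that each has
a vanishing factor; the Leibniz rule for translation needs this slack. -/
theorem coeff_prod_fib (hf : ∀ n, {i | wt i = n}.Finite) (s : X → ℕ → ℤ)
    (hs : ∀ x, Function.Injective (s x)) (φ : X → I → ℂ) (n : ℕ) (T : Finset (X → I))
    (hT : ∀ (h : X → I) (p : X → ℕ), ∑ x, p x = n → (∀ x, (wt (h x) : ℤ) = s x (p x)) → h ∈ T)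
    (hT' : ∀ h ∈ T, (∀ p : X → ℕ, ∑ x, p x = n → ∃ x, (wt (h x) : ℤ) ≠ s x (p x)) →
      ∃ x, φ x (h x) = 0) :
    PowerSeries.coeff n (∏ x, PowerSeries.mk fun k => ∑ i ∈ fib wt (s x k), φ x i)
      = ∑ h ∈ T, ∏ x, φ x (h x) := by
  classical
  rw [PowerSeries.coeff_prod]
  simp only [PowerSeries.coeff_mk, Finset.prod_univ_sum]
  rw [← Finset.sum_biUnion]
  · refine Finset.sum_subset (fun h hh => ?_) fun h hh hn => ?_
    · simp only [Finset.mem_biUnion, Finset.mem_finsuppAntidiag, Fintype.mem_piFinset,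
        mem_fib hf] at hh
      obtain ⟨p, hp, hh⟩ := hh
      exact hT h p hp.1 hh
    · obtain ⟨x, hx⟩ := hT' h hh fun p hp => by
        by_contra hcon
        push Not at hcon
        refine hn (Finset.mem_biUnion.2 ⟨Finsupp.equivFunOnFinite.symm p, ?_, ?_⟩)
        · simp [Finset.mem_finsuppAntidiag, hp]
        · simpa [Fintype.mem_piFinset, mem_fib hf] using hcon
      exact Finset.prod_eq_zero (Finset.mem_univ x) hx
  · intro p _ q _ hpq
    refine Finset.disjoint_left.2 fun h h₁ h₂ => hpq ?_
    ext x
    rw [Fintype.mem_piFinset] at h₁ h₂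
    exact hs x (((mem_fib hf).1 (h₁ x)).symm.trans ((mem_fib hf).1 (h₂ x)))

namespace IsVertexStructure

variable (S : IsVertexStructure wt v c)
include S

/-- Orders of locality can be chosen to vanish if one of the two fields is the vacuum. -/
theorem exists_order : ∃ κ : I → I → ℕ, (∀ a, κ a v = 0) ∧ (∀ b, κ v b = 0) ∧
    ∀ a b b' d, LocalAt (κ a b) (wt b' + wt d)
      (fun k => ∑ i ∈ fib wt k, c d a i * c i b b')
      (fun k => ∑ i ∈ fib wt k, c d b i * c i a b') := by
  classical
  choose κ hκ using S.locality
  -- The vacuum acts as the identity, so in `hL` and `hR` a single intermediate index survives. The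
  -- two orderings then agree term by term, which is locality of order zero.
  have hL : ∀ (u d b' : I) (k : ℤ), ∑ i ∈ fib wt k, c d v i * c i u b'
      = if (wt d : ℤ) = k then c d u b' else 0 := by
    intro u d b' k
    have h : ∑ i ∈ fib wt k, (if i = d then c i u b' else 0)
        = if (wt d : ℤ) = k then c d u b' else 0 := by simp [mem_fib S.finite]
    rw [← h]
    refine Finset.sum_congr rfl fun i _ => ?_
    split_ifs with h
    · rw [h, S.vac_self, one_mul]
    · rw [S.vac_ne d i (Ne.symm h), zero_mul]
  have hR : ∀ (u d b' : I) (k : ℤ), ∑ i ∈ fib wt k, c d u i * c i v b'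
      = if (wt b' : ℤ) = k then c d u b' else 0 := by
    intro u d b' k
    have h : ∑ i ∈ fib wt k, (if i = b' then c d u i else 0)
        = if (wt b' : ℤ) = k then c d u b' else 0 := by simp [mem_fib S.finite]
    rw [← h]
    refine Finset.sum_congr rfl fun i _ => ?_
    split_ifs with h
    · rw [h, S.vac_self, mul_one]
    · rw [S.vac_ne i b' h, mul_zero]
  refine ⟨fun a b => if a = v ∨ b = v then 0 else κ a b, by simp, by simp, fun a b b' d => ?_⟩
  beta_reduce
  split_ifs with h
  · intro r
    rw [zero_add, Finset.sum_range_one]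
    rcases h with rfl | rfl
    · simp only [hL, hR]
      rw [if_congr (P := (wt d : ℤ) = r - (0 : ℕ)) (Q := (wt b' : ℤ) = wt b' + wt d - r + (0 : ℕ))
        (by constructor <;> intro <;> omega) rfl rfl, sub_self, mul_zero]
    · simp only [hL, hR]
      rw [if_congr (P := (wt b' : ℤ) = r - (0 : ℕ)) (Q := (wt d : ℤ) = wt b' + wt d - r + (0 : ℕ))
        (by constructor <;> intro <;> omega) rfl rfl, sub_self, mul_zero]
  · exact hκ a b b' d

/-- Summing over intermediate functions of all weights factors the generating series over the sites,
and `LocalAt.prod` applies. The explicit order, a sum over sites, is what later gives a bound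
independent of `N`. -/
theorem piConst_locality {κ : I → I → ℕ} (hκ : ∀ a b b' d, LocalAt (κ a b) (wt b' + wt d)
      (fun k => ∑ i ∈ fib wt k, c d a i * c i b b')
      (fun k => ∑ i ∈ fib wt k, c d b i * c i a b')) (a b b' d : X → I) :
    LocalAt (∑ x, κ (a x) (b x)) (piWt wt b' + piWt wt d)
      (fun k => ∑ h ∈ fib (piWt wt) k, piConst c d a h * piConst c h b b')
      (fun k => ∑ h ∈ fib (piWt wt) k, piConst c d b h * piConst c h a b') := by
  have hgen : ∀ a b : X → I, toPowerSeries
      (fun k => ∑ h ∈ fib (piWt wt) k, piConst c d a h * piConst c h b b')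
      = ∏ x, toPowerSeries fun k => ∑ i ∈ fib wt k, c (d x) (a x) i * c i (b x) (b' x) := by
    intro a b
    ext n
    rw [coeff_toPowerSeries]
    have := coeff_prod_fib (X := X) S.finite (fun _ k => k) (fun _ => Nat.cast_injective)
      (fun x i => c (d x) (a x) i * c i (b x) (b' x)) n (fib (piWt wt) n) ?_ ?_
    · simp only [toPowerSeries]
      rw [this]
      simp only [piConst, Finset.prod_mul_distrib]
    · intro h p hp hh
      rw [mem_fib (finite_piWt S.finite), piWt, ← hp]
      push_cast
      exact Finset.sum_congr rfl fun x _ => hh x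
    · intro h hh hcon
      rw [mem_fib (finite_piWt S.finite)] at hh
      obtain ⟨x, hx⟩ := hcon (fun x => wt (h x)) (by exact_mod_cast hh)
      exact absurd rfl hx
  have := LocalAt.prod (K := fun x => κ (a x) (b x)) (e := fun x => wt (b' x) + wt (d x))
    (fun x => by exact_mod_cast hκ (a x) (b x) (b' x) (d x)) (fun x => ?_) (fun x => ?_) ?_ ?_
    (hgen a b) (hgen b a)
  · simpa [piWt, Finset.sum_add_distrib] using this
  all_goals
    intro k hk
    simp only [fib_of_neg _ hk, Finset.sum_empty]

/-- A Leibniz rule. `R` grades the first sum by weight lost below `d`, `Q` the second by weight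
gained above `b`. Both have constant terms `c (d x) (a x) (b x)`, and by the one-site axiom their
linear terms differ by a multiple of it. The linear term of the product over sites adds these
multiples. -/
theorem piConst_translation (d a b : X → I) :
    ∑ i ∈ fib (piWt wt) (piWt wt d - 1), piConst c d i (fun _ => v) * piConst c i a b
      - ∑ k ∈ fib (piWt wt) (piWt wt b + 1), piConst c d a k * piConst c k b (fun _ => v)
      = -((piWt wt a : ℂ) + piWt wt b - piWt wt d) * piConst c d a b := by
  classical
  set R : X → PowerSeries ℂ := fun x => PowerSeries.mk fun j => ∑ i ∈ fib wt (wt (d x) - j),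
    c (d x) i v * c i (a x) (b x) with hR
  set Q : X → PowerSeries ℂ := fun x => PowerSeries.mk fun j => ∑ k ∈ fib wt (wt (b x) + j),
    c (d x) (a x) k * c k (b x) v with hQ
  have e₁ : PowerSeries.coeff 1 (∏ x, R x) = ∑ i ∈ fib (piWt wt) (piWt wt d - 1),
      piConst c d i (fun _ => v) * piConst c i a b := by
    simp only [piConst, ← Finset.prod_mul_distrib]
    refine coeff_prod_fib S.finite (fun x k => (wt (d x) : ℤ) - k)
      (fun x k l h => by simpa using h) (fun x i => c (d x) i v * c i (a x) (b x)) 1 _ ?_ ?_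
    · intro h p hp hh
      rw [mem_fib (finite_piWt S.finite), piWt, piWt]
      push_cast
      rw [Finset.sum_congr rfl fun x _ => hh x, Finset.sum_sub_distrib, ← Nat.cast_sum Finset.univ p, hp]
      rfl
    · intro h hh hcon
      rw [mem_fib (finite_piWt S.finite)] at hh
      by_contra hne
      push Not at hne
      -- Moving weight upwards at one site and downwards at another is compatible with the total
      -- weight, but such terms vanish by the creation axiom.
      have hle : ∀ x, wt (h x) ≤ wt (d x) := by
        intro x
        by_contra hlt
        refine hne x ?_
        rw [S.creation_ne (d x) (h x) (by omega) (by rintro h'; rw [h'] at hlt; omega), zero_mul]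
      obtain ⟨x, hx⟩ := hcon (fun x => wt (d x) - wt (h x)) (by
        rw [Finset.sum_tsub_distrib _ fun x _ => hle x]
        simp only [piWt] at hh
        omega)
      have := hle x
      omega
  have e₂ : PowerSeries.coeff 1 (∏ x, Q x) = ∑ k ∈ fib (piWt wt) (piWt wt b + 1),
      piConst c d a k * piConst c k b (fun _ => v) := by
    simp only [piConst, ← Finset.prod_mul_distrib]
    refine coeff_prod_fib S.finite (fun x k => (wt (b x) : ℤ) + k)
      (fun x k l h => by simpa using h) (fun x k => c (d x) (a x) k * c k (b x) v) 1 _ ?_ ?_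
    · intro h p hp hh
      rw [mem_fib (finite_piWt S.finite), piWt, piWt]
      push_cast
      rw [Finset.sum_congr rfl fun x _ => hh x, Finset.sum_add_distrib, ← Nat.cast_sum Finset.univ p, hp]
      rfl
    · intro h hh hcon
      rw [mem_fib (finite_piWt S.finite)] at hh
      by_contra hne
      push Not at hne
      have hle : ∀ x, wt (b x) ≤ wt (h x) := by
        intro x
        by_contra hlt
        refine hne x ?_
        rw [S.creation_ne (h x) (b x) (by omega) (by rintro h'; rw [h'] at hlt; omega), mul_zero]
      obtain ⟨x, hx⟩ := hcon (fun x => wt (h x) - wt (b x)) (by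
        rw [Finset.sum_tsub_distrib _ fun x _ => hle x]
        simp only [piWt] at hh
        omega)
      have := hle x
      omega
  have hsite : ∀ x, PowerSeries.coeff 0 (R x) = c (d x) (a x) (b x) ∧
      PowerSeries.coeff 0 (Q x) = c (d x) (a x) (b x) ∧
      PowerSeries.coeff 1 (R x) - PowerSeries.coeff 1 (Q x)
        = -((wt (a x) : ℂ) + wt (b x) - wt (d x)) * c (d x) (a x) (b x) := by
    intro x
    refine ⟨?_, ?_, ?_⟩
    · rw [hR, PowerSeries.coeff_mk, Finset.sum_eq_single (d x), S.creation_self, one_mul]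
      · intro i hi hne
        rw [mem_fib S.finite] at hi
        rw [S.creation_ne (d x) i (by omega) (Ne.symm hne), zero_mul]
      · intro hn
        simp [mem_fib S.finite] at hn
    · rw [hQ, PowerSeries.coeff_mk, Finset.sum_eq_single (b x), S.creation_self, mul_one]
      · intro i hi hne
        rw [mem_fib S.finite] at hi
        rw [S.creation_ne i (b x) (by omega) hne, mul_zero]
      · intro hn
        simp [mem_fib S.finite] at hn
    · rw [hR, hQ, PowerSeries.coeff_mk, PowerSeries.coeff_mk]
      exact_mod_cast S.translation (d x) (a x) (b x)
  have hprod : ∀ s : Finset X,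
      PowerSeries.coeff 0 (∏ x ∈ s, R x) = ∏ x ∈ s, c (d x) (a x) (b x) ∧
      PowerSeries.coeff 0 (∏ x ∈ s, Q x) = ∏ x ∈ s, c (d x) (a x) (b x) ∧
      PowerSeries.coeff 1 (∏ x ∈ s, R x) - PowerSeries.coeff 1 (∏ x ∈ s, Q x)
        = -(∑ x ∈ s, ((wt (a x) : ℂ) + wt (b x) - wt (d x))) * ∏ x ∈ s, c (d x) (a x) (b x) := by
    intro s
    induction s using Finset.induction_on with
    | empty => simp [PowerSeries.coeff_one]
    | insert x s hx ih =>
      obtain ⟨h₁, h₂, h₃⟩ := hsite x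
      obtain ⟨i₁, i₂, i₃⟩ := ih
      have hone : ∀ A B : PowerSeries ℂ, PowerSeries.coeff 1 (A * B)
          = PowerSeries.coeff 0 A * PowerSeries.coeff 1 B
            + PowerSeries.coeff 1 A * PowerSeries.coeff 0 B := by
        intro A B
        rw [PowerSeries.coeff_mul, Finset.Nat.antidiagonal_succ]
        simp
      have hzero : ∀ A B : PowerSeries ℂ, PowerSeries.coeff 0 (A * B)
          = PowerSeries.coeff 0 A * PowerSeries.coeff 0 B := by
        intro A B
        simp
      simp only [Finset.prod_insert hx, Finset.sum_insert hx, hone, hzero, h₁, h₂, i₁, i₂]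
      refine ⟨trivial, trivial, ?_⟩
      linear_combination c (d x) (a x) (b x) * i₃ + (∏ x ∈ s, c (d x) (a x) (b x)) * h₃
  rw [← e₁, ← e₂, (hprod Finset.univ).2.2, piConst]
  simp only [piWt, Finset.sum_add_distrib, Finset.sum_sub_distrib]
  push_cast
  rfl

/-- The structure constants of a tensor power. -/
theorem pi : IsVertexStructure (piWt wt) (fun _ : X => v) (piConst c) where
  finite := finite_piWt S.finite
  wt_vac := by simp [piWt, S.wt_vac]
  vac_self i := by simp [piConst, S.vac_self]
  vac_ne i k h := by
    obtain ⟨x, hx⟩ := Function.ne_iff.1 h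
    exact Finset.prod_eq_zero (Finset.mem_univ x) (S.vac_ne _ _ hx)
  creation_self i := by simp [piConst, S.creation_self]
  creation_ne i j hle h := by
    -- If no site loses weight, the total weights force equality at every site, and a site where `i`
    -- and `j` differ kills the product. Otherwise a site that loses weight does.
    by_cases hall : ∀ x, wt (j x) ≤ wt (i x)
    · have heq := (Finset.sum_eq_sum_iff_of_le fun x _ => hall x).1
        (le_antisymm (Finset.sum_le_sum fun x _ => hall x) hle)
      obtain ⟨x, hx⟩ := Function.ne_iff.1 h
      exact Finset.prod_eq_zero (Finset.mem_univ x)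
        (S.creation_ne _ _ (heq x (Finset.mem_univ x)).ge hx)
    · push Not at hall
      obtain ⟨x, hx⟩ := hall
      exact Finset.prod_eq_zero (Finset.mem_univ x)
        (S.creation_ne _ _ hx.le (by intro h'; rw [h'] at hx; exact lt_irrefl _ hx))
  translation := S.piConst_translation
  locality a b := by
    obtain ⟨κ, -, -, hκ⟩ := S.exists_order
    exact ⟨_, S.piConst_locality hκ a b⟩

end IsVertexStructure

end Product

/-! ## Orbits of functions -/

section Orbit

/-- The fibres of an equivariant map from a finite group have constant size. -/
theorem sum_comp_of_equivariant {G α M : Type*} [Group G] [Fintype G] [DecidableEq α]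
    [AddCommMonoid M] {f : G → α}
    (hf : ∀ ρ σ τ, f σ = f τ → f (ρ * σ) = f (ρ * τ)) (F : α → M) :
    ∑ σ, F (f σ) = (Finset.univ.filter fun σ => f σ = f 1).card •
      ∑ a ∈ Finset.univ.image f, F a := by
  rw [Finset.sum_comp, Finset.smul_sum]
  refine Finset.sum_congr rfl fun a ha => ?_
  obtain ⟨τ, -, rfl⟩ := Finset.mem_image.1 ha
  congr 1
  refine Finset.card_bij (fun σ _ => τ⁻¹ * σ) ?_ ?_ ?_
  · intro σ hσ
    rw [Finset.mem_filter] at hσ ⊢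
    refine ⟨Finset.mem_univ _, ?_⟩
    rw [hf _ _ _ hσ.2, inv_mul_cancel]
  · intro σ _ σ' _ h
    exact mul_left_cancel h
  · intro σ hσ
    rw [Finset.mem_filter] at hσ
    refine ⟨τ * σ, ?_, by simp⟩
    rw [Finset.mem_filter]
    refine ⟨Finset.mem_univ _, ?_⟩
    rw [hf _ _ _ hσ.2, mul_one]

variable {X I : Type*}

/-- The action of permutations on functions. -/
def act (σ : Equiv.Perm X) (h : X → I) : X → I := fun i => h (σ⁻¹ i)

theorem act_one (h : X → I) : act 1 h = h := rfl

theorem act_mul (σ τ : Equiv.Perm X) (h : X → I) : act (σ * τ) h = act σ (act τ h) := by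
  ext i; simp [act]

theorem act_inv_act (σ : Equiv.Perm X) (h : X → I) : act σ⁻¹ (act σ h) = h := by
  rw [← act_mul, inv_mul_cancel, act_one]

theorem act_act_inv (σ : Equiv.Perm X) (h : X → I) : act σ (act σ⁻¹ h) = h := by
  rw [← act_mul, mul_inv_cancel, act_one]

theorem act_injective (σ : Equiv.Perm X) : Function.Injective (act σ : (X → I) → X → I) :=
  Function.LeftInverse.injective (act_inv_act σ)

theorem piWt_act [Fintype X] (wt : I → ℕ) (σ : Equiv.Perm X) (h : X → I) :
    piWt wt (act σ h) = piWt wt h :=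
  Equiv.sum_comp σ⁻¹ fun i => wt (h i)

theorem piConst_act [Fintype X] (c : I → I → I → ℂ) (σ : Equiv.Perm X) (d a b : X → I) :
    piConst c (act σ d) (act σ a) (act σ b) = piConst c d a b :=
  Equiv.prod_comp σ⁻¹ fun i => c (d i) (a i) (b i)

open Classical in
/-- The orbit of a function. -/
def orb [Finite X] (G : Subgroup (Equiv.Perm X)) (h : X → I) : Finset (X → I) :=
  letI := Fintype.ofFinite G
  Finset.univ.image fun σ : G => act (σ : Equiv.Perm X) h

variable [Finite X] {G : Subgroup (Equiv.Perm X)}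

theorem mem_orb {h h' : X → I} : h' ∈ orb G h ↔ ∃ σ ∈ G, h' = act σ h := by
  simp [orb, eq_comm]

theorem self_mem_orb (h : X → I) : h ∈ orb G h := mem_orb.2 ⟨1, G.one_mem, rfl⟩

theorem orb_card_pos (h : X → I) : 0 < (orb G h).card := Finset.card_pos.2 ⟨h, self_mem_orb h⟩

theorem orb_eq_of_mem {h h' : X → I} (hh : h' ∈ orb G h) : orb G h' = orb G h := by
  obtain ⟨σ, hσ, rfl⟩ := mem_orb.1 hh
  ext k
  rw [mem_orb, mem_orb]
  constructor
  · rintro ⟨τ, hτ, rfl⟩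
    exact ⟨τ * σ, G.mul_mem hτ hσ, (act_mul _ _ _).symm⟩
  · rintro ⟨τ, hτ, rfl⟩
    exact ⟨τ * σ⁻¹, G.mul_mem hτ (G.inv_mem hσ), by rw [act_mul, act_inv_act]⟩

theorem mem_orb_comm {h h' : X → I} : h' ∈ orb G h ↔ h ∈ orb G h' :=
  ⟨fun H => orb_eq_of_mem H ▸ self_mem_orb h, fun H => orb_eq_of_mem H ▸ self_mem_orb h'⟩

theorem act_mem_orb {h h' : X → I} {σ : Equiv.Perm X} (hσ : σ ∈ G) :
    act σ h' ∈ orb G h ↔ h' ∈ orb G h := by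
  constructor
  · intro H
    rw [← orb_eq_of_mem H]
    exact mem_orb_comm.1 (mem_orb.2 ⟨σ, hσ, rfl⟩)
  · intro H
    rw [← orb_eq_of_mem H]
    exact mem_orb.2 ⟨σ, hσ, rfl⟩

theorem orb_const (v : I) : orb G (fun _ => v) = {fun _ => v} := by
  ext h
  rw [mem_orb, Finset.mem_singleton]
  exact ⟨fun ⟨σ, _, h⟩ => h, fun h => ⟨1, G.one_mem, h⟩⟩

theorem piWt_of_mem_orb [Fintype X] {wt : I → ℕ} {h h' : X → I} (hh : h' ∈ orb G h) :
    piWt wt h' = piWt wt h := by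
  obtain ⟨σ, -, rfl⟩ := mem_orb.1 hh
  exact piWt_act wt σ h

theorem sum_orb_act (h : X → I) {σ : Equiv.Perm X} (hσ : σ ∈ G) {M : Type*} [AddCommMonoid M]
    (F : (X → I) → M) : ∑ k ∈ orb G h, F (act σ k) = ∑ k ∈ orb G h, F k := by
  refine Finset.sum_bij (fun k _ => act σ k) ?_ ?_ ?_ ?_
  · intro k hk
    exact (act_mem_orb hσ).2 hk
  · intro k _ k' _ hkk
    exact act_injective σ hkk
  · intro k hk
    exact ⟨act σ⁻¹ k, (act_mem_orb (G.inv_mem hσ)).2 hk, act_act_inv _ _⟩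
  · intro k _
    rfl

/-- Each orbit element is hit once for every element of the stabilizer, whose order is `s`. It is
chosen before `F`, so the multiplicity is the same for all summands. -/
theorem sum_act_eq [Fintype G] (h : X → I) : ∃ s : ℕ, 0 < s ∧
    ∀ {M : Type _} [AddCommMonoid M] (F : (X → I) → M),
      ∑ σ : G, F (act (σ : Equiv.Perm X) h) = s • ∑ k ∈ orb G h, F k := by
  classical
  refine ⟨(Finset.univ.filter fun σ : G => act (σ : Equiv.Perm X) h = act ((1 : G) : Equiv.Perm X) h).card,
    Finset.card_pos.2 ⟨1, by simp⟩, fun F => ?_⟩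
  rw [sum_comp_of_equivariant (f := fun σ : G => act (σ : Equiv.Perm X) h)]
  · congr 2
    ext k
    simp [mem_orb, eq_comm]
  · intro ρ σ τ hh
    rw [Subgroup.coe_mul, Subgroup.coe_mul, act_mul, act_mul, hh]

/-- The structure constants of a fixed point algebra in the basis of normalized orbit sums. -/
def orbConst [Fintype X] (c : I → I → I → ℂ) (G : Subgroup (Equiv.Perm X)) (h₁ h₂ h₃ : X → I) : ℂ :=
  (((√(orb G h₁).card * √(orb G h₂).card * √(orb G h₃).card)⁻¹ : ℝ) : ℂ) *
    ∑ k₁ ∈ orb G h₁, ∑ k₂ ∈ orb G h₂, ∑ k₃ ∈ orb G h₃, piConst c k₁ k₂ k₃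

end Orbit

/-! ## The tensor power -/

section Tensor

variable {V : Type*} [AddCommGroup V] [Module ℂ V]

/-- The modes of the tensor power as a bilinear map. -/
def tensorModeMap (A : VertexAlgebra V) {m : ℕ} (n : ℤ) :
    TensorPow V m →ₗ[ℂ] TensorPow V m →ₗ[ℂ] TensorPow V m :=
  LinearMap.mk₂ ℂ (tensorMode A n)
    (fun b b' c => by
      rw [tensorMode, tensorMode, tensorMode, ← finsum_add_distrib
        (finite_support_tensorMode A n b c) (finite_support_tensorMode A n b' c)]
      exact finsum_congr fun ν => by rw [map_add, LinearMap.add_apply])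
    (fun r b c => by
      rw [tensorMode, tensorMode, smul_finsum' r (finite_support_tensorMode A n b c)]
      exact finsum_congr fun ν => by rw [map_smul, LinearMap.smul_apply])
    (fun b c c' => by
      rw [tensorMode, tensorMode, tensorMode, ← finsum_add_distrib
        (finite_support_tensorMode A n b c) (finite_support_tensorMode A n b c')]
      exact finsum_congr fun ν => map_add _ c c')
    (fun r b c => by
      rw [tensorMode, tensorMode, smul_finsum' r (finite_support_tensorMode A n b c)]
      exact finsum_congr fun ν => map_smul _ r c)

theorem tensorModeMap_apply (A : VertexAlgebra V) {m : ℕ} (n : ℤ) (b c : TensorPow V m) :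
    tensorModeMap A n b c = tensorMode A n b c := rfl

variable {U : UnitaryVOA V} {m : ℕ}

/-- `⟨u, ·⟩` as a linear functional. -/
def tensorFunctional (U : UnitaryVOA V) (u : TensorPow V m) : TensorPow V m →ₗ[ℂ] ℂ :=
  PiTensorProduct.lift (conjMultilinear U m) u

theorem tensorFunctional_apply (u w : TensorPow V m) :
    tensorFunctional U u w = tensorForm U u w := rfl

theorem tensorForm_smul_left (r : ℂ) (u w : TensorPow V m) :
    tensorForm U (r • u) w = (starRingEnd ℂ) r * tensorForm U u w :=
  congrArg (fun φ : ConjDual (TensorPow V m) => (show TensorPow V m →ₗ[ℂ] ℂ from φ) w)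
    (map_smul (PiTensorProduct.lift (conjMultilinear U m)) r u)

theorem tensorForm_add_left (u u' w : TensorPow V m) :
    tensorForm U (u + u') w = tensorForm U u w + tensorForm U u' w :=
  congrArg (fun φ : ConjDual (TensorPow V m) => (show TensorPow V m →ₗ[ℂ] ℂ from φ) w)
    (map_add (PiTensorProduct.lift (conjMultilinear U m)) u u')

theorem tensorForm_zero_left (w : TensorPow V m) : tensorForm U 0 w = 0 := by
  simpa using tensorForm_smul_left (U := U) 0 0 w

theorem tensorForm_sum_left {α : Type*} (s : Finset α) (u : α → TensorPow V m)
    (w : TensorPow V m) : tensorForm U (∑ i ∈ s, u i) w = ∑ i ∈ s, tensorForm U (u i) w := by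
  classical
  induction s using Finset.induction_on with
  | empty => simp [tensorForm_zero_left]
  | insert a s ha ih => rw [Finset.sum_insert ha, Finset.sum_insert ha, tensorForm_add_left, ih]

theorem tensorForm_smul_right (r : ℂ) (u w : TensorPow V m) :
    tensorForm U u (r • w) = r * tensorForm U u w :=
  map_smul (tensorFunctional U u) r w

theorem tensorForm_sum_right {α : Type*} (s : Finset α) (u : TensorPow V m)
    (w : α → TensorPow V m) : tensorForm U u (∑ i ∈ s, w i) = ∑ i ∈ s, tensorForm U u (w i) :=
  map_sum (tensorFunctional U u) w s

variable {ι : Type*} (Φ : RealBasis U ι)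

/-- The tensor product of basis vectors. -/
def tensorBasis (h : Fin m → ι) : TensorPow V m := PiTensorProduct.tprod ℂ fun i => Φ.basis (h i)

open Classical in
theorem tensorForm_tensorBasis (h h' : Fin m → ι) :
    tensorForm U (tensorBasis Φ h) (tensorBasis Φ h') = if h = h' then 1 else 0 := by
  rw [tensorBasis, tensorBasis, tensorForm_tprod]
  split_ifs with H
  · subst H
    simp [Φ.orthonormal_self]
  · obtain ⟨x, hx⟩ := Function.ne_iff.1 H
    exact Finset.prod_eq_zero (Finset.mem_univ x) (Φ.orthonormal_ne _ _ hx)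

-- Homogeneity determines the mode at every site, so at most one family `ν` in the sum contributes.
-- It is admissible exactly when the total weights match.
open Classical in
theorem tensorForm_tensorMode (n : ℤ) (d a b : Fin m → ι) :
    tensorForm U (tensorBasis Φ d)
        (tensorMode U.toVertexAlgebra n (tensorBasis Φ a) (tensorBasis Φ b))
      = if (piWt Φ.wt d : ℤ) = piWt Φ.wt a + piWt Φ.wt b - n - 1 then
          piConst Φ.structConst d a b else 0 := by
  have hterm : ∀ ν : {ν : Fin m → ℤ // ∑ x, (ν x + 1) = n + 1},
      tensorFunctional U (tensorBasis Φ d) (PiTensorProduct.map₂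
        (fun x => U.mode (ν.1 x)) (tensorBasis Φ a) (tensorBasis Φ b))
      = ∏ x, if (Φ.wt (d x) : ℤ) = Φ.wt (a x) + Φ.wt (b x) - ν.1 x - 1 then
          Φ.structConst (d x) (a x) (b x) else 0 := by
    intro ν
    rw [tensorFunctional_apply, tensorBasis, tensorBasis, tensorBasis,
      PiTensorProduct.map₂_tprod_tprod, tensorForm_tprod]
    exact Finset.prod_congr rfl fun x _ => Φ.form_mode _ _ _ _
  rw [← tensorFunctional_apply, tensorMode]
  rw [show tensorFunctional U (tensorBasis Φ d) (∑ᶠ ν : {ν : Fin m → ℤ // ∑ x, (ν x + 1) = n + 1},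
      PiTensorProduct.map₂ (fun x => U.mode (ν.1 x)) (tensorBasis Φ a) (tensorBasis Φ b))
    = ∑ᶠ ν : {ν : Fin m → ℤ // ∑ x, (ν x + 1) = n + 1}, tensorFunctional U (tensorBasis Φ d)
      (PiTensorProduct.map₂ (fun x => U.mode (ν.1 x)) (tensorBasis Φ a) (tensorBasis Φ b)) from
    AddMonoidHom.map_finsum (tensorFunctional U (tensorBasis Φ d)).toAddMonoidHom
      (finite_support_tensorMode U.toVertexAlgebra n _ _)]
  rw [finsum_congr hterm]
  have hsum : ∀ ν : Fin m → ℤ, (∀ x, (Φ.wt (d x) : ℤ) = Φ.wt (a x) + Φ.wt (b x) - ν x - 1) →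
      ∑ x, (ν x + 1) = (piWt Φ.wt a + piWt Φ.wt b - piWt Φ.wt d : ℤ) := by
    intro ν hν
    simp only [piWt, Nat.cast_sum]
    rw [← Finset.sum_add_distrib, ← Finset.sum_sub_distrib]
    exact Finset.sum_congr rfl fun x _ => by have := hν x; omega
  split_ifs with h
  · set ν₀ : Fin m → ℤ := fun x => Φ.wt (a x) + Φ.wt (b x) - Φ.wt (d x) - 1 with hν₀
    have hν : ∑ x, (ν₀ x + 1) = n + 1 := by
      rw [hsum ν₀ fun x => by simp only [hν₀]; ring]
      omega
    rw [finsum_eq_single _ ⟨ν₀, hν⟩]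
    · exact Finset.prod_congr rfl fun x _ => if_pos (by simp only [hν₀]; ring)
    · intro ν hne
      by_contra hcon
      refine hne (Subtype.ext (funext fun x => ?_))
      have := Finset.prod_ne_zero_iff.1 hcon x (Finset.mem_univ x)
      rw [ne_eq, ite_eq_right_iff, Classical.not_imp] at this
      simp only [hν₀]
      omega
  · refine (finsum_congr fun ν => ?_).trans finsum_zero
    by_contra hcon
    refine h ?_
    have := hsum ν.1 fun x => by
      have := Finset.prod_ne_zero_iff.1 hcon x (Finset.mem_univ x)
      rw [ne_eq, ite_eq_right_iff, Classical.not_imp] at this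
      exact this.1
    have h2 := ν.2
    omega

/-- The restriction of a function on `ℕ` to the first `m` numbers. -/
def restr {I : Type*} (m : ℕ) (g : ℕ → I) : Fin m → I := fun i => g i

variable (G : Subgroup (Equiv.Perm (Fin m)))

theorem exists_symmetrization_eq (g : ℕ → ι) : ∃ s : ℕ, 0 < s ∧
    symmetrization Φ G g = (s : ℂ) • ∑ h ∈ orb G (restr m g), tensorBasis Φ h := by
  cases nonempty_fintype G
  obtain ⟨s, hs, h⟩ := sum_act_eq (G := G) (restr m g)
  refine ⟨s, hs, ?_⟩
  rw [symmetrization, finsum_eq_sum_of_fintype, Nat.cast_smul_eq_nsmul, ← h]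
  rfl

open Classical in
theorem tensorForm_sum_sum (s t : Finset (Fin m → ι)) :
    tensorForm U (∑ h ∈ s, tensorBasis Φ h) (∑ h ∈ t, tensorBasis Φ h) = ((s ∩ t).card : ℂ) := by
  rw [tensorForm_sum_left]
  simp only [tensorForm_sum_right, tensorForm_tensorBasis, Finset.sum_ite_eq]
  rw [← Finset.sum_filter, Finset.sum_const, Finset.filter_mem_eq_inter, nsmul_eq_mul, mul_one]

/-- The stabilizer order in the symmetrization cancels against the normalization, leaving a sum of
orthonormal vectors. -/
theorem fixedState_eq (g : ℕ → ι) : fixedState Φ G g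
    = (((√(orb G (restr m g)).card)⁻¹ : ℝ) : ℂ) • ∑ h ∈ orb G (restr m g), tensorBasis Φ h := by
  classical
  obtain ⟨s, hs, h⟩ := exists_symmetrization_eq Φ G g
  rw [fixedState, h, tensorForm_smul_left, tensorForm_smul_right, tensorForm_sum_sum,
    Finset.inter_self, smul_smul]
  congr 1
  rw [show (starRingEnd ℂ) (s : ℂ) * ((s : ℂ) * ((orb G (restr m g)).card : ℂ))
    = (((s : ℝ) ^ 2 * ((orb G (restr m g)).card : ℝ) : ℝ) : ℂ) by simp; ring, Complex.ofReal_re,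
    Real.sqrt_mul (by positivity), Real.sqrt_sq (by positivity)]
  have : (s : ℂ) ≠ 0 := by exact_mod_cast hs.ne'
  push_cast
  field_simp

theorem tensorForm_fixedState_self (g : ℕ → ι) :
    tensorForm U (fixedState Φ G g) (fixedState Φ G g) = 1 := by
  classical
  rw [fixedState_eq, tensorForm_smul_left, tensorForm_smul_right, tensorForm_sum_sum,
    Finset.inter_self, Complex.conj_ofReal]
  have h : (0 : ℝ) < (orb G (restr m g)).card := by exact_mod_cast orb_card_pos _
  rw [show (((orb G (restr m g)).card : ℕ) : ℂ) = (((orb G (restr m g)).card : ℝ) : ℂ) by simp]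
  norm_cast
  rw [← mul_assoc, ← mul_inv, Real.mul_self_sqrt h.le, inv_mul_cancel₀ h.ne']

theorem tensorForm_fixedState_of_notMem {g g' : ℕ → ι} (h : restr m g' ∉ orb G (restr m g)) :
    tensorForm U (fixedState Φ G g) (fixedState Φ G g') = 0 := by
  classical
  rw [fixedState_eq, fixedState_eq, tensorForm_smul_left, tensorForm_smul_right,
    tensorForm_sum_sum]
  have : orb G (restr m g) ∩ orb G (restr m g') = ∅ := by
    rw [← Finset.disjoint_iff_inter_eq_empty, Finset.disjoint_left]
    intro k hk hk'
    exact h (by rw [← orb_eq_of_mem hk, orb_eq_of_mem hk']; exact self_mem_orb _)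
  simp [this]

/-- From here on fixed point algebras are pure combinatorics. The mode number in `structureConstant`
is the one selected by the weights, so all triples from the orbits contribute. -/
theorem structureConstant_eq {g₁ g₂ g₃ : ℕ → ι} (h₁ : weight Φ g₁ = piWt Φ.wt (restr m g₁))
    (h₂ : weight Φ g₂ = piWt Φ.wt (restr m g₂)) (h₃ : weight Φ g₃ = piWt Φ.wt (restr m g₃)) :
    structureConstant Φ G g₁ g₂ g₃
      = orbConst Φ.structConst G (restr m g₁) (restr m g₂) (restr m g₃) := by
  classical
  rw [structureConstant, fixedState_eq, fixedState_eq, fixedState_eq, ← tensorModeMap_apply,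
    map_smul, map_smul, LinearMap.smul_apply, tensorForm_smul_left, tensorForm_smul_right,
    tensorForm_smul_right, Complex.conj_ofReal, orbConst]
  have : tensorForm U (∑ h ∈ orb G (restr m g₁), tensorBasis Φ h)
      (tensorModeMap U.toVertexAlgebra ((weight Φ g₃ : ℤ) + weight Φ g₂ - weight Φ g₁ - 1)
        (∑ h ∈ orb G (restr m g₂), tensorBasis Φ h) (∑ h ∈ orb G (restr m g₃), tensorBasis Φ h))
      = ∑ k₁ ∈ orb G (restr m g₁), ∑ k₂ ∈ orb G (restr m g₂), ∑ k₃ ∈ orb G (restr m g₃),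
        piConst Φ.structConst k₁ k₂ k₃ := by
    rw [tensorForm_sum_left]
    refine Finset.sum_congr rfl fun k₁ hk₁ => ?_
    rw [map_sum (tensorModeMap _ _), LinearMap.sum_apply, tensorForm_sum_right]
    refine Finset.sum_congr rfl fun k₂ hk₂ => ?_
    rw [map_sum, tensorForm_sum_right]
    refine Finset.sum_congr rfl fun k₃ hk₃ => ?_
    rw [tensorModeMap_apply, tensorForm_tensorMode, piWt_of_mem_orb hk₁, piWt_of_mem_orb hk₂,
      piWt_of_mem_orb hk₃, h₁, h₂, h₃, if_pos (by ring)]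
  rw [this]
  push_cast
  rw [mul_inv, mul_inv]
  ring

/-! ### The fixed point subspace -/

theorem reindex_tensorBasis (σ : Equiv.Perm (Fin m)) (h : Fin m → ι) :
    PiTensorProduct.reindex ℂ (fun _ : Fin m => V) σ (tensorBasis Φ h)
      = tensorBasis Φ (act σ h) := by
  rw [tensorBasis, tensorBasis]
  exact PiTensorProduct.reindex_tprod σ _

theorem tensorBasis_mem_tensorWeightSpace (h : Fin m → ι) :
    tensorBasis Φ h ∈ tensorWeightSpace U.toVertexOperatorAlgebra m (piWt Φ.wt h) :=
  Submodule.subset_span ⟨fun x => Φ.wt (h x), fun x => Φ.basis (h x), by simp [piWt],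
    fun x => Φ.homogeneous _, rfl⟩

theorem tensorWeightSpace_le (n : ℕ) : tensorWeightSpace U.toVertexOperatorAlgebra m n
    ≤ Submodule.span ℂ (tensorBasis Φ '' {h : Fin m → ι | piWt Φ.wt h = n}) := by
  classical
  rw [tensorWeightSpace, Submodule.span_le]
  rintro _ ⟨k, w, hk, hw, rfl⟩
  have hexp : w = fun x => ∑ i ∈ fib Φ.wt (k x), Φ.basis.repr (w x) i • Φ.basis i := by
    ext1 x
    conv_lhs => rw [← Φ.basis.linearCombination_repr (w x), Finsupp.linearCombination_apply]
    refine Finset.sum_subset (fun i hi => ?_) fun i _ hi => ?_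
    · rw [mem_fib Φ.finite_wt]
      by_contra hne
      exact (Finsupp.mem_support_iff.1 hi) (Φ.repr_eq_zero_of_mem_weightSpace (hw x) hne)
    · simp only [Finsupp.notMem_support_iff.1 hi, zero_smul]
  rw [hexp, MultilinearMap.map_sum_finset]
  refine Submodule.sum_mem _ fun h hh => ?_
  rw [MultilinearMap.map_smul_univ]
  refine Submodule.smul_mem _ _ (Submodule.subset_span ⟨h, ?_, rfl⟩)
  change piWt Φ.wt h = n
  have : ((piWt Φ.wt h : ℕ) : ℤ) = n := by
    rw [← hk, piWt, Nat.cast_sum]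
    exact Finset.sum_congr rfl fun x _ => (mem_fib Φ.finite_wt).1 (Fintype.mem_piFinset.1 hh x)
  exact_mod_cast this

theorem fixedState_mem (g : ℕ → ι) : fixedState Φ G g ∈ fixedPointSpace V G ⊓
    tensorWeightSpace U.toVertexOperatorAlgebra m (piWt Φ.wt (restr m g)) := by
  rw [fixedState_eq]
  refine Submodule.smul_mem _ _ ⟨fun σ hσ => ?_, Submodule.sum_mem _ fun h hh => ?_⟩
  · rw [map_sum]
    simp only [reindex_tensorBasis]
    exact sum_orb_act _ hσ _
  · rw [← piWt_of_mem_orb hh]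
    exact tensorBasis_mem_tensorWeightSpace Φ h

/-- Averaging over the group: `P` multiplies an invariant vector by the group order and sends a
basis tensor to a multiple of its orbit sum. -/
theorem inf_le_span_fixedState (n : ℕ) {s : Set (ℕ → ι)}
    (hs : ∀ h : Fin m → ι, piWt Φ.wt h = n → ∃ g ∈ s, h ∈ orb G (restr m g)) :
    fixedPointSpace V G ⊓ tensorWeightSpace U.toVertexOperatorAlgebra m n
      ≤ Submodule.span ℂ (fixedState Φ G '' s) := by
  cases nonempty_fintype G
  rintro u ⟨hfix, hu⟩
  let P : TensorPow V m →ₗ[ℂ] TensorPow V m := ∑ σ : G,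
    (PiTensorProduct.reindex ℂ (fun _ : Fin m => V) (σ : Equiv.Perm (Fin m))).toLinearMap
  have hP : P u = (Fintype.card G : ℂ) • u := by
    simp only [P, LinearMap.sum_apply, LinearEquiv.coe_coe]
    rw [Finset.sum_congr rfl fun (σ : G) _ => hfix σ.1 σ.2, Finset.sum_const, Nat.cast_smul_eq_nsmul,
      Finset.card_univ]
  have hcard : (Fintype.card G : ℂ) ≠ 0 := by exact_mod_cast Fintype.card_ne_zero
  have hmem : P u ∈ Submodule.span ℂ (fixedState Φ G '' s) := by
    have h1 := Submodule.mem_map_of_mem (f := P) (tensorWeightSpace_le Φ n hu)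
    rw [Submodule.map_span] at h1
    refine Submodule.span_le.2 ?_ h1
    rintro _ ⟨_, ⟨h, hh, rfl⟩, rfl⟩
    obtain ⟨g, hg, hgh⟩ := hs h hh
    obtain ⟨t, -, ht⟩ := sum_act_eq (G := G) h
    have : P (tensorBasis Φ h) = ((t : ℂ) * ((√(orb G (restr m g)).card : ℝ) : ℂ)) • fixedState Φ G g := by
      have hpos : ((√(orb G (restr m g)).card : ℝ) : ℂ) ≠ 0 := by
        rw [Complex.ofReal_ne_zero, Real.sqrt_ne_zero']
        exact_mod_cast orb_card_pos _
      rw [fixedState_eq, smul_smul, mul_assoc, Complex.ofReal_inv, mul_inv_cancel₀ hpos, mul_one,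
        Nat.cast_smul_eq_nsmul, ← orb_eq_of_mem hgh, ← ht]
      simp only [P, LinearMap.sum_apply, LinearEquiv.coe_coe, reindex_tensorBasis]
    rw [this]
    exact Submodule.smul_mem _ _ (Submodule.subset_span ⟨g, hg, rfl⟩)
  rw [hP] at hmem
  exact (Submodule.smul_mem_iff _ hcard).1 hmem

end Tensor

/-! ## Systems of representatives -/

theorem perm_apply_inv {X : Type*} (σ : Equiv.Perm X) (i : X) : σ (σ⁻¹ i) = i := by simp

theorem perm_inv_apply {X : Type*} (σ : Equiv.Perm X) (i : X) : σ⁻¹ (σ i) = i := by simp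

section Representatives

variable {V : Type*} [AddCommGroup V] [Module ℂ V] {U : UnitaryVOA V} {ι : Type*}
  (Φ : RealBasis U ι)

/-- The function `g` is supported in the first `m` numbers. -/
def SuppIn (m : ℕ) (g : ℕ → ι) : Prop := ∀ j, m ≤ j → g j = Φ.vacIdx

variable {Φ}

theorem SuppIn.mono {m m' : ℕ} {g : ℕ → ι} (h : SuppIn Φ m g) (hm : m ≤ m') : SuppIn Φ m' g :=
  fun j hj => h j (hm.trans hj)

theorem SuppIn.eq_of_restr_eq {m : ℕ} {g g' : ℕ → ι} (h : SuppIn Φ m g) (h' : SuppIn Φ m g')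
    (he : restr m g = restr m g') : g = g' := by
  ext j
  by_cases hj : j < m
  · exact congrFun he ⟨j, hj⟩
  · rw [h j (not_lt.1 hj), h' j (not_lt.1 hj)]

theorem suppIn_iff {m : ℕ} {g : ℕ → ι} : SuppIn Φ m g ↔ ∀ j ∈ supp Φ g, j < m := by
  constructor
  · intro h j hj
    by_contra hlt
    exact hj (h j (not_lt.1 hlt))
  · intro h j hj
    by_contra hne
    exact absurd (h j hne) (not_lt.2 hj)

theorem weight_eq (hU : U.IsCFTType) {m : ℕ} {g : ℕ → ι} (h : SuppIn Φ m g) :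
    weight Φ g = piWt Φ.wt (restr m g) := by
  rw [weight, finsum_eq_sum_of_support_subset (s := Finset.range m), piWt, Finset.sum_range]
  · rfl
  · intro j hj
    rw [Finset.mem_coe, Finset.mem_range]
    by_contra hlt
    exact hj ((congrArg Φ.wt (h j (not_lt.1 hlt))).trans (Φ.wt_vacIdx hU))

variable (Φ) in
/-- Extension of a function by the vacuum. -/
def extend {m : ℕ} (h : Fin m → ι) : ℕ → ι := fun j => if hj : j < m then h ⟨j, hj⟩ else Φ.vacIdx

theorem suppIn_extend {m : ℕ} (h : Fin m → ι) : SuppIn Φ m (extend Φ h) :=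
  fun _ hj => dif_neg (not_lt.2 hj)

theorem restr_extend {m : ℕ} (h : Fin m → ι) : restr m (extend Φ h) = h := by
  ext i
  simp [restr, extend]

theorem finite_suppIn (hU : U.IsCFTType) (m n : ℕ) :
    {g : ℕ → ι | SuppIn Φ m g ∧ weight Φ g = n}.Finite := by
  refine Set.Finite.of_finite_image (f := restr m) ((finite_piWt Φ.finite_wt n).subset ?_) ?_
  · rintro _ ⟨g, ⟨hg, hn⟩, rfl⟩
    rw [weight_eq hU hg] at hn
    exact hn
  · rintro g ⟨hg, -⟩ g' ⟨hg', -⟩ he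
    exact hg.eq_of_restr_eq hg' he

variable {x : ℕ → ℕ} {G : ∀ N, Subgroup (Equiv.Perm (Fin (x N)))}

theorem NestedOligomorphic.monotone (hG : NestedOligomorphic Φ x G) : Monotone x :=
  (strictMono_nat_of_lt_succ hG.size_lt).monotone

/-- Functions in the same orbit are in the same orbit for all smaller `N`. -/
theorem NestedOligomorphic.mem_orb_of_le (hG : NestedOligomorphic Φ x G) {g g' : ℕ → ι} {N M : ℕ}
    (hNM : N ≤ M) (h : SuppIn Φ (x N) g) (h' : SuppIn Φ (x N) g')
    (hM : restr (x M) g ∈ orb (G M) (restr (x M) g')) :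
    restr (x N) g ∈ orb (G N) (restr (x N) g') := by
  induction M, hNM using Nat.le_induction with
  | base => exact hM
  | succ M hNM ih =>
    refine ih ?_
    have h := h.mono (hG.monotone hNM)
    have h' := h'.mono (hG.monotone hNM)
    obtain ⟨σ, hσ, he⟩ := mem_orb.1 hM
    obtain ⟨τ, hτ, hτσ⟩ := hG.nested M σ hσ
    refine mem_orb.2 ⟨τ, hτ, ?_⟩
    have hval : ∀ i : Fin (x (M + 1)), g (σ i) = g' i := by
      intro i
      have := congrFun he (σ i)
      simpa [restr, act] using this
    have key : ∀ j : Fin (x M), g (τ j) = g' j := by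
      intro j
      have hj := hval (Fin.castLE (hG.size_lt M).le j)
      rw [Fin.val_castLE] at hj
      by_cases hlt : ((σ (Fin.castLE (hG.size_lt M).le j) : Fin (x (M + 1))) : ℕ) < x M
      · rw [← hτσ j hlt, hj]
      -- Here `σ` moves `j` out of `X_M`, so `g' j` is the vacuum. If `g (τ j)` were not, then `σ⁻¹
      -- (τ j)` would lie in the support of `g'`, hence in `X_M`, where `τ` agrees with `σ`.
      -- Injectivity of `τ` would give `j = σ⁻¹ (τ j)`, a contradiction.
      · rw [h _ (not_lt.1 hlt)] at hj
        rw [← hj]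
        by_contra hne
        set i : Fin (x (M + 1)) := Fin.castLE (hG.size_lt M).le (τ j) with hi
        have hg' := hval (σ⁻¹ i)
        rw [perm_apply_inv, hi, Fin.val_castLE] at hg'
        have hlt' : ((σ⁻¹ i : Fin (x (M + 1))) : ℕ) < x M := by
          by_contra hge
          exact hne (hg'.trans (h' _ (not_lt.1 hge)))
        have h1 := hτσ ⟨(σ⁻¹ i : Fin (x (M + 1))), hlt'⟩
        have h2 : Fin.castLE (hG.size_lt M).le ⟨(σ⁻¹ i : Fin (x (M + 1))), hlt'⟩ = σ⁻¹ i := rfl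
        rw [h2, perm_apply_inv] at h1
        have h3 := h1 (τ j).2
        have h4 : τ j = τ ⟨(σ⁻¹ i : Fin (x (M + 1))), hlt'⟩ := Fin.ext h3
        have h5 := τ.injective h4
        rw [← congrArg Fin.val h5] at hg'
        exact hne (hg'.trans hj.symm)
    ext i
    have := key (τ⁻¹ i)
    rw [perm_apply_inv] at this
    exact this

open Classical in
theorem orbitCount_eq {m : ℕ} (H : Subgroup (Equiv.Perm (Fin m))) (n : ℕ) :
    orbitCount Φ H n = ((fib (piWt Φ.wt) n).image (orb H)).card := by
  rw [orbitCount, ← Set.ncard_coe_finset, ← Set.ncard_image_of_injective _ Finset.coe_injective]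
  congr 1
  ext O
  simp only [Set.mem_ofPred_eq, Finset.coe_image, Set.mem_image, Finset.mem_coe,
    mem_fib (finite_piWt Φ.finite_wt), exists_exists_and_eq_and]
  refine exists_congr fun h => and_congr (by rw [piWt]; norm_cast) ?_
  have : ((orb H h : Finset (Fin m → ι)) : Set (Fin m → ι))
      = {h' | ∃ σ ∈ H, h' = fun i => h (σ⁻¹ i)} := by
    ext h'
    rw [Finset.mem_coe, mem_orb]
    rfl
  rw [this, eq_comm]

theorem IsRepresentativeSystem.exists_stable {B : Set (ℕ → ι)}
    (hB : IsRepresentativeSystem Φ x G B) (n : ℕ) : ∃ N₀ : ℕ,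
      (∀ g ∈ B, weight Φ g = n → SuppIn Φ (x N₀) g) ∧ ∀ N ≥ N₀, ∀ h : Fin (x N) → ι,
        piWt Φ.wt h = n → ∃! g : ℕ → ι, g ∈ B ∧ weight Φ g = n ∧ h ∈ orb (G N) (restr (x N) g) := by
  obtain ⟨N₀, h₁, h₂⟩ := hB.stable n
  refine ⟨N₀, fun g hg hn => suppIn_iff.2 (h₁ g hg hn), fun N hN h hh => ?_⟩
  have := h₂ N hN h hh
  simp only [mem_orb]
  convert this using 7
  exact funext_iff

/-- Representatives are chosen where the orbit count of weight `n` has become constant and are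
extended by the vacuum. Nestedness keeps them inequivalent for larger `N`, and the constant count
then leaves no orbit unrepresented. -/
theorem NestedOligomorphic.exists_representatives (hU : U.IsCFTType)
    (hG : NestedOligomorphic Φ x G) : ∃ B, IsRepresentativeSystem Φ x G B := by
  classical
  choose b hb using hG.orbitCount_converges
  choose N₀ hN₀ using fun n => eventually_atTop.1 (hb n)
  let Orb : ∀ n N : ℕ, Finset (Finset (Fin (x N) → ι)) := fun n N =>
    (fib (piWt Φ.wt) (n : ℤ)).image (orb (G N))
  have hOrb : ∀ n N O, O ∈ Orb n N ↔ ∃ h : Fin (x N) → ι, piWt Φ.wt h = n ∧ orb (G N) h = O := by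
    intro n N O
    simp [Orb, mem_fib (finite_piWt Φ.finite_wt)]
  have hrep : ∀ n (O : {O // O ∈ Orb n (N₀ n)}), ∃ h : Fin (x (N₀ n)) → ι,
      piWt Φ.wt h = n ∧ orb (G (N₀ n)) h = O := fun n O => (hOrb _ _ _).1 O.2
  choose rep hwt hrep using hrep
  have hw : ∀ n O, weight Φ (extend Φ (rep n O)) = n := fun n O => by
    rw [weight_eq hU (suppIn_extend _), restr_extend, hwt]
  have hsupp : ∀ n O, SuppIn Φ (x (N₀ n)) (extend Φ (rep n O)) := fun n O => suppIn_extend _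
  refine ⟨{g | ∃ n, ∃ O : {O // O ∈ Orb n (N₀ n)}, g = extend Φ (rep n O)}, ?_, ?_⟩
  · rintro _ ⟨n, O, rfl⟩
    exact (Set.finite_lt_nat (x (N₀ n))).subset fun j hj => suppIn_iff.1 (hsupp n O) j hj
  · intro n
    refine ⟨N₀ n, ?_, ?_⟩
    · rintro _ ⟨n', O, rfl⟩ hn
      rw [hw] at hn
      subst hn
      exact suppIn_iff.1 (hsupp _ O)
    · intro N hN h hh
      let F : {O // O ∈ Orb n (N₀ n)} → {O // O ∈ Orb n N} := fun O =>
        ⟨orb (G N) (restr (x N) (extend Φ (rep n O))), (hOrb _ _ _).2 ⟨_, by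
          rw [← weight_eq hU ((hsupp n O).mono (hG.monotone hN)), hw], rfl⟩⟩
      have hinj : Function.Injective F := by
        intro O O' he
        have h1 : restr (x N) (extend Φ (rep n O)) ∈ orb (G N) (restr (x N) (extend Φ (rep n O'))) := by
          have he' : orb (G N) (restr (x N) (extend Φ (rep n O)))
            = orb (G N) (restr (x N) (extend Φ (rep n O'))) := congrArg Subtype.val he
          rw [← he']
          exact self_mem_orb _
        have h2 := hG.mem_orb_of_le hN (hsupp n O) (hsupp n O') h1
        rw [restr_extend, restr_extend] at h2
        have h3 := orb_eq_of_mem h2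
        rw [hrep, hrep] at h3
        exact Subtype.ext h3
      have hcard : Fintype.card {O // O ∈ Orb n (N₀ n)} = Fintype.card {O // O ∈ Orb n N} := by
        rw [Fintype.card_coe, Fintype.card_coe, ← orbitCount_eq, ← orbitCount_eq, hN₀ n N hN,
          hN₀ n (N₀ n) le_rfl]
      have hbij := (Fintype.bijective_iff_injective_and_card F).2 ⟨hinj, hcard⟩
      obtain ⟨O, hO⟩ := hbij.2 ⟨orb (G N) h, (hOrb _ _ _).2 ⟨h, hh, rfl⟩⟩
      have hO' : orb (G N) (restr (x N) (extend Φ (rep n O))) = orb (G N) h := congrArg Subtype.val hO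
      refine ⟨extend Φ (rep n O), ⟨⟨n, O, rfl⟩, hw n O, ?_⟩, ?_⟩
      · have : h ∈ orb (G N) (restr (x N) (extend Φ (rep n O))) := by
          rw [hO']; exact self_mem_orb h
        obtain ⟨σ, hσ, he⟩ := mem_orb.1 this
        exact ⟨σ, hσ, fun i => congrFun he i⟩
      · rintro _ ⟨⟨n', O', rfl⟩, hn', σ, hσ, he⟩
        rw [hw] at hn'
        subst hn'
        have : h ∈ orb (G N) (restr (x N) (extend Φ (rep n' O'))) :=
          mem_orb.2 ⟨σ, hσ, funext he⟩
        have h1 := orb_eq_of_mem this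
        have : F O' = F O := Subtype.ext (h1.symm.trans hO'.symm)
        rw [hinj this]

/-- Orbits of finite subsets have representatives independent of `N`. -/
theorem IsRepresentativeSystem.exists_subset_representatives (hU : U.IsCFTType)
    {B : Set (ℕ → ι)} (hG : NestedOligomorphic Φ x G) (hB : IsRepresentativeSystem Φ x G B)
    {i₀ : ι} (hi₀ : i₀ ≠ Φ.vacIdx) (n : ℕ) :
    ∃ (𝒰 : Finset (Finset ℕ)) (N₀ : ℕ), (∀ A ∈ 𝒰, ∀ j ∈ A, j < x N₀) ∧
      ∀ N ≥ N₀, ∀ S : Finset (Fin (x N)), S.card ≤ n →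
        ∃! A, A ∈ 𝒰 ∧ ∃ σ ∈ G N, S = (finPart (x N) A).image σ := by
  classical
  choose N₁ hN₁ hN₁' using hB.exists_stable
  set w := Φ.wt i₀ with hw
  have hwpos : 0 < w := Nat.pos_of_ne_zero fun h => hi₀ ((Φ.wt_eq_zero_iff hU).1 h)
  -- A set of `k` points is encoded by the function with value `i₀` on it and the vacuum elsewhere,
  -- of weight `k * w`. Stability is needed only for the finitely many `k ≤ n`.
  set N₀ := (Finset.range (n + 1)).sup fun k => N₁ (k * w) with hN₀
  have hle : ∀ k ≤ n, N₁ (k * w) ≤ N₀ := fun k hk =>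
    Finset.le_sup (f := fun k => N₁ (k * w)) (Finset.mem_range.2 (by omega))
  let ind : Finset ℕ → ℕ → ι := fun A j => if j ∈ A then i₀ else Φ.vacIdx
  have ind_inj : Function.Injective ind := by
    intro A A' h
    ext j
    have := congrFun h j
    simp only [ind] at this
    by_cases h1 : j ∈ A <;> by_cases h2 : j ∈ A' <;> simp_all [Ne.symm hi₀]
  let 𝒰 := (Finset.range (x N₀)).powerset.filter fun A => A.card ≤ n ∧ ind A ∈ B
  have ind_supp : ∀ A m, (∀ j ∈ A, j < m) → SuppIn Φ m (ind A) := fun A m hA j hj =>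
    if_neg fun h => absurd (hA j h) (not_lt.2 hj)
  have ind_wt : ∀ (m : ℕ) (A : Finset ℕ), (∀ j ∈ A, j < m) →
      weight Φ (ind A) = A.card * w := by
    intro m A hA
    rw [weight, finsum_eq_sum_of_support_subset (s := A)]
    · rw [Finset.sum_congr rfl fun j hj => congrArg Φ.wt (if_pos hj), Finset.sum_const, smul_eq_mul]
    · intro j hj
      by_contra hn
      exact hj ((congrArg Φ.wt (if_neg hn)).trans (Φ.wt_vacIdx hU))
  refine ⟨𝒰, N₀, ?_, ?_⟩
  · intro A hA j hj
    exact Finset.mem_range.1 (Finset.mem_powerset.1 (Finset.mem_filter.1 hA).1 hj)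
  · intro N hN S hS
    have hk := hle _ hS
    set h : Fin (x N) → ι := fun i => if i ∈ S then i₀ else Φ.vacIdx with hh
    have hwt : piWt Φ.wt h = S.card * w := by
      rw [piWt, ← Finset.sum_subset (Finset.subset_univ S)]
      · rw [Finset.sum_congr rfl fun j hj => congrArg Φ.wt (if_pos hj), Finset.sum_const,
          smul_eq_mul]
      · intro j _ hj
        exact (congrArg Φ.wt (if_neg hj)).trans (Φ.wt_vacIdx hU)
    obtain ⟨g, ⟨hgB, hgw, hg⟩, huniq⟩ := hN₁' _ N (hk.trans hN) h hwt
    have hmem : ∀ A : Finset ℕ, (∃ σ ∈ G N, S = (finPart (x N) A).image σ) ↔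
        h ∈ orb (G N) (restr (x N) (ind A)) := by
      intro A
      rw [mem_orb]
      refine exists_congr fun σ => and_congr_right fun _ => ?_
      have h1 : ∀ i, i ∈ (finPart (x N) A).image σ ↔ ((σ⁻¹ i : Fin (x N)) : ℕ) ∈ A := by
        intro i
        rw [Finset.mem_image]
        constructor
        · rintro ⟨j, hj, rfl⟩
          simpa [finPart] using hj
        · intro hi
          exact ⟨σ⁻¹ i, by simpa [finPart] using hi, by simp⟩
      constructor
      · intro hS'
        ext i
        simp only [hh, act, restr, ind]
        rw [if_congr (by rw [hS', h1]) rfl rfl]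
      · intro he
        ext i
        have := congrFun he i
        simp only [hh, act, restr, ind] at this
        rw [h1]
        by_cases a1 : i ∈ S <;> by_cases a2 : ((σ⁻¹ i : Fin (x N)) : ℕ) ∈ A <;>
          simp_all [Ne.symm hi₀]
    have hgs := (hN₁ _ g hgB hgw).mono (hG.monotone hk)
    set A : Finset ℕ := (Finset.range (x N₀)).filter fun j => g j = i₀ with hA
    have hAlt : ∀ j ∈ A, j < x N₀ := fun j hj => Finset.mem_range.1 (Finset.mem_filter.1 hj).1
    -- Up to a permutation `g` is the encoding of `S`, so it has no values besides `i₀` and the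
    -- vacuum, and it encodes a set itself.
    have hgA : g = ind A := by
      ext j
      by_cases hj : j < x N₀
      · have hj' : j < x N := hj.trans_le (hG.monotone hN)
        obtain ⟨σ, hσ, he⟩ := mem_orb.1 hg
        have h2 := congrFun he (σ ⟨j, hj'⟩)
        simp only [hh, act, restr, perm_inv_apply] at h2
        simp only [ind, hA, Finset.mem_filter, Finset.mem_range, hj, true_and]
        by_cases h4 : g j = i₀
        · rw [if_pos h4, h4]
        · rw [if_neg h4]
          split_ifs at h2 with h3
          · exact absurd h2.symm h4
          · exact h2.symm
      · rw [hgs j (not_lt.1 hj)]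
        exact (if_neg fun h => hj (hAlt j h)).symm
    have hAcard : A.card = S.card := by
      have := ind_wt _ A hAlt
      rw [← hgA, hgw] at this
      exact (Nat.eq_of_mul_eq_mul_right hwpos this).symm
    refine ⟨A, ⟨?_, (hmem A).2 (hgA ▸ hg)⟩, ?_⟩
    · exact Finset.mem_filter.2 ⟨Finset.mem_powerset.2 (Finset.filter_subset _ _),
        by omega, hgA ▸ hgB⟩
    · rintro A' ⟨hA', hex⟩
      obtain ⟨hA'1, -, hA'2⟩ := Finset.mem_filter.1 hA'
      have hlt : ∀ j ∈ A', j < x N₀ := fun j hj =>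
        Finset.mem_range.1 (Finset.mem_powerset.1 hA'1 hj)
      have hcard : A'.card = S.card := by
        obtain ⟨σ, -, rfl⟩ := hex
        rw [Finset.card_image_of_injective _ σ.injective]
        refine (Finset.card_bij (fun (i : Fin (x N)) _ => (i : ℕ)) ?_ ?_ ?_).symm
        · intro i hi
          simpa [finPart] using hi
        · intro i _ j _ hij
          exact Fin.ext hij
        · intro j hj
          exact ⟨⟨j, (hlt j hj).trans_le (hG.monotone hN)⟩, by simpa [finPart] using hj, rfl⟩
      refine ind_inj (((huniq _ ⟨hA'2, ?_, (hmem A').1 hex⟩).trans hgA))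
      rw [ind_wt _ A' hlt, hcard]

end Representatives

/-! ## Stabilizers and orbit sizes -/

section Counting

variable {m : ℕ} (G : Subgroup (Equiv.Perm (Fin m)))

theorem mem_finPart {K : Finset ℕ} {i : Fin m} : i ∈ finPart m K ↔ (i : ℕ) ∈ K := by
  simp [finPart]

theorem mem_pointwiseStabilizer {K : Finset (Fin m)} {σ : G} :
    σ ∈ pointwiseStabilizer G K ↔ ∀ i ∈ K, (σ : Equiv.Perm (Fin m)) i = i :=
  mem_fixingSubgroup_iff G

theorem exists_induced {K : Finset ℕ} (hK : ∀ j ∈ K, j < m) {σ : Equiv.Perm (Fin m)}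
    (h : ∀ i : Fin m, (i : ℕ) ∈ K → (σ i : ℕ) ∈ K) :
    ∃ π : Equiv.Perm K, ∀ (i : Fin m) (hi : (i : ℕ) ∈ K), (σ i : ℕ) = (π ⟨i, hi⟩ : ℕ) := by
  let f : K → K := fun k => ⟨σ ⟨k, hK k k.2⟩, h _ k.2⟩
  have hf : Function.Injective f := by
    intro k l hkl
    have h1 : ((σ ⟨k, hK k k.2⟩ : Fin m) : ℕ) = σ ⟨l, hK l l.2⟩ := congrArg Subtype.val hkl
    have h2 := σ.injective (Fin.ext h1)
    exact Subtype.ext (congrArg Fin.val h2)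
  exact ⟨Equiv.ofBijective f (Finite.injective_iff_bijective.1 hf), fun i hi => rfl⟩

/-- Elements of a permutation group which preserve a finite set and act on it in a prescribed
way are counted by the pointwise stabilizer and the induced group. -/
theorem card_restricted {K : Finset ℕ} (hK : ∀ j ∈ K, j < m) (Q : Set (Equiv.Perm K)) :
    Nat.card {σ : G // ∃ π ∈ Q, ∀ (i : Fin m) (hi : (i : ℕ) ∈ K),
      (((σ : Equiv.Perm (Fin m)) i : Fin m) : ℕ) = (π ⟨i, hi⟩ : ℕ)}
      = (inducedGroup G K ∩ Q).ncard * Nat.card (pointwiseStabilizer G (finPart m K)) := by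
  have hch : ∀ π : (inducedGroup G K ∩ Q : Set (Equiv.Perm K)), ∃ σ : G,
      ∀ (i : Fin m) (hi : (i : ℕ) ∈ K),
        (((σ : Equiv.Perm (Fin m)) i : Fin m) : ℕ) = (π.1 ⟨i, hi⟩ : ℕ) := by
    rintro ⟨π, ⟨σ, hσ, h⟩, -⟩
    exact ⟨⟨σ, hσ⟩, h⟩
  choose s hs using hch
  have hfix : ∀ (ρ : pointwiseStabilizer G (finPart m K)) (i : Fin m), (i : ℕ) ∈ K →
      ((ρ : G) : Equiv.Perm (Fin m)) i = i := fun ρ i hi =>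
    (mem_pointwiseStabilizer G).1 ρ.2 i (mem_finPart.2 hi)
  rw [← Nat.card_coe_set_eq, ← Nat.card_prod]
  symm
  -- With one lift `s π` fixed for each induced permutation, every counted element is uniquely a
  -- lift times an element of the pointwise stabilizer.
  refine Nat.card_eq_of_bijective (fun p => ⟨s p.1 * p.2, p.1.1, p.1.2.2, fun i hi => ?_⟩)
    ⟨?_, ?_⟩
  · rw [Subgroup.coe_mul, Equiv.Perm.mul_apply, hfix p.2 i hi, hs]
  · rintro ⟨π, ρ⟩ ⟨π', ρ'⟩ he
    have he' : s π * (ρ : G) = s π' * (ρ' : G) := congrArg Subtype.val he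
    have hπ : π = π' := by
      refine Subtype.ext (Equiv.ext fun k => Subtype.ext ?_)
      have hk := hK k k.2
      have h1 := congrArg (fun σ : G => (((σ : Equiv.Perm (Fin m)) ⟨k, hk⟩ : Fin m) : ℕ)) he'
      simp only [Subgroup.coe_mul, Equiv.Perm.mul_apply] at h1
      rw [hfix ρ ⟨k, hk⟩ k.2, hfix ρ' ⟨k, hk⟩ k.2, hs _ ⟨k, hk⟩ k.2, hs _ ⟨k, hk⟩ k.2] at h1
      exact h1
    subst hπ
    exact Prod.ext rfl (Subtype.ext (mul_left_cancel he'))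
  · rintro ⟨σ, π, hπ, hσ⟩
    let π' : (inducedGroup G K ∩ Q : Set (Equiv.Perm K)) := ⟨π, ⟨σ, σ.2, hσ⟩, hπ⟩
    refine ⟨⟨π', ⟨(s π')⁻¹ * σ, (mem_pointwiseStabilizer G).2 fun i hi => ?_⟩⟩, ?_⟩
    · have hi' := mem_finPart.1 hi
      rw [Subgroup.coe_mul, Equiv.Perm.mul_apply, Subgroup.coe_inv, Equiv.Perm.inv_eq_iff_eq]
      exact Fin.ext ((hσ i hi').trans (hs π' i hi').symm)
    · refine Subtype.ext ?_
      simp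

variable {I : Type*}

/-- Orbit-stabilizer theorem for functions. -/
theorem card_orb_mul {v : I} {K : Finset ℕ} (hK : ∀ j ∈ K, j < m) {g : ℕ → I}
    (hg : ∀ j, j ∈ K ↔ g j ≠ v) : (orb G (restr m g)).card *
      ((inducedGroup G K ∩ {π | ∀ i, g (π i : ℕ) = g (i : ℕ)}).ncard *
        Nat.card (pointwiseStabilizer G (finPart m K))) = Nat.card G := by
  classical
  cases nonempty_fintype G
  have h := sum_comp_of_equivariant (f := fun σ : G => act (σ : Equiv.Perm (Fin m)) (restr m g))
    (fun ρ σ τ hh => by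
      rw [Subgroup.coe_mul, Subgroup.coe_mul, act_mul, act_mul, hh]) (fun _ => 1)
  have horb : Finset.univ.image (fun σ : G => act (σ : Equiv.Perm (Fin m)) (restr m g))
      = orb G (restr m g) := by
    ext k
    simp [mem_orb, eq_comm]
  rw [Finset.sum_const, Finset.sum_const, horb, smul_eq_mul, smul_eq_mul, smul_eq_mul, mul_one,
    mul_one, Finset.card_univ] at h
  rw [← card_restricted G hK, Nat.card_eq_fintype_card (α := G), h, mul_comm,
    Nat.card_eq_fintype_card, Fintype.card_subtype]
  congr 2
  ext σ
  rw [Finset.mem_filter, Finset.mem_filter]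
  simp only [Finset.mem_univ, true_and, Subgroup.coe_one, act_one]
  have hact : act (σ : Equiv.Perm (Fin m)) (restr m g) = restr m g ↔
      ∀ i : Fin m, g ((σ : Equiv.Perm (Fin m)) i : Fin m) = g i := by
    constructor
    · intro h i
      have := congrFun h ((σ : Equiv.Perm (Fin m)) i)
      simp only [act, restr, perm_inv_apply] at this
      exact this.symm
    · intro h
      ext i
      have := h ((σ : Equiv.Perm (Fin m))⁻¹ i)
      rw [perm_apply_inv] at this
      exact this.symm
  rw [hact]
  constructor
  · rintro ⟨π, hπ, hσ⟩ i
    by_cases hi : (i : ℕ) ∈ K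
    · rw [hσ i hi]
      exact hπ ⟨i, hi⟩
    -- A point of `K` is already the image of a point of `K`, as `π` is onto.
    · have hσi : (((σ : Equiv.Perm (Fin m)) i : Fin m) : ℕ) ∉ K := by
        intro hmem
        set k := π⁻¹ ⟨_, hmem⟩ with hk
        have h1 := hσ ⟨k, hK k k.2⟩ k.2
        have h2 : π ⟨k, k.2⟩ = ⟨_, hmem⟩ := perm_apply_inv π _
        rw [h2] at h1
        have h3 := (σ : Equiv.Perm (Fin m)).injective (Fin.ext h1)
        exact hi (h3 ▸ k.2)
      rw [hg, not_not] at hi hσi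
      rw [hi, hσi]
  · intro hσ
    obtain ⟨π, hπ⟩ := exists_induced (σ := (σ : Equiv.Perm (Fin m))) hK fun i hi => by
      rw [hg] at hi ⊢
      rwa [hσ]
    refine ⟨π, fun k => ?_, hπ⟩
    rw [← hπ ⟨k, hK k k.2⟩ k.2, hσ]

open Classical in
/-- The orbit of a finite set. -/
def setOrb (S : Finset (Fin m)) : Finset (Finset (Fin m)) :=
  letI := Fintype.ofFinite G
  Finset.univ.image fun σ : G => S.image (σ : Equiv.Perm (Fin m))

theorem mem_setOrb [DecidableEq (Fin m)] {S T : Finset (Fin m)} :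
    T ∈ setOrb G S ↔ ∃ σ ∈ G, T = S.image σ := by
  simp only [setOrb, Finset.mem_image, Finset.mem_univ, true_and, Subtype.exists, exists_prop]
  refine exists_congr fun σ => and_congr_right fun _ => ?_
  rw [eq_comm]
  congr!

/-- Orbit-stabilizer theorem for finite sets. -/
theorem card_setOrb_mul {K : Finset ℕ} (hK : ∀ j ∈ K, j < m) :
    (setOrb G (finPart m K)).card *
      ((inducedGroup G K).ncard * Nat.card (pointwiseStabilizer G (finPart m K)))
        = Nat.card G := by
  classical
  cases nonempty_fintype G
  have h := sum_comp_of_equivariant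
    (f := fun σ : G => (finPart m K).image (σ : Equiv.Perm (Fin m)))
    (fun ρ σ τ hh => by
      rw [Subgroup.coe_mul, Subgroup.coe_mul, Equiv.Perm.coe_mul, Equiv.Perm.coe_mul,
        ← Finset.image_image, ← Finset.image_image, hh]) (fun _ => 1)
  have horb : Finset.univ.image (fun σ : G => (finPart m K).image (σ : Equiv.Perm (Fin m)))
      = setOrb G (finPart m K) := by
    ext k
    rw [mem_setOrb]
    simp [eq_comm]
  rw [Finset.sum_const, Finset.sum_const, horb, smul_eq_mul, smul_eq_mul, smul_eq_mul, mul_one,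
    mul_one, Finset.card_univ] at h
  rw [← Set.inter_univ (inducedGroup G K), ← card_restricted G hK,
    Nat.card_eq_fintype_card (α := G), h, mul_comm, Nat.card_eq_fintype_card, Fintype.card_subtype]
  congr 2
  ext σ
  simp only [Finset.mem_filter, Finset.mem_univ, true_and, Subgroup.coe_one, Equiv.Perm.coe_one,
    Finset.image_id, Set.mem_univ]
  constructor
  · rintro ⟨π, hσ⟩
    refine Finset.eq_of_subset_of_card_le ?_ ?_
    · intro j hj
      obtain ⟨i, hi, rfl⟩ := Finset.mem_image.1 hj
      rw [mem_finPart] at hi ⊢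
      rw [hσ i hi]
      exact (π _).2
    · rw [Finset.card_image_of_injective _ (Equiv.injective _)]
  · intro he
    refine exists_induced hK fun i hi => ?_
    rw [← mem_finPart (m := m), ← he]
    exact Finset.mem_image_of_mem _ (mem_finPart.2 hi)

/-- Orbit-stabilizer expresses the orbit sizes by pointwise stabilizers `p i`, `pU` and orders `s
i`, `u` from induced groups. The last square root is `M(κ, N)`; the factor before it depends only on
induced groups. -/
theorem orbit_ratio_eq {o p s : Fin 3 → ℝ} {oU pU u gN : ℝ} (hp : ∀ i, 0 < p i)
    (hs : ∀ i, 0 < s i) (hpU : 0 < pU) (hu : 0 < u) (hgN : 0 < gN)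
    (h : ∀ i, o i * (s i * p i) = gN) (hU : oU * (u * pU) = gN) :
    oU / (√(o 0) * √(o 1) * √(o 2))
      = √(s 0 * s 1 * s 2) / u * √((∏ i, p i) / (gN * pU ^ 2)) := by
  have ho : ∀ i, o i = gN / (s i * p i) := fun i => by
    rw [eq_div_iff (mul_pos (hs i) (hp i)).ne', h]
  have hoU : oU = gN / (u * pU) := by rw [eq_div_iff (mul_pos hu hpU).ne', hU]
  have ho' : ∀ i, 0 < o i := fun i => by rw [ho]; exact div_pos hgN (mul_pos (hs i) (hp i))
  have hoU' : 0 < oU := by rw [hoU]; positivity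
  have hpp := Finset.prod_pos fun i (_ : i ∈ Finset.univ) => hp i
  have h0 := hp 0
  have h1 := hp 1
  have h2 := hp 2
  have s0 := hs 0
  have s1 := hs 1
  have s2 := hs 2
  have o0 := ho' 0
  have o1 := ho' 1
  have o2 := ho' 2
  rw [← Real.sqrt_mul o0.le, ← Real.sqrt_mul (by positivity)]
  refine (sq_eq_sq₀ (by positivity) (by positivity)).1 ?_
  rw [div_pow, Real.sq_sqrt (by positivity), mul_pow, div_pow, Real.sq_sqrt (by positivity),
    Real.sq_sqrt (by positivity), Fin.prod_univ_three, hoU, ho, ho, ho]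
  field_simp

end Counting

/-! ## Convergence of the structure constants -/

theorem sum_piFinset_three {α M : Type*} [AddCommMonoid M] (A : Fin 3 → Finset α)
    (f : α → α → α → M) : ∑ k ∈ Fintype.piFinset A, f (k 0) (k 1) (k 2)
      = ∑ k₁ ∈ A 0, ∑ k₂ ∈ A 1, ∑ k₃ ∈ A 2, f k₁ k₂ k₃ := by
  have h : ∑ k₁ ∈ A 0, ∑ k₂ ∈ A 1, ∑ k₃ ∈ A 2, f k₁ k₂ k₃
      = ∑ p ∈ A 0 ×ˢ A 1 ×ˢ A 2, f p.1 p.2.1 p.2.2 := by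
    rw [Finset.sum_product]
    exact Finset.sum_congr rfl fun k _ => (Finset.sum_product (A 1) (A 2) fun p => f k p.1 p.2).symm
  rw [h]
  refine Finset.sum_bij' (fun k _ => (k 0, k 1, k 2)) (fun p _ => ![p.1, p.2.1, p.2.2])
    ?_ ?_ ?_ ?_ ?_
  · intro k hk
    rw [Fintype.mem_piFinset] at hk
    simp [hk]
  · rintro ⟨a, b, c⟩ hp
    simp only [Finset.mem_product] at hp
    rw [Fintype.mem_piFinset]
    intro i
    fin_cases i
    · exact hp.1
    · exact hp.2.1
    · exact hp.2.2
  · intro k _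
    ext i
    fin_cases i <;> rfl
  · intro p _
    rfl
  · intro k _
    rfl

/-! ### Sums over triples, split by the union of supports. -/

section Decomposition

open Classical in
/-- The union of the supports of functions. -/
def unionSupp {I X J : Type*} [Fintype X] (v : I) (k : J → X → I) : Finset X :=
  Finset.univ.filter fun j => ∃ i, k i j ≠ v

theorem mem_unionSupp {I X J : Type*} [Fintype X] {v : I} {k : J → X → I} {j : X} :
    j ∈ unionSupp v k ↔ ∃ i, k i j ≠ v := by
  simp [unionSupp]

variable {I : Type*} {m : ℕ} (G : Subgroup (Equiv.Perm (Fin m))) (v : I)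

theorem unionSupp_act {J : Type*} (σ : Equiv.Perm (Fin m)) (k : J → Fin m → I) :
    unionSupp v (fun i => act σ (k i)) = (unionSupp v k).image σ := by
  ext j
  rw [mem_unionSupp, Finset.mem_image]
  constructor
  · rintro ⟨i, hi⟩
    exact ⟨σ⁻¹ j, mem_unionSupp.2 ⟨i, hi⟩, perm_apply_inv σ j⟩
  · rintro ⟨l, hl, rfl⟩
    obtain ⟨i, hi⟩ := mem_unionSupp.1 hl
    refine ⟨i, ?_⟩
    rwa [act, perm_inv_apply]

theorem card_unionSupp_le {g : Fin 3 → ℕ → I} {m' : ℕ} (hg : ∀ i j, m' ≤ j → g i j = v)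
    {k : Fin 3 → Fin m → I} (hk : ∀ i, k i ∈ orb G (restr m (g i))) :
    (unionSupp v k).card ≤ 3 * m' := by
  classical
  have h1 : unionSupp v k ⊆ Finset.univ.biUnion fun i => Finset.univ.filter fun j => k i j ≠ v := by
    intro j hj
    obtain ⟨i, hi⟩ := mem_unionSupp.1 hj
    simpa using ⟨i, hi⟩
  refine (Finset.card_le_card h1).trans (Finset.card_biUnion_le.trans ?_)
  refine (Finset.sum_le_card_nsmul _ _ m' fun i _ => ?_).trans (by simp)
  obtain ⟨σ, -, hσ⟩ := mem_orb.1 (hk i)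
  rw [← Finset.card_range m']
  refine Finset.card_le_card_of_injOn (fun j => ((σ⁻¹ j : Fin m) : ℕ)) ?_ ?_
  · intro j hj
    rw [Finset.mem_coe, Finset.mem_filter] at hj
    rw [Finset.mem_coe, Finset.mem_range]
    by_contra hlt
    refine hj.2 ?_
    rw [hσ]
    exact hg i _ (not_lt.1 hlt)
  · intro j _ j' _ h
    exact (σ⁻¹).injective (Fin.ext h)

open Classical in
/-- A sum over triples from three orbits, decomposed according to the orbit of the union of the
supports. -/
theorem sum_triples_eq (A : Fin 3 → Finset (Fin m → I))
    (hA : ∀ i, ∀ σ ∈ G, ∀ h, act σ h ∈ A i ↔ h ∈ A i) (C : (Fin 3 → Fin m → I) → ℂ)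
    (hC : ∀ σ k, C (fun i => act σ (k i)) = C k) (𝒰 : Finset (Finset ℕ))
    (h𝒰 : ∀ k ∈ Fintype.piFinset A, ∃! U, U ∈ 𝒰 ∧ unionSupp v k ∈ setOrb G (finPart m U)) :
    ∑ k ∈ Fintype.piFinset A, C k = ∑ U ∈ 𝒰, ((setOrb G (finPart m U)).card : ℂ) *
      ∑ k ∈ (Fintype.piFinset A).filter (fun k => unionSupp v k = finPart m U), C k := by
  have h1 : ∑ k ∈ Fintype.piFinset A, C k = ∑ U ∈ 𝒰, ∑ k ∈ Fintype.piFinset A,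
      if unionSupp v k ∈ setOrb G (finPart m U) then C k else 0 := by
    rw [Finset.sum_comm]
    refine Finset.sum_congr rfl fun k hk => ?_
    obtain ⟨U, ⟨hU, hU'⟩, huniq⟩ := h𝒰 k hk
    rw [Finset.sum_eq_single U, if_pos hU']
    · intro U₁ hU₁ hne
      exact if_neg fun h => hne (huniq _ ⟨hU₁, h⟩)
    · intro h
      exact absurd hU h
  rw [h1]
  refine Finset.sum_congr rfl fun U _ => ?_
  rw [← Finset.sum_filter, ← nsmul_eq_mul, ← Finset.sum_const,
    ← Finset.sum_fiberwise_of_maps_to (t := setOrb G (finPart m U)) (g := unionSupp v)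
      fun k hk => (Finset.mem_filter.1 hk).2]
  -- An element of `G` carrying the representative to `S` matches the triples with these two unions
  -- of supports, and the summand is invariant. All sets in the orbit thus give the same partial
  -- sum.
  refine Finset.sum_congr rfl fun S hS => ?_
  obtain ⟨σ, hσ, rfl⟩ := (mem_setOrb G).1 hS
  symm
  refine Finset.sum_bij (fun k _ i => act σ (k i)) ?_ ?_ ?_ ?_
  · intro k hk
    rw [Finset.mem_filter, Fintype.mem_piFinset] at hk
    rw [Finset.mem_filter, Finset.mem_filter, Fintype.mem_piFinset, unionSupp_act, hk.2]
    exact ⟨⟨fun i => (hA i σ hσ _).2 (hk.1 i), hS⟩, rfl⟩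
  · intro k _ k' _ h
    ext1 i
    exact act_injective σ (congrFun h i)
  · intro k hk
    rw [Finset.mem_filter, Finset.mem_filter, Fintype.mem_piFinset] at hk
    refine ⟨fun i => act σ⁻¹ (k i), ?_, ?_⟩
    · rw [Finset.mem_filter, Fintype.mem_piFinset, unionSupp_act, hk.2, Finset.image_image]
      refine ⟨fun i => (hA i _ (G.inv_mem hσ) _).2 (hk.1.1 i), ?_⟩
      rw [show (⇑σ⁻¹ ∘ ⇑σ) = id from funext (perm_inv_apply σ), Finset.image_id]
    · ext1 i
      exact act_act_inv σ (k i)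
  · intro k _
    exact (hC σ k).symm

end Decomposition

/-! ### Existence of the limits. -/

section Convergence

variable {V : Type*} [AddCommGroup V] [Module ℂ V] {U : UnitaryVOA V} {ι : Type*}
  {Φ : RealBasis U ι} {x : ℕ → ℕ} {G : ∀ N, Subgroup (Equiv.Perm (Fin (x N)))}

/-- The finite support of a function supported in the first `m` numbers. -/
def suppFinset (Φ : RealBasis U ι) (m : ℕ) (g : ℕ → ι) : Finset ℕ :=
  open Classical in (Finset.range m).filter fun j => g j ≠ Φ.vacIdx

theorem mem_suppFinset_iff {m : ℕ} {g : ℕ → ι} {j : ℕ} :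
    j ∈ suppFinset Φ m g ↔ j < m ∧ g j ≠ Φ.vacIdx := by
  simp [suppFinset]

theorem SuppIn.mem_suppFinset {m : ℕ} {g : ℕ → ι} (hg : SuppIn Φ m g) {j : ℕ} :
    j ∈ suppFinset Φ m g ↔ g j ≠ Φ.vacIdx := by
  rw [mem_suppFinset_iff, and_iff_right_iff_imp]
  intro h
  by_contra hlt
  exact h (hg j (not_lt.1 hlt))

theorem lt_of_mem_suppFinset {m : ℕ} {g : ℕ → ι} {j : ℕ} (hj : j ∈ suppFinset Φ m g) : j < m :=
  (mem_suppFinset_iff.1 hj).1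

theorem NestedOligomorphic.tendsto_size (hG : NestedOligomorphic Φ x G) : Tendsto x atTop atTop :=
  (strictMono_nat_of_lt_succ hG.size_lt).tendsto_atTop

/-- Group elements taking `g i` to `H i` form a configuration with fixed supports `K i` and `L i`,
so `M(κ, N)` converges. The remaining factor counts elements of induced groups, which are eventually
constant. -/
theorem exists_tendsto_ratio (hG : NestedOligomorphic Φ x G) (hM : MultiplicitiesConverge x G)
    {m : ℕ} {g H : Fin 3 → ℕ → ι} (hg : ∀ i, SuppIn Φ m (g i)) (hH : ∀ i, SuppIn Φ m (H i))
    (hmem : ∀ᶠ N in atTop, ∀ i, restr (x N) (H i) ∈ orb (G N) (restr (x N) (g i)))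
    (hone : ∀ j, (Finset.univ.filter fun i => j ∈ suppFinset Φ m (H i)).card ≠ 1)
    {A : Finset ℕ} (hA : ∀ j, j ∈ A ↔ ∃ i, H i j ≠ Φ.vacIdx) :
    ∃ l : ℝ, Tendsto (fun N => ((setOrb (G N) (finPart (x N) A)).card : ℝ) /
      (√(orb (G N) (restr (x N) (g 0))).card * √(orb (G N) (restr (x N) (g 1))).card
        * √(orb (G N) (restr (x N) (g 2))).card)) atTop (𝓝 l) := by
  classical
  set K : Fin 3 → Finset ℕ := fun i => suppFinset Φ m (g i) with hK
  set L : Fin 3 → Finset ℕ := fun i => suppFinset Φ m (H i) with hL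
  -- For the small `N` at which some `H i` is not in the orbit of `g i`, any `κ` will do, and `1` is
  -- taken.
  have hκ : ∀ N, ∃ κ : Fin 3 → G N,
      (∀ i, restr (x N) (H i) ∈ orb (G N) (restr (x N) (g i))) →
        ∀ i, restr (x N) (H i) = act (κ i : Equiv.Perm (Fin (x N))) (restr (x N) (g i)) := by
    intro N
    by_cases h : ∀ i, restr (x N) (H i) ∈ orb (G N) (restr (x N) (g i))
    · choose σ hσ he using fun i => mem_orb.1 (h i)
      exact ⟨fun i => ⟨σ i, hσ i⟩, fun _ => he⟩
    · exact ⟨1, fun h' => absurd h' h⟩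
  choose κ hκ using hκ
  have himage : ∀ᶠ N in atTop, ∀ i,
      (finPart (x N) (K i)).image (κ N i : Equiv.Perm (Fin (x N))) = finPart (x N) (L i) := by
    filter_upwards [hmem] with N hN i
    have he := hκ N hN i
    ext j
    rw [Finset.mem_image, mem_finPart, hL, (hH i).mem_suppFinset]
    have hj := congrFun he j
    constructor
    · rintro ⟨l, hl, rfl⟩
      rw [mem_finPart, hK, (hg i).mem_suppFinset] at hl
      rw [act, perm_inv_apply] at hj
      simp only [restr] at hj
      rwa [hj]
    · intro hne
      refine ⟨(κ N i : Equiv.Perm (Fin (x N)))⁻¹ j, ?_, perm_apply_inv _ _⟩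
      rw [mem_finPart, hK, (hg i).mem_suppFinset]
      simp only [restr, act] at hj
      rwa [← hj]
  obtain ⟨l, hl⟩ := hM K L κ himage hone
  have hAm : ∀ j ∈ A, j < m := by
    intro j hj
    obtain ⟨i, hi⟩ := (hA j).1 hj
    exact lt_of_mem_suppFinset ((hH i).mem_suppFinset.2 hi)
  let Q : ∀ i, Set (Equiv.Perm (K i)) := fun i => {π | ∀ k, g i (π k : ℕ) = g i (k : ℕ)}
  choose HK hHK using fun i => hG.induced_converges (K i)
  obtain ⟨HA, hHA⟩ := hG.induced_converges A
  set s : Fin 3 → ℝ := fun i => ((((HK i : Set (Equiv.Perm (K i))) ∩ Q i).ncard : ℕ) : ℝ) with hs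
  set u : ℝ := (((HA : Set (Equiv.Perm A)).ncard : ℕ) : ℝ) with hu
  have hspos : ∀ i, 0 < s i := fun i => by
    rw [hs, Nat.cast_pos, Set.ncard_pos (Set.toFinite _)]
    exact ⟨1, (HK i).one_mem, fun k => rfl⟩
  have hupos : 0 < u := by
    rw [hu, Nat.cast_pos, Set.ncard_pos (Set.toFinite _)]
    exact ⟨1, HA.one_mem⟩
  refine ⟨√(s 0 * s 1 * s 2) / u * l, (hl.const_mul _).congr' ?_⟩
  filter_upwards [himage, eventually_all.2 hHK, hHA, hG.tendsto_size.eventually_ge_atTop m]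
    with N hN hHK hHA hm
  have hunion : (Finset.univ.biUnion fun i => (finPart (x N) (K i)).image
      (κ N i : Equiv.Perm (Fin (x N)))) = finPart (x N) A := by
    ext j
    simp only [hN, Finset.mem_biUnion, Finset.mem_univ, true_and, mem_finPart, hA, hL]
    exact exists_congr fun i => (hH i).mem_suppFinset
  symm
  rw [configMultiplicity, hunion]
  refine orbit_ratio_eq (fun i => ?_) hspos ?_ hupos ?_ (o := fun i => ((orb (G N) (restr (x N) (g i))).card : ℝ))
    (fun i => ?_) ?_
  · exact_mod_cast Nat.card_pos
  · exact_mod_cast Nat.card_pos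
  · exact_mod_cast Nat.card_pos
  · have := card_orb_mul (G N) (K := K i) (g := g i) (v := Φ.vacIdx)
      (fun j hj => (lt_of_mem_suppFinset hj).trans_le hm) (fun j => (hg i).mem_suppFinset)
    rw [hHK i] at this
    simp only [hs, Q]
    exact_mod_cast this
  · have := card_setOrb_mul (G N) (K := A) (fun j hj => (hAm j hj).trans_le hm)
    rw [hHA] at this
    rw [hu]
    exact_mod_cast this

/-- Sites outside the supports carry three vacua and contribute the factor one, so the product does
not depend on `N`. -/
theorem piConst_restr (hU : U.IsCFTType) {m m' : ℕ} (hm : m ≤ m') {H : Fin 3 → ℕ → ι}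
    (hH : ∀ i, SuppIn Φ m (H i)) :
    piConst Φ.structConst (restr m' (H 0)) (restr m' (H 1)) (restr m' (H 2))
      = ∏ j ∈ Finset.range m, Φ.structConst (H 0 j) (H 1 j) (H 2 j) := by
  rw [Finset.prod_subset (Finset.range_subset_range.2 hm), Finset.prod_range]
  · rfl
  · intro j _ hj
    rw [Finset.mem_range, not_lt] at hj
    rw [hH 0 j hj, hH 1 j hj, hH 2 j hj, (Φ.isVertexStructure hU).vac_self]

/-- A site with exactly two vacua contributes zero. Nonzero triples therefore meet the restriction
in `MultiplicitiesConverge`. -/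
theorem card_filter_suppFinset_ne_one (hU : U.IsCFTType) {m : ℕ} {H : Fin 3 → ℕ → ι}
    (hne : ∏ j ∈ Finset.range m, Φ.structConst (H 0 j) (H 1 j) (H 2 j) ≠ 0) (j : ℕ) :
    (Finset.univ.filter fun i => j ∈ suppFinset Φ m (H i)).card ≠ 1 := by
  intro h
  obtain ⟨i, hi⟩ := Finset.card_eq_one.1 h
  have S := Φ.isVertexStructure hU
  have hi' := Finset.ext_iff.1 hi
  simp only [Finset.mem_filter, Finset.mem_univ, true_and, Finset.mem_singleton] at hi'
  have hj := lt_of_mem_suppFinset ((hi' i).2 rfl)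
  have hv : ∀ k, H k j ≠ Φ.vacIdx ↔ k = i := by
    intro k
    rw [← hi' k, mem_suppFinset_iff, and_iff_right hj]
  have hv' : ∀ k, k ≠ i → H k j = Φ.vacIdx := fun k hk => by
    by_contra hcon
    exact hk ((hv k).1 hcon)
  have hii := (hv i).2 rfl
  refine Finset.prod_ne_zero_iff.1 hne j (Finset.mem_range.2 hj) ?_
  fin_cases i
  · change H 0 j ≠ _ at hii
    rw [hv' 1 (by decide), hv' 2 (by decide)]
    exact S.vac_ne _ _ hii
  · change H 1 j ≠ _ at hii
    rw [hv' 0 (by decide), hv' 2 (by decide)]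
    exact S.creation_ne _ _ (by rw [S.wt_vac]; exact Nat.zero_le _) (Ne.symm hii)
  · change H 2 j ≠ _ at hii
    rw [hv' 0 (by decide), hv' 1 (by decide)]
    exact S.vac_ne _ _ (Ne.symm hii)

/-- Triples of functions with given weights and given union of supports. -/
def triples (Φ : RealBasis U ι) (m : ℕ) (w : Fin 3 → ℕ) (A : Finset ℕ) : Set (Fin 3 → ℕ → ι) :=
  {H | (∀ i, SuppIn Φ m (H i) ∧ weight Φ (H i) = w i) ∧ ∀ j, j ∈ A ↔ ∃ i, H i j ≠ Φ.vacIdx}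

theorem finite_triples (hU : U.IsCFTType) (m : ℕ) (w : Fin 3 → ℕ) (A : Finset ℕ) :
    (triples Φ m w A).Finite :=
  (Set.Finite.pi' fun i => finite_suppIn hU m (w i)).subset fun _ hH i => hH.1 i

-- Once the union of supports is fixed, the triples come from a finite set independent of `N`, and
-- `N` enters only through the orbit conditions.
open Classical in
theorem sum_filter_unionSupp (hU : U.IsCFTType) {m N : ℕ} (hm : m ≤ x N) {g : Fin 3 → ℕ → ι}
    (hg : ∀ i, SuppIn Φ m (g i)) {A : Finset ℕ} (hA : ∀ j ∈ A, j < m) :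
    ∑ k ∈ (Fintype.piFinset fun i => orb (G N) (restr (x N) (g i))).filter
        (fun k => unionSupp Φ.vacIdx k = finPart (x N) A),
      piConst Φ.structConst (k 0) (k 1) (k 2)
    = ∑ H ∈ (finite_triples (Φ := Φ) hU m (fun i => weight Φ (g i)) A).toFinset,
      if ∀ i, restr (x N) (H i) ∈ orb (G N) (restr (x N) (g i)) then
        ∏ j ∈ Finset.range m, Φ.structConst (H 0 j) (H 1 j) (H 2 j) else 0 := by
  rw [← Finset.sum_filter]
  symm
  refine Finset.sum_bij (fun H _ i => restr (x N) (H i)) ?_ ?_ ?_ ?_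
  · intro H hH
    rw [Finset.mem_filter, Set.Finite.mem_toFinset] at hH
    rw [Finset.mem_filter, Fintype.mem_piFinset]
    refine ⟨hH.2, ?_⟩
    ext j
    rw [mem_unionSupp, mem_finPart, hH.1.2]
    rfl
  · intro H hH H' hH' he
    rw [Finset.mem_filter, Set.Finite.mem_toFinset] at hH hH'
    ext1 i
    exact ((hH.1.1 i).1.mono hm).eq_of_restr_eq ((hH'.1.1 i).1.mono hm) (congrFun he i)
  · intro k hk
    rw [Finset.mem_filter, Fintype.mem_piFinset] at hk
    have hres : ∀ i, restr (x N) (extend Φ (k i)) = k i := fun i => restr_extend _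
    refine ⟨fun i => extend Φ (k i), ?_, funext hres⟩
    rw [Finset.mem_filter, Set.Finite.mem_toFinset]
    have hun : ∀ j, j ∈ A ↔ ∃ i, extend Φ (k i) j ≠ Φ.vacIdx := by
      intro j
      by_cases hj : j < x N
      · have := Finset.ext_iff.1 hk.2 ⟨j, hj⟩
        rw [mem_unionSupp, mem_finPart] at this
        rw [← this]
        refine exists_congr fun i => ?_
        rw [← congrFun (hres i) ⟨j, hj⟩]
        rfl
      · constructor
        · intro h
          exact absurd ((hA j h).trans_le hm) hj
        · rintro ⟨i, hi⟩
          exact absurd (suppIn_extend (k i) j (not_lt.1 hj)) hi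
    refine ⟨⟨fun i => ⟨fun j hj => ?_, ?_⟩, hun⟩, fun i => by rw [hres]; exact hk.1 i⟩
    · by_contra hne
      exact absurd (hA j ((hun j).2 ⟨i, hne⟩)) (not_lt.2 hj)
    · change _ = weight Φ (g i)
      rw [weight_eq hU (suppIn_extend _), hres, piWt_of_mem_orb (hk.1 i),
        weight_eq hU ((hg i).mono hm)]
  · intro H hH
    rw [Finset.mem_filter, Set.Finite.mem_toFinset] at hH
    exact (piConst_restr hU hm fun i => (hH.1.1 i).1).symm

/-- The structure constants of the fixed point algebras converge. -/
theorem exists_tendsto_orbConst (hU : U.IsCFTType) (hG : NestedOligomorphic Φ x G)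
    (hM : MultiplicitiesConverge x G) {m : ℕ} {g : Fin 3 → ℕ → ι} (hg : ∀ i, SuppIn Φ m (g i)) :
    ∃ l : ℂ, Tendsto (fun N => orbConst Φ.structConst (G N) (restr (x N) (g 0))
      (restr (x N) (g 1)) (restr (x N) (g 2))) atTop (𝓝 l) := by
  classical
  have S := Φ.isVertexStructure hU
  -- Encoding sets by functions needs a value other than the vacuum. Without one, every function is
  -- constant and every structure constant is one.
  by_cases hi₀ : ∃ i₀, i₀ ≠ Φ.vacIdx
  swap
  · push Not at hi₀
    have hconst : ∀ (N : ℕ) (h : Fin (x N) → ι), h = fun _ => Φ.vacIdx :=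
      fun N h => funext fun i => hi₀ _
    refine ⟨1, tendsto_const_nhds.congr fun N => ?_⟩
    rw [hconst N (restr (x N) (g 0)), hconst N (restr (x N) (g 1)), hconst N (restr (x N) (g 2)),
      orbConst, orb_const, Finset.sum_singleton, Finset.sum_singleton, Finset.sum_singleton, piConst]
    simp [S.vac_self]
  obtain ⟨i₀, hi₀⟩ := hi₀
  obtain ⟨B, hB⟩ := hG.exists_representatives hU
  -- Each of the three supports has at most `m` points, which bounds the unions that occur.
  -- Enlarging `m` to `m'` below makes room for the representing sets as well.
  obtain ⟨𝒰, N₀, h𝒰, h𝒰'⟩ := hB.exists_subset_representatives hU hG hi₀ (3 * m)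
  set m' := max m (x N₀) with hm'
  have hg' : ∀ i, SuppIn Φ m' (g i) := fun i => (hg i).mono (le_max_left _ _)
  have hev : ∀ᶠ N in atTop, m' ≤ x N ∧ N₀ ≤ N :=
    (hG.tendsto_size.eventually_ge_atTop m').and (eventually_ge_atTop N₀)
  set ratio : Finset ℕ → ℕ → ℝ := fun A N => ((setOrb (G N) (finPart (x N) A)).card : ℝ) /
      (√(orb (G N) (restr (x N) (g 0))).card * √(orb (G N) (restr (x N) (g 1))).card
        * √(orb (G N) (restr (x N) (g 2))).card) with hratio
  have hterm : ∀ A ∈ 𝒰, ∀ H ∈ (finite_triples (Φ := Φ) hU m' (fun i => weight Φ (g i)) A).toFinset,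
      ∃ l : ℂ, Tendsto (fun N => (ratio A N : ℂ) *
        if ∀ i, restr (x N) (H i) ∈ orb (G N) (restr (x N) (g i)) then
          ∏ j ∈ Finset.range m', Φ.structConst (H 0 j) (H 1 j) (H 2 j) else 0) atTop (𝓝 l) := by
    intro A hA H hH
    rw [Set.Finite.mem_toFinset] at hH
    by_cases hzero : ∏ j ∈ Finset.range m', Φ.structConst (H 0 j) (H 1 j) (H 2 j) = 0
    · refine ⟨0, tendsto_const_nhds.congr fun N => ?_⟩
      rw [hzero, ite_self, mul_zero]
    by_cases hall : ∀ᶠ N in atTop, ∀ i, restr (x N) (H i) ∈ orb (G N) (restr (x N) (g i))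
    · obtain ⟨l, hl⟩ := exists_tendsto_ratio hG hM hg' (fun i => (hH.1 i).1) hall
        (card_filter_suppFinset_ne_one hU hzero) hH.2
      refine ⟨(l : ℂ) * ∏ j ∈ Finset.range m', Φ.structConst (H 0 j) (H 1 j) (H 2 j), ?_⟩
      refine (((Complex.continuous_ofReal.tendsto l).comp hl).mul_const _).congr' ?_
      filter_upwards [hall] with N hN
      rw [if_pos hN]
      rfl
    -- If the orbit condition fails at one sufficiently large `N₁`, nestedness makes it fail for all
    -- `N ≥ N₁`, so the term is eventually zero.
    · refine ⟨0, tendsto_const_nhds.congr' ?_⟩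
      obtain ⟨N₁, hN₁, hN₁'⟩ := ((not_eventually.1 hall).and_eventually hev).exists
      filter_upwards [eventually_ge_atTop N₁] with N hN
      rw [if_neg, mul_zero]
      intro hcon
      refine hN₁ fun i => hG.mem_orb_of_le hN ?_ ?_ (hcon i)
      · exact (hH.1 i).1.mono hN₁'.1
      · exact (hg' i).mono hN₁'.1
  choose! l hl using hterm
  refine ⟨∑ A ∈ 𝒰, ∑ H ∈ (finite_triples (Φ := Φ) hU m' (fun i => weight Φ (g i)) A).toFinset, l A H,
    (tendsto_finsetSum _ fun A hA => tendsto_finsetSum _ fun H hH => hl A hA H hH).congr' ?_⟩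
  filter_upwards [hev] with N hN
  rw [orbConst, ← sum_piFinset_three (fun i => orb (G N) (restr (x N) (g i)))
      (piConst Φ.structConst),
    sum_triples_eq (G N) Φ.vacIdx (fun i => orb (G N) (restr (x N) (g i)))
      (fun i σ hσ h => act_mem_orb hσ) (fun k => piConst Φ.structConst (k 0) (k 1) (k 2))
      (fun σ k => piConst_act _ _ _ _ _) 𝒰 ?_, Finset.mul_sum]
  · refine Finset.sum_congr rfl fun A hA => ?_
    rw [sum_filter_unionSupp hU hN.1 hg' fun j hj => (h𝒰 A hA j hj).trans_le (le_max_right _ _),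
      ← mul_assoc, Finset.mul_sum]
    refine Finset.sum_congr rfl fun H _ => ?_
    congr 1
    simp only [hratio]
    push_cast
    rw [div_eq_mul_inv, mul_comm]
  · intro k hk
    rw [Fintype.mem_piFinset] at hk
    have := h𝒰' N hN.2 (unionSupp Φ.vacIdx k) (card_unionSupp_le (G N) _ (fun i => hg i) hk)
    simpa only [mem_setOrb] using this

end Convergence

/-! ## Composition of structure constants of fixed point algebras -/

section Composition

variable {I J X : Type*} [Fintype X] (G : Subgroup (Equiv.Perm X)) (wt : I → ℕ)

/-- The functions `r j`, `j ∈ T`, represent the orbits on functions of weight `w`. -/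
structure IsTransversal (T : Finset J) (r : J → X → I) (w : ℤ) : Prop where
  weight_eq : ∀ j ∈ T, (piWt wt (r j) : ℤ) = w
  existsUnique : ∀ h : X → I, (piWt wt h : ℤ) = w → ∃! j, j ∈ T ∧ h ∈ orb G (r j)

variable {G wt} {T : Finset J} {r : J → X → I} {w : ℤ}

/-- Completeness of the normalized orbit sums among invariants of weight `w`: `P` and `Q` are
constant on each orbit, and the two square roots cancel one of the two factors of its size. -/
theorem IsTransversal.sum_eq (hT : IsTransversal G wt T r w) (hf : ∀ n, {i | wt i = n}.Finite)
    (P Q : (X → I) → ℂ) (hP : ∀ σ ∈ G, ∀ h, P (act σ h) = P h)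
    (hQ : ∀ σ ∈ G, ∀ h, Q (act σ h) = Q h) :
    ∑ j ∈ T, ((√(orb G (r j)).card : ℝ) : ℂ)⁻¹ * (∑ h ∈ orb G (r j), P h)
        * (((√(orb G (r j)).card : ℝ) : ℂ)⁻¹ * ∑ h ∈ orb G (r j), Q h)
      = ∑ h ∈ fib (piWt wt) w, P h * Q h := by
  classical
  have hfib : fib (piWt wt) w = T.biUnion fun j => orb G (r j) := by
    ext h
    rw [mem_fib (finite_piWt hf), Finset.mem_biUnion]
    constructor
    · intro hh
      obtain ⟨j, hj, -⟩ := hT.existsUnique h hh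
      exact ⟨j, hj⟩
    · rintro ⟨j, hj, hh⟩
      rw [piWt_of_mem_orb hh]
      exact hT.weight_eq j hj
  rw [hfib, Finset.sum_biUnion]
  · refine Finset.sum_congr rfl fun j _ => ?_
    have hPj : ∀ h ∈ orb G (r j), P h = P (r j) := fun h hh => by
      obtain ⟨σ, hσ, rfl⟩ := mem_orb.1 hh
      exact hP σ hσ _
    have hQj : ∀ h ∈ orb G (r j), Q h = Q (r j) := fun h hh => by
      obtain ⟨σ, hσ, rfl⟩ := mem_orb.1 hh
      exact hQ σ hσ _
    rw [Finset.sum_congr rfl hPj, Finset.sum_congr rfl hQj,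
      Finset.sum_congr rfl fun h hh => congrArg₂ (· * ·) (hPj h hh) (hQj h hh)]
    simp only [Finset.sum_const, nsmul_eq_mul]
    have h0 : (0 : ℝ) < (orb G (r j)).card := by exact_mod_cast orb_card_pos _
    have h1 : ((√(orb G (r j)).card : ℝ) : ℂ) * ((√(orb G (r j)).card : ℝ) : ℂ)
        = ((orb G (r j)).card : ℂ) := by
      rw [← Complex.ofReal_mul, Real.mul_self_sqrt h0.le, Complex.ofReal_natCast]
    have h2 : ((√(orb G (r j)).card : ℝ) : ℂ) ≠ 0 := by
      rw [Complex.ofReal_ne_zero]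
      exact (Real.sqrt_pos.2 h0).ne'
    rw [← h1]
    field_simp
  · intro j hj j' hj' hne
    rw [Function.onFun, Finset.disjoint_left]
    intro h hh hh'
    have hw : (piWt wt h : ℤ) = w := by
      rw [piWt_of_mem_orb hh]
      exact hT.weight_eq j hj
    exact hne ((hT.existsUnique h hw).unique ⟨hj, hh⟩ ⟨hj', hh'⟩)

variable {c : I → I → I → ℂ}

theorem sum_sum_piConst_act_right {σ : Equiv.Perm X} (hσ : σ ∈ G) (d a h : X → I) :
    ∑ k₁ ∈ orb G d, ∑ k₂ ∈ orb G a, piConst c k₁ k₂ (act σ h)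
      = ∑ k₁ ∈ orb G d, ∑ k₂ ∈ orb G a, piConst c k₁ k₂ h := by
  rw [← sum_orb_act d hσ]
  refine Finset.sum_congr rfl fun k₁ _ => ?_
  rw [← sum_orb_act a hσ]
  simp only [piConst_act]

theorem sum_sum_piConst_act_mid {σ : Equiv.Perm X} (hσ : σ ∈ G) (d b h : X → I) :
    ∑ k₁ ∈ orb G d, ∑ k₂ ∈ orb G b, piConst c k₁ (act σ h) k₂
      = ∑ k₁ ∈ orb G d, ∑ k₂ ∈ orb G b, piConst c k₁ h k₂ := by
  rw [← sum_orb_act d hσ]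
  refine Finset.sum_congr rfl fun k₁ _ => ?_
  rw [← sum_orb_act b hσ]
  simp only [piConst_act]

theorem sum_sum_piConst_act_left {σ : Equiv.Perm X} (hσ : σ ∈ G) (a b h : X → I) :
    ∑ k₁ ∈ orb G a, ∑ k₂ ∈ orb G b, piConst c (act σ h) k₁ k₂
      = ∑ k₁ ∈ orb G a, ∑ k₂ ∈ orb G b, piConst c h k₁ k₂ := by
  rw [← sum_orb_act a hσ]
  refine Finset.sum_congr rfl fun k₁ _ => ?_
  rw [← sum_orb_act b hσ]
  simp only [piConst_act]

/-- Sum over four orbits, normalized. -/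
def orbSum (G : Subgroup (Equiv.Perm X)) (d a b b' : X → I)
    (F : (X → I) → (X → I) → (X → I) → (X → I) → ℂ) : ℂ :=
  (((√(orb G d).card * √(orb G a).card * √(orb G b).card * √(orb G b').card)⁻¹ : ℝ) : ℂ) *
    ∑ k₁ ∈ orb G d, ∑ k₂ ∈ orb G a, ∑ k₃ ∈ orb G b, ∑ k₄ ∈ orb G b', F k₁ k₂ k₃ k₄

theorem orbSum_comm (d a b b' : X → I) (F : (X → I) → (X → I) → (X → I) → (X → I) → ℂ) :
    orbSum G d a b b' F = orbSum G d b a b' fun k₁ k₃ k₂ k₄ => F k₁ k₂ k₃ k₄ := by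
  rw [orbSum, orbSum, mul_right_comm (√(orb G d).card)]
  congr 1
  exact Finset.sum_congr rfl fun k₁ _ => Finset.sum_comm

theorem orbSum_sub (d a b b' : X → I) (F F' : (X → I) → (X → I) → (X → I) → (X → I) → ℂ) :
    orbSum G d a b b' F - orbSum G d a b b' F'
      = orbSum G d a b b' fun k₁ k₂ k₃ k₄ => F k₁ k₂ k₃ k₄ - F' k₁ k₂ k₃ k₄ := by
  simp only [orbSum, ← mul_sub, Finset.sum_sub_distrib]

theorem orbSum_mul_left (z : ℂ) (d a b b' : X → I)
    (F : (X → I) → (X → I) → (X → I) → (X → I) → ℂ) :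
    z * orbSum G d a b b' F = orbSum G d a b b' fun k₁ k₂ k₃ k₄ => z * F k₁ k₂ k₃ k₄ := by
  simp only [orbSum, Finset.mul_sum]
  simp only [mul_left_comm]

theorem sum_orbSum {α : Type*} (s : Finset α) (d a b b' : X → I)
    (F : α → (X → I) → (X → I) → (X → I) → (X → I) → ℂ) :
    ∑ j ∈ s, orbSum G d a b b' (F j)
      = orbSum G d a b b' fun k₁ k₂ k₃ k₄ => ∑ j ∈ s, F j k₁ k₂ k₃ k₄ := by
  simp only [orbSum, ← Finset.mul_sum]
  congr 1
  simp only [Finset.sum_comm (s := s)]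

theorem orbSum_congr {d a b b' : X → I} {F F' : (X → I) → (X → I) → (X → I) → (X → I) → ℂ}
    (h : ∀ k₁ ∈ orb G d, ∀ k₂ ∈ orb G a, ∀ k₃ ∈ orb G b, ∀ k₄ ∈ orb G b',
      F k₁ k₂ k₃ k₄ = F' k₁ k₂ k₃ k₄) : orbSum G d a b b' F = orbSum G d a b b' F' := by
  rw [orbSum, orbSum]
  congr 1
  exact Finset.sum_congr rfl fun k₁ h₁ => Finset.sum_congr rfl fun k₂ h₂ =>
    Finset.sum_congr rfl fun k₃ h₃ => Finset.sum_congr rfl fun k₄ h₄ => h k₁ h₁ k₂ h₂ k₃ h₃ k₄ h₄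

theorem orbSum_const (d a b : X → I) (v : I) (F : (X → I) → (X → I) → (X → I) → (X → I) → ℂ) :
    orbSum G d a b (fun _ => v) F
      = (((√(orb G d).card * √(orb G a).card * √(orb G b).card)⁻¹ : ℝ) : ℂ) *
        ∑ k₁ ∈ orb G d, ∑ k₂ ∈ orb G a, ∑ k₃ ∈ orb G b, F k₁ k₂ k₃ fun _ => v := by
  simp [orbSum, orb_const]

/-- The inner double sums are invariant functions of the intermediate argument, so
`IsTransversal.sum_eq` replaces the sum over orbits by the sum over all functions of weight `w`.
Quadratic identities of the tensor power thereby descend to the fixed points. -/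
theorem IsTransversal.sum_right (hT : IsTransversal G wt T r w)
    (hf : ∀ n, {i | wt i = n}.Finite) (d a b b' : X → I) :
    ∑ j ∈ T, orbConst c G d a (r j) * orbConst c G (r j) b b'
      = orbSum G d a b b' fun k₁ k₂ k₃ k₄ =>
        ∑ h ∈ fib (piWt wt) w, piConst c k₁ k₂ h * piConst c h k₃ k₄ := by
  have key := hT.sum_eq hf (fun h => ∑ k₁ ∈ orb G d, ∑ k₂ ∈ orb G a, piConst c k₁ k₂ h)
    (fun h => ∑ k₃ ∈ orb G b, ∑ k₄ ∈ orb G b', piConst c h k₃ k₄)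
    (fun σ hσ h => sum_sum_piConst_act_right hσ d a h)
    (fun σ hσ h => sum_sum_piConst_act_left hσ b b' h)
  have h1 : ∑ k₁ ∈ orb G d, ∑ k₂ ∈ orb G a, ∑ k₃ ∈ orb G b, ∑ k₄ ∈ orb G b',
      ∑ h ∈ fib (piWt wt) w, piConst c k₁ k₂ h * piConst c h k₃ k₄
      = ∑ h ∈ fib (piWt wt) w, (∑ k₁ ∈ orb G d, ∑ k₂ ∈ orb G a, piConst c k₁ k₂ h)
        * ∑ k₃ ∈ orb G b, ∑ k₄ ∈ orb G b', piConst c h k₃ k₄ := by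
    simp only [Finset.sum_comm (t := fib (piWt wt) w), Finset.sum_mul]
    simp only [Finset.mul_sum]
  rw [orbSum, h1, ← key, Finset.mul_sum]
  refine Finset.sum_congr rfl fun j _ => ?_
  have h2 : ∑ k₁ ∈ orb G d, ∑ k₂ ∈ orb G a, ∑ h ∈ orb G (r j), piConst c k₁ k₂ h
      = ∑ h ∈ orb G (r j), ∑ k₁ ∈ orb G d, ∑ k₂ ∈ orb G a, piConst c k₁ k₂ h := by
    simp only [Finset.sum_comm (t := orb G (r j))]
  rw [orbConst, orbConst, h2]
  push_cast
  simp only [mul_inv]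
  ring

theorem IsTransversal.sum_left (hT : IsTransversal G wt T r w)
    (hf : ∀ n, {i | wt i = n}.Finite) (d a b b' : X → I) :
    ∑ j ∈ T, orbConst c G d (r j) b' * orbConst c G (r j) a b
      = orbSum G d a b b' fun k₁ k₂ k₃ k₄ =>
        ∑ h ∈ fib (piWt wt) w, piConst c k₁ h k₄ * piConst c h k₂ k₃ := by
  have key := hT.sum_eq hf (fun h => ∑ k₁ ∈ orb G d, ∑ k₄ ∈ orb G b', piConst c k₁ h k₄)
    (fun h => ∑ k₂ ∈ orb G a, ∑ k₃ ∈ orb G b, piConst c h k₂ k₃)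
    (fun σ hσ h => sum_sum_piConst_act_mid hσ d b' h)
    (fun σ hσ h => sum_sum_piConst_act_left hσ a b h)
  have h1 : ∑ k₁ ∈ orb G d, ∑ k₂ ∈ orb G a, ∑ k₃ ∈ orb G b, ∑ k₄ ∈ orb G b',
      ∑ h ∈ fib (piWt wt) w, piConst c k₁ h k₄ * piConst c h k₂ k₃
      = ∑ h ∈ fib (piWt wt) w, (∑ k₁ ∈ orb G d, ∑ k₄ ∈ orb G b', piConst c k₁ h k₄)
        * ∑ k₂ ∈ orb G a, ∑ k₃ ∈ orb G b, piConst c h k₂ k₃ := by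
    simp only [Finset.sum_comm (t := fib (piWt wt) w), Finset.sum_mul]
    simp only [Finset.mul_sum]
    refine Finset.sum_congr rfl fun h _ => Finset.sum_congr rfl fun k₁ _ => ?_
    simp only [Finset.sum_comm (t := orb G b')]
  rw [orbSum, h1, ← key, Finset.mul_sum]
  refine Finset.sum_congr rfl fun j _ => ?_
  have h2 : ∑ k₁ ∈ orb G d, ∑ h ∈ orb G (r j), ∑ k₄ ∈ orb G b', piConst c k₁ h k₄
      = ∑ h ∈ orb G (r j), ∑ k₁ ∈ orb G d, ∑ k₄ ∈ orb G b', piConst c k₁ h k₄ :=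
    Finset.sum_comm
  rw [orbConst, orbConst, h2]
  push_cast
  simp only [mul_inv]
  ring

/-! ### The axioms for the structure constants of fixed point algebras -/

variable {v : I} (S : IsVertexStructure wt v c)
include S

theorem IsVertexStructure.orbConst_vac_self (h : X → I) :
    orbConst c G h (fun _ => v) h = 1 := by
  classical
  have h1 : ∀ k₁ k₃, piConst c k₁ (fun _ : X => v) k₃ = if k₁ = k₃ then 1 else 0 := by
    intro k₁ k₃
    split_ifs with hk
    · rw [hk]
      exact S.pi.vac_self k₃
    · exact S.pi.vac_ne _ _ hk
  have h0 : (0 : ℝ) < (orb G h).card := by exact_mod_cast orb_card_pos _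
  simp only [orbConst, orb_const, Finset.sum_singleton, h1, Finset.sum_ite_eq, Finset.card_singleton]
  simp only [Finset.sum_ite_mem, Finset.inter_self, Finset.sum_const, nsmul_eq_mul, mul_one,
    Nat.cast_one, Real.sqrt_one, Real.mul_self_sqrt h0.le]
  rw [Complex.ofReal_inv, Complex.ofReal_natCast, inv_mul_cancel₀]
  exact_mod_cast (orb_card_pos h).ne'

theorem IsVertexStructure.orbConst_vac_ne {h h' : X → I} (hh : h' ∉ orb G h) :
    orbConst c G h (fun _ => v) h' = 0 := by
  rw [orbConst, Finset.sum_eq_zero, mul_zero]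
  intro k₁ h₁
  rw [orb_const, Finset.sum_singleton]
  refine Finset.sum_eq_zero fun k₃ h₃ => S.pi.vac_ne _ _ ?_
  rintro rfl
  exact hh (by rw [← orb_eq_of_mem h₁, orb_eq_of_mem h₃]; exact self_mem_orb _)

theorem IsVertexStructure.orbConst_creation_self (h : X → I) :
    orbConst c G h h (fun _ => v) = 1 := by
  classical
  have h0 : (0 : ℝ) < (orb G h).card := by exact_mod_cast orb_card_pos _
  have h1 : ∀ k₁ ∈ orb G h, ∑ k₂ ∈ orb G h, piConst c k₁ k₂ (fun _ : X => v) = 1 := by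
    intro k₁ hk₁
    rw [Finset.sum_eq_single k₁]
    · exact S.pi.creation_self k₁
    · intro k₂ hk₂ hne
      refine S.pi.creation_ne _ _ ?_ hne.symm
      rw [piWt_of_mem_orb hk₁, piWt_of_mem_orb hk₂]
    · exact fun hcon => absurd hk₁ hcon
  simp only [orbConst, orb_const, Finset.sum_singleton, Finset.card_singleton]
  rw [Finset.sum_congr rfl h1]
  simp only [Finset.sum_const, nsmul_eq_mul, mul_one,
    Nat.cast_one, Real.sqrt_one, Real.mul_self_sqrt h0.le]
  rw [Complex.ofReal_inv, Complex.ofReal_natCast, inv_mul_cancel₀]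
  exact_mod_cast (orb_card_pos h).ne'

theorem IsVertexStructure.orbConst_creation_ne {h h' : X → I} (hw : piWt wt h ≤ piWt wt h')
    (hh : h' ∉ orb G h) : orbConst c G h h' (fun _ => v) = 0 := by
  rw [orbConst, Finset.sum_eq_zero, mul_zero]
  intro k₁ h₁
  refine Finset.sum_eq_zero fun k₂ h₂ => ?_
  rw [orb_const, Finset.sum_singleton]
  refine S.pi.creation_ne _ _ (by rwa [piWt_of_mem_orb h₁, piWt_of_mem_orb h₂]) ?_
  rintro rfl
  exact hh (by rw [← orb_eq_of_mem h₁, orb_eq_of_mem h₂]; exact self_mem_orb _)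

theorem IsVertexStructure.orbConst_translation {J' : Type*} {T' : Finset J'} {r' : J' → X → I}
    {d a b : X → I} (hT : IsTransversal G wt T r (piWt wt d - 1))
    (hT' : IsTransversal G wt T' r' (piWt wt b + 1)) :
    ∑ j ∈ T, orbConst c G d (r j) (fun _ => v) * orbConst c G (r j) a b
      - ∑ j ∈ T', orbConst c G d a (r' j) * orbConst c G (r' j) b (fun _ => v)
      = -((piWt wt a : ℂ) + piWt wt b - piWt wt d) * orbConst c G d a b := by
  rw [hT.sum_left S.finite, hT'.sum_right S.finite, orbSum_sub, orbSum_const, orbConst,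
    mul_left_comm]
  congr 1
  simp only [Finset.mul_sum]
  refine Finset.sum_congr rfl fun k₁ h₁ => Finset.sum_congr rfl fun k₂ h₂ =>
    Finset.sum_congr rfl fun k₃ h₃ => ?_
  have := S.pi.translation k₁ k₂ k₃
  rw [piWt_of_mem_orb h₁, piWt_of_mem_orb h₂, piWt_of_mem_orb h₃] at this
  exact this

/-- Orbit average of the locality relations of the tensor power, all raised to a common order `K`
valid for every pair of orbit elements. -/
theorem IsVertexStructure.orbConst_locality {κ : I → I → ℕ}
    (hκ : ∀ a b b' d, LocalAt (κ a b) (wt b' + wt d)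
      (fun k => ∑ i ∈ fib wt k, c d a i * c i b b')
      (fun k => ∑ i ∈ fib wt k, c d b i * c i a b')) {a b b' d : X → I} {K : ℕ}
    (hK : ∀ k ∈ orb G a, ∀ l ∈ orb G b, ∑ x, κ (k x) (l x) ≤ K) {T : ℤ → Finset J} {e s : ℤ}
    (he : e = piWt wt b' + piWt wt d)
    (hT : ∀ j ∈ Finset.range (K + 1), IsTransversal G wt (T (s - j)) r (s - j))
    (hT' : ∀ j ∈ Finset.range (K + 1), IsTransversal G wt (T (e - s + j)) r (e - s + j)) :
    ∑ j ∈ Finset.range (K + 1), ((-1 : ℂ) ^ j * (K.choose j : ℂ)) *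
      (∑ i ∈ T (s - j), orbConst c G d a (r i) * orbConst c G (r i) b b'
        - ∑ i ∈ T (e - s + j), orbConst c G d b (r i) * orbConst c G (r i) a b') = 0 := by
  have h1 : ∀ j ∈ Finset.range (K + 1), ((-1 : ℂ) ^ j * (K.choose j : ℂ)) *
      (∑ i ∈ T (s - j), orbConst c G d a (r i) * orbConst c G (r i) b b'
        - ∑ i ∈ T (e - s + j), orbConst c G d b (r i) * orbConst c G (r i) a b')
      = orbSum G d a b b' fun k₁ k₂ k₃ k₄ => ((-1 : ℂ) ^ j * (K.choose j : ℂ)) *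
        (∑ h ∈ fib (piWt wt) (s - j), piConst c k₁ k₂ h * piConst c h k₃ k₄
          - ∑ h ∈ fib (piWt wt) (e - s + j), piConst c k₁ k₃ h * piConst c h k₂ k₄) := by
    intro j hj
    rw [(hT j hj).sum_right S.finite, (hT' j hj).sum_right S.finite, orbSum_comm d b a,
      orbSum_sub, orbSum_mul_left]
  rw [Finset.sum_congr rfl h1, sum_orbSum,
    orbSum_congr (F' := fun _ _ _ _ => 0) fun k₁ h₁ k₂ h₂ k₃ h₃ k₄ h₄ => ?_]
  · simp [orbSum]
  · have := (S.piConst_locality hκ k₂ k₃ k₄ k₁).mono (hK k₂ h₂ k₃ h₃)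
    rw [piWt_of_mem_orb h₁, piWt_of_mem_orb h₄, ← he] at this
    exact this s

end Composition

/-! ## The limit vertex algebra -/

section Order

variable {I : Type*} {m m' : ℕ} {G : Subgroup (Equiv.Perm (Fin m'))} {v : I} {κ : I → I → ℕ}

/-- The order of locality of two orbit sums is bounded independently of the permutation group. -/
theorem sum_order_le (hκ₁ : ∀ a, κ a v = 0) (hκ₂ : ∀ b, κ v b = 0) {a b : ℕ → I}
    (ha : ∀ j, m ≤ j → a j = v) (hb : ∀ j, m ≤ j → b j = v) {k l : Fin m' → I}
    (hk : k ∈ orb G (restr m' a)) (hl : l ∈ orb G (restr m' b)) :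
    ∑ i, κ (k i) (l i) ≤ ∑ p ∈ Finset.range m ×ˢ Finset.range m, κ (a p.1) (b p.2) := by
  classical
  obtain ⟨σ, -, rfl⟩ := mem_orb.1 hk
  obtain ⟨τ, -, rfl⟩ := mem_orb.1 hl
  -- The permutations matter only through which points of `a` and `b` meet at a site. Distinct sites
  -- give distinct pairs, and a pair outside the square meets a vacuum and costs nothing.
  let φ : Fin m' → ℕ × ℕ := fun i => ((σ⁻¹ i : Fin m'), (τ⁻¹ i : Fin m'))
  have hφ : Function.Injective φ := fun i j h =>
    (σ⁻¹).injective (Fin.ext (congrArg Prod.fst h))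
  calc ∑ i, κ (act σ (restr m' a) i) (act τ (restr m' b) i)
      = ∑ p ∈ Finset.univ.image φ, κ (a p.1) (b p.2) := by
        rw [Finset.sum_image hφ.injOn]
        rfl
    _ ≤ ∑ p ∈ Finset.range m ×ˢ Finset.range m, κ (a p.1) (b p.2) := by
        refine Finset.sum_le_sum_of_ne_zero fun p _ hp => ?_
        rw [Finset.mem_product, Finset.mem_range, Finset.mem_range]
        constructor
        · by_contra hlt
          exact hp (by rw [ha _ (not_lt.1 hlt), hκ₂])
        · by_contra hlt
          exact hp (by rw [hb _ (not_lt.1 hlt), hκ₁])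

end Order

section Limit

variable {V : Type*} [AddCommGroup V] [Module ℂ V] {U : UnitaryVOA V} {ι : Type*}
  {Φ : RealBasis U ι} {x : ℕ → ℕ} {G : ∀ N, Subgroup (Equiv.Perm (Fin (x N)))}
  {B : Set (ℕ → ι)}

namespace IsRepresentativeSystem

variable (hB : IsRepresentativeSystem Φ x G B)
include hB

theorem exists_suppIn {g : ℕ → ι} (hg : g ∈ B) : ∃ m, SuppIn Φ m g := by
  obtain ⟨b, hb⟩ := (hB.finite_supp g hg).bddAbove
  exact ⟨b + 1, suppIn_iff.2 fun j hj => Nat.lt_succ_of_le (hb hj)⟩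

theorem finite_weight (hU : U.IsCFTType) (n : ℕ) : {g : B | weight Φ g.1 = n}.Finite := by
  obtain ⟨N₀, h, -⟩ := hB.exists_stable n
  exact ((finite_suppIn hU (x N₀) n).preimage Subtype.val_injective.injOn).subset
    fun g hg => ⟨h g.1 g.2 hg, hg⟩

/-- The representative of the vacuum orbit has weight zero, and in CFT type only the vacuum index
has weight zero. -/
theorem vac_mem (hU : U.IsCFTType) : (fun _ => Φ.vacIdx) ∈ B := by
  obtain ⟨N₀, h, h'⟩ := hB.exists_stable 0
  obtain ⟨g, ⟨hg, hw, -⟩, -⟩ := h' N₀ le_rfl (fun _ => Φ.vacIdx)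
    (by simp [piWt, Φ.wt_vacIdx hU])
  have hs := h g hg hw
  rw [weight_eq hU hs, piWt, Finset.sum_eq_zero_iff] at hw
  convert hg
  rename_i j
  by_cases hj : j < x N₀
  · exact ((Φ.wt_eq_zero_iff hU).1 (hw ⟨j, hj⟩ (Finset.mem_univ _))).symm
  · exact (hs j (not_lt.1 hj)).symm

theorem eventually_suppIn (hG : NestedOligomorphic Φ x G) {g : ℕ → ι} (hg : g ∈ B) :
    ∀ᶠ N in atTop, SuppIn Φ (x N) g := by
  obtain ⟨m, hm⟩ := hB.exists_suppIn hg
  filter_upwards [hG.tendsto_size.eventually_ge_atTop m] with N hN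
  exact hm.mono hN

theorem eventually_weight_eq (hU : U.IsCFTType) (hG : NestedOligomorphic Φ x G) {g : ℕ → ι}
    (hg : g ∈ B) : ∀ᶠ N in atTop, weight Φ g = piWt Φ.wt (restr (x N) g) := by
  filter_upwards [hB.eventually_suppIn hG hg] with N hN
  exact weight_eq hU hN

/-- Supplies index sets for intermediate states that no longer depend on `N`, so that finite sums
commute with the limit. -/
theorem eventually_isTransversal (hU : U.IsCFTType) (hG : NestedOligomorphic Φ x G) (w : ℤ) :
    ∀ᶠ N in atTop, IsTransversal (G N) Φ.wt (fib (fun g : B => weight Φ g.1) w)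
      (fun g => restr (x N) g.1) w := by
  have hf := hB.finite_weight hU
  rcases lt_or_ge w 0 with hw | hw
  · refine Eventually.of_forall fun N => ⟨fun g hg => ?_, fun h hh => ?_⟩
    · rw [fib_of_neg _ hw] at hg
      exact absurd hg (Finset.notMem_empty g)
    · omega
  lift w to ℕ using hw
  obtain ⟨N₀, h, h'⟩ := hB.exists_stable w
  filter_upwards [eventually_ge_atTop N₀] with N hN
  refine ⟨fun g hg => ?_, fun k hk => ?_⟩
  · rw [mem_fib hf] at hg
    rw [← hg, weight_eq hU ((h g.1 g.2 (by exact_mod_cast hg)).mono (hG.monotone hN))]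
  · obtain ⟨g, ⟨hg, hw, hgk⟩, huniq⟩ := h' N hN k (by exact_mod_cast hk)
    refine ⟨⟨g, hg⟩, ⟨(mem_fib hf).2 (by exact_mod_cast hw), hgk⟩, fun g' hg' => ?_⟩
    exact Subtype.ext (huniq g'.1 ⟨g'.2, by exact_mod_cast (mem_fib hf).1 hg'.1, hg'.2⟩)

theorem eventually_notMem_orb (hU : U.IsCFTType) (hG : NestedOligomorphic Φ x G) {g g' : ℕ → ι}
    (hg : g ∈ B) (hg' : g' ∈ B) (hne : g ≠ g') :
    ∀ᶠ N in atTop, restr (x N) g' ∉ orb (G N) (restr (x N) g) := by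
  filter_upwards [hB.eventually_isTransversal hU hG (weight Φ g),
    hB.eventually_weight_eq hU hG hg, hB.eventually_weight_eq hU hG hg'] with N hN h h' hmem
  have hf := hB.finite_weight hU
  have hw : weight Φ g' = weight Φ g := by rw [h, h', piWt_of_mem_orb hmem]
  have := (hN.existsUnique (restr (x N) g') (by rw [← h', hw])).unique
    (y₁ := ⟨g, hg⟩) (y₂ := ⟨g', hg'⟩) ⟨(mem_fib hf).2 rfl, hmem⟩
    ⟨(mem_fib hf).2 (by rw [hw]), self_mem_orb _⟩
  exact hne (congrArg Subtype.val this)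

theorem exists_limit (hU : U.IsCFTType) (hG : NestedOligomorphic Φ x G)
    (hM : MultiplicitiesConverge x G) : ∃ f : B → B → B → ℂ, ∀ g₁ g₂ g₃ : B,
      Tendsto (fun N => orbConst Φ.structConst (G N) (restr (x N) g₁.1) (restr (x N) g₂.1)
        (restr (x N) g₃.1)) atTop (𝓝 (f g₁ g₂ g₃)) := by
  have h : ∀ g₁ g₂ g₃ : B, ∃ l : ℂ, Tendsto (fun N => orbConst Φ.structConst (G N)
      (restr (x N) g₁.1) (restr (x N) g₂.1) (restr (x N) g₃.1)) atTop (𝓝 l) := by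
    intro g₁ g₂ g₃
    choose m hm using fun g : B => hB.exists_suppIn g.2
    refine exists_tendsto_orbConst hU hG hM (g := ![g₁.1, g₂.1, g₃.1])
      (m := max (m g₁) (max (m g₂) (m g₃))) fun i => ?_
    fin_cases i
    · exact (hm g₁).mono (le_max_left _ _)
    · exact (hm g₂).mono ((le_max_left _ _).trans (le_max_right _ _))
    · exact (hm g₃).mono ((le_max_right _ _).trans (le_max_right _ _))
  choose f hf using h
  exact ⟨f, hf⟩

variable {f : B → B → B → ℂ} (hf : ∀ g₁ g₂ g₃ : B,
  Tendsto (fun N => orbConst Φ.structConst (G N) (restr (x N) g₁.1) (restr (x N) g₂.1)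
    (restr (x N) g₃.1)) atTop (𝓝 (f g₁ g₂ g₃)))
include hf

/-- The limits of the structure constants satisfy the axioms of a vertex algebra. -/
theorem isVertexStructure_limit (hU : U.IsCFTType) (hG : NestedOligomorphic Φ x G) :
    IsVertexStructure (fun g : B => weight Φ g.1) ⟨fun _ => Φ.vacIdx, hB.vac_mem hU⟩ f where
  finite := hB.finite_weight hU
  wt_vac := weight_eq hU (m := 0) fun _ _ => rfl
  vac_self i := by
    refine tendsto_nhds_unique (hf _ _ _) (tendsto_const_nhds.congr fun N => ?_)
    exact ((Φ.isVertexStructure hU).orbConst_vac_self _).symm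
  vac_ne i k h := by
    refine tendsto_nhds_unique (hf _ _ _) (tendsto_const_nhds.congr' ?_)
    filter_upwards [hB.eventually_notMem_orb hU hG i.2 k.2 fun h' => h (Subtype.ext h')] with N hN
    exact ((Φ.isVertexStructure hU).orbConst_vac_ne hN).symm
  creation_self i := by
    refine tendsto_nhds_unique (hf _ _ _) (tendsto_const_nhds.congr fun N => ?_)
    exact ((Φ.isVertexStructure hU).orbConst_creation_self _).symm
  creation_ne i j hle h := by
    refine tendsto_nhds_unique (hf _ _ _) (tendsto_const_nhds.congr' ?_)
    filter_upwards [hB.eventually_notMem_orb hU hG i.2 j.2 fun h' => h (Subtype.ext h'),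
      hB.eventually_weight_eq hU hG i.2, hB.eventually_weight_eq hU hG j.2] with N hN h₁ h₂
    exact ((Φ.isVertexStructure hU).orbConst_creation_ne (by rwa [← h₁, ← h₂]) hN).symm
  translation d a b := by
    refine tendsto_nhds_unique_of_eventuallyEq
      ((tendsto_finsetSum _ fun i _ => (hf _ _ _).mul (hf _ _ _)).sub
        (tendsto_finsetSum _ fun i _ => (hf _ _ _).mul (hf _ _ _))) ((hf _ _ _).const_mul _) ?_
    filter_upwards [hB.eventually_isTransversal hU hG (weight Φ d.1 - 1),
      hB.eventually_isTransversal hU hG (weight Φ b.1 + 1), hB.eventually_weight_eq hU hG a.2,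
      hB.eventually_weight_eq hU hG b.2, hB.eventually_weight_eq hU hG d.2] with N h₁ h₂ ha hb hd
    have := (Φ.isVertexStructure hU).orbConst_translation (a := restr (x N) a.1)
      (b := restr (x N) b.1) (d := restr (x N) d.1) (hd ▸ h₁) (hb ▸ h₂)
    rw [← ha, ← hb, ← hd] at this
    exact this
  locality a b := by
    have S := Φ.isVertexStructure hU
    obtain ⟨κ, hκ₁, hκ₂, hκ⟩ := S.exists_order
    obtain ⟨m₁, hm₁⟩ := hB.exists_suppIn a.2
    obtain ⟨m₂, hm₂⟩ := hB.exists_suppIn b.2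
    set m := max m₁ m₂
    -- The order must be fixed before the limit is taken; this value bounds the orders at all `N`.
    set K := ∑ p ∈ Finset.range m ×ˢ Finset.range m, κ (a.1 p.1) (b.1 p.2)
    refine ⟨K, fun b' d s => ?_⟩
    have hlim : Tendsto (fun N => ∑ j ∈ Finset.range (K + 1), ((-1 : ℂ) ^ j * (K.choose j : ℂ)) *
        (∑ i ∈ fib (fun g : B => weight Φ g.1) (s - j),
          orbConst Φ.structConst (G N) (restr (x N) d.1) (restr (x N) a.1) (restr (x N) i.1)
            * orbConst Φ.structConst (G N) (restr (x N) i.1) (restr (x N) b.1) (restr (x N) b'.1)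
        - ∑ i ∈ fib (fun g : B => weight Φ g.1) (weight Φ b'.1 + weight Φ d.1 - s + j),
          orbConst Φ.structConst (G N) (restr (x N) d.1) (restr (x N) b.1) (restr (x N) i.1)
            * orbConst Φ.structConst (G N) (restr (x N) i.1) (restr (x N) a.1) (restr (x N) b'.1)))
        atTop (𝓝 (∑ j ∈ Finset.range (K + 1), ((-1 : ℂ) ^ j * (K.choose j : ℂ)) *
        (∑ i ∈ fib (fun g : B => weight Φ g.1) (s - j), f d a i * f i b b'
        - ∑ i ∈ fib (fun g : B => weight Φ g.1) (weight Φ b'.1 + weight Φ d.1 - s + j),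
          f d b i * f i a b'))) :=
      tendsto_finsetSum _ fun j _ => Tendsto.const_mul _
        ((tendsto_finsetSum _ fun i _ => (hf _ _ _).mul (hf _ _ _)).sub
          (tendsto_finsetSum _ fun i _ => (hf _ _ _).mul (hf _ _ _)))
    refine tendsto_nhds_unique hlim (tendsto_const_nhds.congr' ?_)
    -- Only finitely many intermediate weights occur, so one threshold in `N` serves all of them.
    filter_upwards [(Finset.range (K + 1)).eventually_all.2 fun j _ =>
        hB.eventually_isTransversal hU hG (s - j), (Finset.range (K + 1)).eventually_all.2 fun j _ =>
        hB.eventually_isTransversal hU hG (weight Φ b'.1 + weight Φ d.1 - s + j),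
      hB.eventually_weight_eq hU hG b'.2, hB.eventually_weight_eq hU hG d.2] with N h₁ h₂ hb' hd
    symm
    exact S.orbConst_locality hκ (fun k hk l hl => sum_order_le hκ₁ hκ₂
      (hm₁.mono (le_max_left _ _)) (hm₂.mono (le_max_right _ _)) hk hl) (by rw [hb', hd]) h₁ h₂

theorem isLargeNLimit (hU : U.IsCFTType) (hG : NestedOligomorphic Φ x G) :
    IsLargeNLimit Φ x G B f (hB.isVertexStructure_limit hf hU hG).vertexAlgebra where
  orthonormal n := by
    filter_upwards [hB.eventually_isTransversal hU hG n] with N hN g hg g' hg' hw hw'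
    have hfin := hB.finite_weight hU
    refine ⟨fun h => h ▸ tensorForm_fixedState_self Φ (G N) g,
      fun hne => tensorForm_fixedState_of_notMem Φ (G N) fun hmem => hne ?_⟩
    have h₁ : (⟨g, hg⟩ : B) ∈ fib (fun g : B => weight Φ g.1) n := (mem_fib hfin).2 (by rw [hw])
    have h₂ : (⟨g', hg'⟩ : B) ∈ fib (fun g : B => weight Φ g.1) n := (mem_fib hfin).2 (by rw [hw'])
    exact congrArg Subtype.val ((hN.existsUnique _ (hN.weight_eq _ h₂)).unique ⟨h₁, hmem⟩
      ⟨h₂, self_mem_orb _⟩)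
  span_eq n := by
    filter_upwards [hB.eventually_isTransversal hU hG n] with N hN
    have hfin := hB.finite_weight hU
    refine le_antisymm (Submodule.span_le.2 ?_) ?_
    · rintro _ ⟨g, hg, hw, rfl⟩
      have := hN.weight_eq ⟨g, hg⟩ ((mem_fib hfin).2 (by rw [hw]))
      rw [← this]
      exact fixedState_mem Φ (G N) g
    · refine (inf_le_span_fixedState Φ (G N) n (s := {g | g ∈ B ∧ weight Φ g = n})
        fun h hh => ?_).trans (Submodule.span_mono ?_)
      · obtain ⟨g, ⟨hg, hgh⟩, -⟩ := hN.existsUnique h (by rw [hh])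
        exact ⟨g.1, ⟨g.2, by exact_mod_cast (mem_fib hfin).1 hg⟩, hgh⟩
      · rintro _ ⟨g, ⟨hg, hw⟩, rfl⟩
        exact ⟨g, hg, hw, rfl⟩
  tendsto g₁ g₂ g₃ := by
    refine (hf g₁ g₂ g₃).congr' ?_
    filter_upwards [hB.eventually_weight_eq hU hG g₁.2, hB.eventually_weight_eq hU hG g₂.2,
      hB.eventually_weight_eq hU hG g₃.2] with N h₁ h₂ h₃
    exact (structureConstant_eq Φ (G N) h₁ h₂ h₃).symm
  vac_eq := ⟨hB.vac_mem hU, rfl⟩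
  mode_eq g₁ g₂ g₃ n := by
    rw [IsVertexStructure.vertexAlgebra_mode, modeMap_single_apply _ (hB.finite_weight hU)]
    exact ⟨fun h => if_pos h, fun h => if_neg h⟩

end IsRepresentativeSystem

end Limit

theorem mainTheorem5 {V : Type*} [AddCommGroup V] [Module ℂ V] (U : UnitaryVOA V)
    (hU : U.IsCFTType) {ι : Type*} (Φ : RealBasis U ι) (x : ℕ → ℕ)
    (G : ∀ N, Subgroup (Equiv.Perm (Fin (x N)))) (hG : NestedOligomorphic Φ x G)
    (hM : MultiplicitiesConverge x G) :
    HasLargeNLimit Φ x G := by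
  refine ⟨hG.exists_representatives hU, fun B hB => ?_⟩
  obtain ⟨f, hf⟩ := hB.exists_limit hU hG hM
  exact ⟨f, _, hB.isLargeNLimit hf hU hG⟩

end
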